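/- Let $a_1,a_2,a_3$ be three distinct points of $\mathbb{CP}^1=\mathbb{C}\cup\{\infty\}$ and let $X=\mathbb{CP}^1\setminus\{a_1,a_2,a_3\}$. Let $\lambda=(\theta_2/\theta_3)^4$ be the modular $\lambda$-function on the upper half plane $\mathbb{H}$, where $\theta_2(\tau)=\sum_{n\in\mathbb{Z}}e^{\pi i(n+1/2)^2\tau}$ and $\theta_3(\tau)=\sum_{n\in\mathbb{Z}}e^{\pi i n^2\tau}$, and let $q_2=e^{\pi i\tau}$. If one of the $a_j$ is $\infty$, the formulas below are read as limits for $a_j\to\infty$. (1) The map $$f(\tau)=\frac{a_1(a_2-a_3)-a_3(a_2-a_1)\lambda(\tau)}{(a_2-a_3)-(a_2-a_1)\lambda(\tau)}$$ is a holomorphic (universal) covering map $\mathbb{H}\to X$. Its fibres are the orbits of $\Gamma(2)$, and it takes the values $a_1,a_2,a_3$ at the cusps $\infty,0,1$, as limits for $\operatorname{Im}\tau\to\infty$ and for vertical approach to $0$ and to $1$. It is the only holomorphic covering map $\mathbb{H}\to X$ with these two properties. (2) There is exactly one complete Kähler–Einstein metric $|ds|$ on $X$, normalized to Gauss curvature $-1$.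 (3) Suppose that $a_1\neq\infty$, and put $$A=16\,\frac{(a_1-a_3)(a_2-a_1)}{a_2-a_3},\qquad B=128(a_1-a_3)\left[2\frac{(a_2-a_1)^2}{(a_2-a_3)^2}-\frac{a_2-a_1}{a_2-a_3}\right].$$ Then $A\neq 0$, and as $\operatorname{Im}\tau\to\infty$ the map $f$ is finite and $$f(\tau)=a_1+A\,q_2+B\,q_2^2+O(q_2^3).$$ Write $f$ also for the standard coordinate of $\mathbb{C}$, and put $$\mathfrak{f}=\frac{f-a_1}{A}=\frac{(a_2-a_3)(f-a_1)}{16(a_1-a_3)(a_2-a_1)},\qquad c=2\,\frac{a_2-a_1}{a_2-a_3}-1.$$ Then the metric of (2) satisfies, as $f\to a_1$, $$|ds|=\frac{|a_2-a_3|}{16\,|a_1-a_3|\,|a_2-a_1|}\cdot\frac{1}{|\mathfrak{f}|\,\bigl|\log|\mathfrak{f}|\bigr|}\left|1-8\left[c\,\mathfrak{f}-\frac{\operatorname{Re}(c\,\mathfrak{f})}{\log|\mathfrak{f}|}\right]+O(\mathfrak{f}^2)\right||df|.$$ -/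

import Mathlib

open Filter Topology Asymptotics
open UpperHalfPlane (atImInfty ofComplex)
open scoped UpperHalfPlane
open scoped ContDiff ENNReal

noncomputable section

namespace PuncturedSphere

/-! ### The Riemann sphere `ℂℙ¹ = ℂ ∪ {∞}`

The sphere is `OnePoint ℂ` with its two standard holomorphic coordinates, `z` away from `∞` and
`w = 1/z` away from `0`. -/

/-- The coordinate `z` on `ℂℙ¹ ∖ {∞}` (with the dummy value `0` at `∞`). -/
def zCoord : OnePoint ℂ → ℂ
  | some z => z
  | none => 0

/-- The coordinate `w = 1/z` on `ℂℙ¹ ∖ {0}` (with the dummy value `0⁻¹ = 0` at the point `0`). -/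
def wCoord : OnePoint ℂ → ℂ
  | some z => z⁻¹
  | none => 0

/-- The point `[x : y] = x / y` of `ℂℙ¹`, where `[x : 0] = ∞`. -/
def hpt (x y : ℂ) : OnePoint ℂ := if y = 0 then OnePoint.infty else ((x / y : ℂ) : OnePoint ℂ)

/-- First homogeneous coordinate of a point: `z = [z : 1]`, `∞ = [1 : 0]`. -/
def hx : OnePoint ℂ → ℂ
  | some z => z
  | none => 1

/-- Second homogeneous coordinate of a point: `z = [z : 1]`, `∞ = [1 : 0]`. -/
def hy : OnePoint ℂ → ℂ
  | some _ => 1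
  | none => 0

/-- The difference `p - q` of two points of `ℂℙ¹`, in homogeneous coordinates. For finite points it
is the usual difference (see `diff_coe`). -/
def diff (p q : OnePoint ℂ) : ℂ := hx p * hy q - hx q * hy p

@[simp] theorem zCoord_coe (z : ℂ) : zCoord (z : OnePoint ℂ) = z := rfl
@[simp] theorem wCoord_coe (z : ℂ) : wCoord (z : OnePoint ℂ) = z⁻¹ := rfl
@[simp] theorem wCoord_infty : wCoord OnePoint.infty = 0 := rfl
@[simp] theorem hx_coe (z : ℂ) : hx (z : OnePoint ℂ) = z := rfl
@[simp] theorem hx_infty : hx OnePoint.infty = 1 := rfl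
@[simp] theorem hy_coe (z : ℂ) : hy (z : OnePoint ℂ) = 1 := rfl
@[simp] theorem hy_infty : hy OnePoint.infty = 0 := rfl
@[simp] theorem diff_coe (z w : ℂ) : diff (z : OnePoint ℂ) (w : OnePoint ℂ) = z - w := by
  simp [diff]

/-! ### The modular function `λ` and its Möbius transform -/

/-- The theta constant `θ₂(τ) = ∑ₙ exp(π i (n + 1/2)² τ)`. -/
def theta2 (τ : ℂ) : ℂ := ∑' n : ℤ, Complex.exp (Real.pi * Complex.I * ((n : ℂ) + 1 / 2) ^ 2 * τ)

/-- The modular function `λ = (θ₂ / θ₃)⁴`, where `θ₃(τ) = ∑ₙ exp(π i n² τ)` is `jacobiTheta`. -/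
def modularLambda (τ : ℍ) : ℂ := (theta2 τ / jacobiTheta τ) ^ 4

/-- The local parameter `q₂ = exp(π i τ)`. -/
def q2 (τ : ℍ) : ℂ := Complex.exp (Real.pi * Complex.I * τ)

/-- The Möbius transform
`(a₁ (a₂ - a₃) - a₃ (a₂ - a₁) λ) / ((a₂ - a₃) - (a₂ - a₁) λ)` of the modular function `λ`,
written in homogeneous coordinates, so that one of the `aⱼ` may be `∞`. -/
def coverMap (a₁ a₂ a₃ : OnePoint ℂ) (τ : ℍ) : OnePoint ℂ :=
  hpt (hx a₁ * diff a₂ a₃ - hx a₃ * diff a₂ a₁ * modularLambda τ)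
    (hy a₁ * diff a₂ a₃ - hy a₃ * diff a₂ a₁ * modularLambda τ)

/-- For finite points `coverMap` is the usual Möbius transform of `λ`. -/
theorem coverMap_coe (a₁ a₂ a₃ : ℂ) (τ : ℍ) :
    coverMap a₁ a₂ a₃ τ = hpt (a₁ * (a₂ - a₃) - a₃ * (a₂ - a₁) * modularLambda τ)
      ((a₂ - a₃) - (a₂ - a₁) * modularLambda τ) := by
  simp [coverMap]

/-- The ratio `(a₂ - a₁) / (a₂ - a₃)` for `a₁ ∈ ℂ`; it is `1` if `a₂ = ∞` and `0` if `a₃ = ∞`. -/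
def ratio (a₁ a₂ a₃ : OnePoint ℂ) : ℂ := diff a₂ a₁ * hy a₃ / diff a₂ a₃

/-- The coefficient `A = 16 (a₁ - a₃) (a₂ - a₁) / (a₂ - a₃)` for `a₁ ∈ ℂ`; it is `16 (a₁ - a₃)` if
`a₂ = ∞` and `16 (a₂ - a₁)` if `a₃ = ∞`. -/
def coeffA (a₁ a₂ a₃ : OnePoint ℂ) : ℂ := 16 * (diff a₁ a₃ * diff a₂ a₁ / diff a₂ a₃)

/-- The coefficient `B = 128 (a₁ - a₃) [2 (a₂ - a₁)² / (a₂ - a₃)² - (a₂ - a₁) / (a₂ - a₃)]`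
for `a₁ ∈ ℂ`, with the factor `(a₁ - a₃) (a₂ - a₁) / (a₂ - a₃)` taken out. -/
def coeffB (a₁ a₂ a₃ : OnePoint ℂ) : ℂ :=
  128 * (diff a₁ a₃ * diff a₂ a₁ / diff a₂ a₃) * (2 * ratio a₁ a₂ a₃ - 1)

theorem ratio_coe (a₁ a₂ a₃ : ℂ) :
    ratio a₁ a₂ a₃ = (a₂ - a₁) / (a₂ - a₃) := by
  simp [ratio]

theorem coeffA_coe (a₁ a₂ a₃ : ℂ) :
    coeffA a₁ a₂ a₃ = 16 * ((a₁ - a₃) * (a₂ - a₁) / (a₂ - a₃)) := by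
  simp [coeffA]

theorem coeffB_coe (a₁ a₂ a₃ : ℂ) :
    coeffB a₁ a₂ a₃ =
      128 * (a₁ - a₃) * (2 * ((a₂ - a₁) ^ 2 / (a₂ - a₃) ^ 2) - (a₂ - a₁) / (a₂ - a₃)) := by
  simp only [coeffB, ratio_coe, diff_coe]
  rw [← div_pow]
  ring

/-! ### Holomorphic coverings by the upper half plane -/

/-- `f : ℍ → ℂℙ¹` is holomorphic: it is continuous, and complex differentiable when read in the
coordinate `z` of the sphere at points not mapped to `∞`, and in `w = 1/z` at points mapped to
`∞`. -/
def IsHolomorphic (f : ℍ → OnePoint ℂ) : Prop :=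
  Continuous f ∧ ∀ τ : ℍ,
    (f τ ≠ OnePoint.infty → DifferentiableAt ℂ (fun z : ℂ => zCoord (f (ofComplex z))) τ) ∧
    (f τ = OnePoint.infty → DifferentiableAt ℂ (fun z : ℂ => wCoord (f (ofComplex z))) τ)

/-- `f : ℍ → X` is a holomorphic covering map onto `X ⊆ ℂℙ¹` (a universal one, since `ℍ` is
simply connected). -/
structure IsHolomorphicCovering (X : Set (OnePoint ℂ)) (f : ℍ → OnePoint ℂ) : Prop where
  holomorphic : IsHolomorphic f
  range_eq : Set.range f = X
  covering : IsCoveringMap (Set.codRestrict f X fun τ => range_eq ▸ Set.mem_range_self τ)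

/-- The fibres of `f` are the orbits of the principal congruence subgroup `Γ(2)`. For a universal
covering this says that its group of deck transformations is (the image of) `Γ(2)`. -/
def FibresAreGammaTwoOrbits (f : ℍ → OnePoint ℂ) : Prop :=
  ∀ τ τ' : ℍ, f τ = f τ' ↔ ∃ γ ∈ CongruenceSubgroup.Gamma 2, γ • τ = τ'

/-- `f` takes the values `a₁, a₂, a₃` at the cusps `∞, 0, 1`, as limits: for `Im τ → ∞`, and for
vertical approach to `0` and `1`. -/
def HasCuspValues (f : ℍ → OnePoint ℂ) (a₁ a₂ a₃ : OnePoint ℂ) : Prop :=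
  Tendsto f atImInfty (𝓝 a₁) ∧
  Tendsto (fun y : ℝ => f (ofComplex (y * Complex.I))) (𝓝[>] 0) (𝓝 a₂) ∧
  Tendsto (fun y : ℝ => f (ofComplex (1 + y * Complex.I))) (𝓝[>] 0) (𝓝 a₃)

/-! ### Conformal metrics

A conformal metric on an open set `X` of the sphere is given by one function `ρ`: it is
`|ds| = ρ(z) |dz|` at the finite points `z` of `X`, and `|ds| = ρ(∞) |dw|`, `w = 1/z`, at `∞`.
In complex dimension one every such metric is Kähler. -/

/-- The density of the metric `ρ` in the coordinate `w = 1/z`: since `|dz| = |dw| / |w|²`, it is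
`ρ(1/w) / |w|²` for `w ≠ 0`. -/
def wDensity (ρ : OnePoint ℂ → ℝ) (w : ℂ) : ℝ :=
  if w = 0 then ρ OnePoint.infty else ρ ((w⁻¹ : ℂ) : OnePoint ℂ) / ‖w‖ ^ 2

/-- The curve `γ` in the sphere is continuously differentiable near the time `t`. -/
def IsC1At (γ : ℝ → OnePoint ℂ) (t : ℝ) : Prop :=
  ContinuousAt γ t ∧
  (γ t ≠ OnePoint.infty → ContDiffAt ℝ 1 (fun s => zCoord (γ s)) t) ∧
  (γ t = OnePoint.infty → ContDiffAt ℝ 1 (fun s => wCoord (γ s)) t)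

open Classical in
/-- The speed `|ds|/dt` of the curve `γ` at the time `t` in the metric `ρ`. -/
def speed (ρ : OnePoint ℂ → ℝ) (γ : ℝ → OnePoint ℂ) (t : ℝ) : ℝ :=
  if γ t = OnePoint.infty then ρ (γ t) * ‖deriv (fun s => wCoord (γ s)) t‖
  else ρ (γ t) * ‖deriv (fun s => zCoord (γ s)) t‖

/-- `γ`, restricted to `[0, 1]`, is a continuously differentiable curve in `X` from `p` to `q`. -/
structure IsCurve (X : Set (OnePoint ℂ)) (p q : OnePoint ℂ) (γ : ℝ → OnePoint ℂ) : Prop where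
  source : γ 0 = p
  target : γ 1 = q
  mem : ∀ t ∈ Set.Icc (0 : ℝ) 1, γ t ∈ X
  isC1 : ∀ t ∈ Set.Icc (0 : ℝ) 1, IsC1At γ t

/-- The length of `γ`, restricted to `[0, 1]`, in the metric `ρ`. -/
def length (ρ : OnePoint ℂ → ℝ) (γ : ℝ → OnePoint ℂ) : ℝ≥0∞ :=
  ∫⁻ t in Set.Icc (0 : ℝ) 1, ENNReal.ofReal (speed ρ γ t)

/-- The distance of `p` and `q` in `X` for the metric `ρ`: the infimum of the lengths of the curves
in `X` that join them. -/
def pathDist (X : Set (OnePoint ℂ)) (ρ : OnePoint ℂ → ℝ) (p q : OnePoint ℂ) : ℝ≥0∞ :=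
  ⨅ (γ : ℝ → OnePoint ℂ) (_ : IsCurve X p q γ), length ρ γ

/-- The metric `ρ` on `X` is complete: each sequence in `X` that is Cauchy for its distance
converges in `X`. -/
def IsCompleteMetric (X : Set (OnePoint ℂ)) (ρ : OnePoint ℂ → ℝ) : Prop :=
  ∀ u : ℕ → OnePoint ℂ, (∀ n, u n ∈ X) →
    (∀ ε : ℝ≥0∞, 0 < ε → ∃ N, ∀ m ≥ N, ∀ n ≥ N, pathDist X ρ (u m) (u n) < ε) →
    ∃ p ∈ X, Tendsto u atTop (𝓝 p)

/-- `ρ` is a complete Kähler–Einstein metric on the open set `X` of the sphere: a smooth conformal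
metric which is complete and has constant Gauss curvature `-1`. The curvature of `ρ |dz|` is
`-Δ (log ρ) / ρ²`. -/
structure IsCompleteKE (X : Set (OnePoint ℂ)) (ρ : OnePoint ℂ → ℝ) : Prop where
  pos : ∀ p ∈ X, 0 < ρ p
  smooth : ∀ z : ℂ, (z : OnePoint ℂ) ∈ X → ContDiffAt ℝ ∞ (fun z : ℂ => ρ z) z
  smooth_infty : OnePoint.infty ∈ X → ContDiffAt ℝ ∞ (wDensity ρ) 0
  curvature : ∀ z : ℂ, (z : OnePoint ℂ) ∈ X →
    -Laplacian.laplacian (fun z : ℂ => Real.log (ρ z)) z / ρ z ^ 2 = -1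
  curvature_infty : OnePoint.infty ∈ X →
    -Laplacian.laplacian (fun w : ℂ => Real.log (wDensity ρ w)) 0 / wDensity ρ 0 ^ 2 = -1
  complete : IsCompleteMetric X ρ

end PuncturedSphere

end

open PuncturedSphere

noncomputable section

namespace PuncturedSphere

/-! ### The Laplacian on the complex plane -/

/-! `coverMap` is a Möbius transformation applied to λ, the one that sends 0, 1, ∞ to a₁, a₂, a₃. So
the covering statement concerns λ : ℍ → ℂ ∖ {0, 1}. Splitting double theta series by parity gives
Jacobi's identity and the doubling formulas. These show that no theta constant vanishes on ℍ, hence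
λ omits 0 and 1. Under the generators S and T of the modular group λ becomes 1 - λ and λ/(λ - 1), so
it is Γ(2)-invariant. The function λ'/(λ θ₄⁴) is invariant under the whole modular group and tends
to πi at the cusp, so the maximum principle makes it constant (`lamRatio_eq`); thus λ' never
vanishes. The absolute invariant shows that λ is proper modulo Γ(2). Together with the connectedness
of ℂ ∖ {0, 1} this gives surjectivity (`exists_lam_eq`) and identifies the fibres with the
Γ(2)-orbits (`exists_smul_eq_of_lam_eq`). A subgroup with the same orbits acts freely and properly
discontinuously, so the map is a covering.

For uniqueness, a second map with the same fibres and cusp values is, up to the Möbius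
transformation, φ ∘ λ with φ injective and holomorphic on ℂ ∖ {0, 1}. The isolated singularities of
φ are removable on the sphere, φ fixes 0, 1, ∞, and Liouville's theorem gives φ = id
(`eq_id_of_injective`).

The complete metric is the image of |dτ| / Im τ. Its curvature is a local conformal invariant, and
its completeness follows by lifting Cauchy sequences to ℍ. Conversely, let a complete metric of
curvature -1 be pulled back to ℍ. By the Ahlfors–Schwarz lemma it is at most the hyperbolic metric,
so the `defect`, the logarithm of the quotient, is nonnegative; it is also subharmonic and
Γ(2)-invariant. Completeness enters only at the cusps: an exponentially decaying density would put
the cusp at finite distance (`not_exponential_decay`), and maximum and mean value principles turn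
this into a defect that is o(Im τ) at every cusp. The modular invariant function `barrier` grows at
least like Im τ there and has Laplacian 6 / (Im τ)². Hence a positive value of defect - ε · barrier
forces a maximum, where the curvature equation bounds the defect (`defect_le_barrier`). Letting ε →
0 shows that the defect is zero.

The expansions come from λ = 16 q (1 - 8 q + ...), read off the theta series. It gives f = a + A q
W(q) with W analytic and W(0) = 1. Since the metric pulls back to |dτ| / Im τ and Im τ = -log|q| /
π, its density at f is explicit in q; inverting F = q W(q) and expanding to first order gives the
stated form (`isBigO_cusp_quotient`, `exists_density_expansion`). -/

open Laplacian InnerProductSpace in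
theorem laplacian_eq_fderiv_fderiv (u : ℂ → ℝ) (z : ℂ) :
    laplacian u z = fderiv ℝ (fderiv ℝ u) z 1 1 +
      fderiv ℝ (fderiv ℝ u) z Complex.I Complex.I := by
  rw [laplacian_eq_iteratedFDeriv_complexPlane]
  simp [iteratedFDeriv_two_apply]

theorem ContDiffAt.differentiableAt_fderiv_real {u : ℂ → ℝ} {z : ℂ} (hu : ContDiffAt ℝ 2 u z) :
    DifferentiableAt ℝ (fderiv ℝ u) z :=
  (hu.fderiv_right (m := 1) (by norm_num)).differentiableAt (by norm_num)

/-- The second directional derivative, computed along the line. -/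
theorem hasDerivAt_fderiv_line {u : ℂ → ℝ} {z : ℂ} (hu : ContDiffAt ℝ 2 u z) (v : ℂ) :
    HasDerivAt (fun t : ℝ => fderiv ℝ u (z + t * v) v) (fderiv ℝ (fderiv ℝ u) z v v) 0 := by
  have h1 : HasFDerivAt (fderiv ℝ u) (fderiv ℝ (fderiv ℝ u) z) (z + ((0 : ℝ) : ℂ) * v) := by
    simpa using (ContDiffAt.differentiableAt_fderiv_real hu).hasFDerivAt
  have h2 : HasDerivAt (fun t : ℝ => z + t * v) v 0 := by
    simpa using ((Complex.ofRealCLM.hasDerivAt (x := (0 : ℝ))).mul_const v).const_add z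
  have h3 := h1.comp_hasDerivAt (0 : ℝ) h2
  simpa using h3.clm_apply (hasDerivAt_const (0 : ℝ) v)

theorem eventually_hasDerivAt_line {u : ℂ → ℝ} {z : ℂ} (hu : ContDiffAt ℝ 2 u z) (v : ℂ) :
    ∀ᶠ t : ℝ in 𝓝 0, HasDerivAt (fun t : ℝ => u (z + t * v)) (fderiv ℝ u (z + t * v) v) t := by
  have hc : Tendsto (fun t : ℝ => z + t * v) (𝓝 0) (𝓝 z) := by
    have : Continuous (fun t : ℝ => z + t * v) := by fun_prop
    simpa using this.tendsto 0
  have h := hc.eventually (hu.eventually (by simp))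
  filter_upwards [h] with t ht
  have h2 : HasDerivAt (fun t : ℝ => z + t * v) v t := by
    simpa using ((Complex.ofRealCLM.hasDerivAt (x := t)).mul_const v).const_add z
  exact (ht.differentiableAt (by norm_num)).hasFDerivAt.comp_hasDerivAt t h2

/-- The Laplacian from the second derivatives along the coordinate axes. -/
theorem laplacian_eq_of_hasDerivAt {u : ℂ → ℝ} {z : ℂ} (hu : ContDiffAt ℝ 2 u z)
    {a b : ℝ → ℝ} {a' b' : ℝ}
    (ha : ∀ᶠ t : ℝ in 𝓝 0, HasDerivAt (fun t : ℝ => u (z + t)) (a t) t)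
    (ha' : HasDerivAt a a' 0)
    (hb : ∀ᶠ t : ℝ in 𝓝 0, HasDerivAt (fun t : ℝ => u (z + t * Complex.I)) (b t) t)
    (hb' : HasDerivAt b b' 0) : Laplacian.laplacian u z = a' + b' := by
  rw [laplacian_eq_fderiv_fderiv]
  congr 1
  · refine (hasDerivAt_fderiv_line hu 1).unique (ha'.congr_of_eventuallyEq ?_)
    filter_upwards [ha, eventually_hasDerivAt_line hu 1] with t h1 h2
    simp only [mul_one] at h2 ⊢
    exact h2.unique h1
  · refine (hasDerivAt_fderiv_line hu Complex.I).unique (hb'.congr_of_eventuallyEq ?_)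
    filter_upwards [hb, eventually_hasDerivAt_line hu Complex.I] with t h1 h2
    exact h2.unique h1

/-- A positive second derivative would make the point a local minimum on the line as well; then the
function would be constant there and its second derivative zero. -/
theorem secondDeriv_nonpos_of_isLocalMax {u : ℂ → ℝ} {z : ℂ} (hu : ContDiffAt ℝ 2 u z)
    (hm : IsLocalMax u z) (v : ℂ) : fderiv ℝ (fderiv ℝ u) z v v ≤ 0 := by
  by_contra! hpos
  set φ : ℝ → ℝ := fun t => u (z + t * v) with hφ
  have hd := eventually_hasDerivAt_line hu v
  have hderiv : deriv φ =ᶠ[𝓝 0] fun t => fderiv ℝ u (z + t * v) v :=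
    hd.mono fun t ht => ht.deriv
  have h2 : HasDerivAt (deriv φ) (fderiv ℝ (fderiv ℝ u) z v v) 0 :=
    (hasDerivAt_fderiv_line hu v).congr_of_eventuallyEq hderiv
  have hc : Tendsto (fun t : ℝ => z + t * v) (𝓝 0) (𝓝 z) := by
    have : Continuous (fun t : ℝ => z + t * v) := by fun_prop
    simpa using this.tendsto 0
  have hmax : IsLocalMax φ 0 := by
    have := hc.eventually hm
    filter_upwards [this] with t ht
    simpa [hφ] using ht
  have hmin : IsLocalMin φ 0 :=
    isLocalMin_of_deriv_deriv_pos (by rw [h2.deriv]; exact hpos) hmax.deriv_eq_zero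
      hd.self_of_nhds.continuousAt
  have heq : φ =ᶠ[𝓝 0] fun _ => φ 0 := by
    filter_upwards [hmax, hmin] with t h1 h2 using le_antisymm h1 h2
  have h3 : deriv φ =ᶠ[𝓝 0] fun _ => 0 := by
    simpa using heq.deriv
  have h4 := h3.deriv_eq
  rw [h2.deriv] at h4
  simp at h4
  exact hpos.ne' h4

theorem laplacian_nonpos_of_isLocalMax {u : ℂ → ℝ} {z : ℂ} (hu : ContDiffAt ℝ 2 u z)
    (hm : IsLocalMax u z) : Laplacian.laplacian u z ≤ 0 := by
  rw [laplacian_eq_fderiv_fderiv]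
  exact add_nonpos (secondDeriv_nonpos_of_isLocalMax hu hm 1)
    (secondDeriv_nonpos_of_isLocalMax hu hm Complex.I)

/-- Conformal transformation of the Laplacian. -/
theorem laplacian_comp_analyticAt {u : ℂ → ℝ} {g : ℂ → ℂ} {z : ℂ} (hg : AnalyticAt ℂ g z)
    (hu : ContDiffAt ℝ 2 u (g z)) :
    Laplacian.laplacian (fun x => u (g x)) z =
      ‖deriv g z‖ ^ 2 * Laplacian.laplacian u (g z) := by
  have hev : ∀ᶠ x in 𝓝 z, ∀ v, fderiv ℝ (fun x => u (g x)) x v =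
      fderiv ℝ u (g x) (deriv g x * v) := by
    filter_upwards [hg.eventually_analyticAt,
      hg.continuousAt.eventually (hu.eventually (by simp))] with x h1 h2 v
    have h3 : HasFDerivAt g (deriv g x • (1 : ℂ →L[ℝ] ℂ)) x :=
      h1.differentiableAt.hasDerivAt.complexToReal_fderiv
    change fderiv ℝ (u ∘ g) x v = _
    rw [((h2.differentiableAt (by norm_num)).hasFDerivAt.comp x h3).fderiv]
    simp
  have hu1 : HasFDerivAt (fderiv ℝ u) (fderiv ℝ (fderiv ℝ u) (g z)) (g z) :=
    (ContDiffAt.differentiableAt_fderiv_real hu).hasFDerivAt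
  have hg1 : HasFDerivAt g (deriv g z • (1 : ℂ →L[ℝ] ℂ)) z :=
    hg.differentiableAt.hasDerivAt.complexToReal_fderiv
  have hg2 : HasFDerivAt (deriv g) (deriv (deriv g) z • (1 : ℂ →L[ℝ] ℂ)) z :=
    hg.deriv.differentiableAt.hasDerivAt.complexToReal_fderiv
  have hcd : ContDiffAt ℝ 2 (fun x => u (g x)) z :=
    hu.comp z ((hg.contDiffAt (n := 2)).restrict_scalars ℝ)
  -- Chain rule for the Hessian. The last term depends on v only through v², so it changes sign
  -- between v = 1 and v = i and drops out of the Laplacian.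
  have key : ∀ v, fderiv ℝ (fderiv ℝ (fun x => u (g x))) z v v =
      fderiv ℝ (fderiv ℝ u) (g z) (deriv g z * v) (deriv g z * v) +
        fderiv ℝ u (g z) (deriv (deriv g) z * (v * v)) := by
    intro v
    have h1 := ((ContDiffAt.differentiableAt_fderiv_real hcd).hasFDerivAt.clm_apply
      (hasFDerivAt_const v z))
    have h2 := (hu1.comp z hg1).clm_apply (hg2.mul_const v)
    have h3 : HasFDerivAt (fun x => fderiv ℝ (fun x => u (g x)) x v) _ z :=
      h2.congr_of_eventuallyEq (hev.mono fun x hx => hx v)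
    have h4 := congrArg (fun L : ℂ →L[ℝ] ℝ => L v) (h1.unique h3)
    simp at h4
    rw [h4, add_comm]
    congr 2
    ring
  rw [laplacian_eq_fderiv_fderiv, laplacian_eq_fderiv_fderiv, key, key]
  set B := fderiv ℝ (fderiv ℝ u) (g z)
  set w := deriv g z
  -- w and w i are orthogonal and of equal length ‖w‖, so the trace of the bilinear form over this
  -- pair is ‖w‖² times its trace over 1, i.
  have e1 : w = w.re • (1 : ℂ) + w.im • Complex.I := by
    simp [Complex.re_add_im]
  have e2 : w * Complex.I = (-w.im) • (1 : ℂ) + w.re • Complex.I := by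
    apply Complex.ext <;> simp
  have e3 : fderiv ℝ u (g z) (deriv (deriv g) z * (Complex.I * Complex.I)) =
      - fderiv ℝ u (g z) (deriv (deriv g) z * (1 * 1)) := by
    rw [← map_neg]; congr 1; simp
  rw [e3, mul_one, e2, ← Complex.normSq_eq_norm_sq, Complex.normSq_apply]
  nth_rewrite 1 2 [e1]
  simp only [map_add, map_smul, add_apply, smul_apply,
    smul_eq_mul]
  ring

/-! ### Maximum principles -/

theorem laplacian_const_mul_normSq (ε : ℝ) (z : ℂ) :
    Laplacian.laplacian (fun z : ℂ => ε * ‖z‖ ^ 2) z = 4 * ε := by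
  have h : ∀ t : ℝ, ‖z + t‖ ^ 2 = (z.re + t) ^ 2 + z.im ^ 2 := by
    intro t; rw [← Complex.normSq_eq_norm_sq, Complex.normSq_apply]; simp; ring
  have h' : ∀ t : ℝ, ‖z + t * Complex.I‖ ^ 2 = z.re ^ 2 + (z.im + t) ^ 2 := by
    intro t; rw [← Complex.normSq_eq_norm_sq, Complex.normSq_apply]; simp; ring
  have hlin : ∀ s t : ℝ, HasDerivAt (fun t : ℝ => s + t) 1 t := fun s t =>
    (hasDerivAt_id t).const_add s
  rw [laplacian_eq_of_hasDerivAt (a := fun t => ε * (2 * (z.re + t)))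
    (b := fun t => ε * (2 * (z.im + t))) (a' := ε * (2 * 1)) (b' := ε * (2 * 1))]
  · ring
  · exact contDiffAt_const.mul (contDiff_norm_sq ℝ).contDiffAt
  · refine Eventually.of_forall fun t => ?_
    simp only [h]
    have := ((((hlin z.re t).pow 2).add_const (z.im ^ 2)).const_mul ε)
    exact this.congr_deriv (by simp)
  · exact ((hlin z.re 0).const_mul 2).const_mul ε
  · refine Eventually.of_forall fun t => ?_
    simp only [h']
    have := ((((hlin z.im t).pow 2).const_add (z.re ^ 2)).const_mul ε)
    exact this.congr_deriv (by simp)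
  · exact ((hlin z.im 0).const_mul 2).const_mul ε

/-- The weak maximum principle on a compact set for functions with nonnegative Laplacian. -/
theorem le_of_laplacian_nonneg {u : ℂ → ℝ} {K : Set ℂ} (hK : IsCompact K) (hc : ContinuousOn u K)
    (hu : ∀ z ∈ interior K, ContDiffAt ℝ 2 u z) (hΔ : ∀ z ∈ interior K, 0 ≤ Laplacian.laplacian u z)
    {m : ℝ} (hm : ∀ z ∈ K \ interior K, u z ≤ m) {z : ℂ} (hz : z ∈ K) : u z ≤ m := by
  obtain ⟨C, hC⟩ := hK.isBounded.exists_norm_le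
  have main : ∀ ε > 0, u z ≤ m + ε * C ^ 2 := by
    intro ε hε
    -- The added term makes the Laplacian strictly positive, which excludes interior maxima.
    set v : ℂ → ℝ := u + fun z => ε * ‖z‖ ^ 2 with hv
    have hvc : ContinuousOn v K := hc.add (by fun_prop)
    obtain ⟨x, hxK, hx⟩ := hK.exists_isMaxOn ⟨z, hz⟩ hvc
    have hx1 : x ∉ interior K := by
      intro hxi
      have h2 : ContDiffAt ℝ 2 (fun z : ℂ => ε * ‖z‖ ^ 2) x :=
        contDiffAt_const.mul (contDiff_norm_sq ℝ).contDiffAt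
      have h1 : Laplacian.laplacian v x ≤ 0 :=
        laplacian_nonpos_of_isLocalMax ((hu x hxi).add h2)
          (hx.isLocalMax (mem_interior_iff_mem_nhds.mp hxi))
      rw [hv, (hu x hxi).laplacian_add h2, laplacian_const_mul_normSq] at h1
      linarith [hΔ x hxi]
    have h3 : v z ≤ v x := hx hz
    have h4 : u x ≤ m := hm x ⟨hxK, hx1⟩
    have h5 : ‖x‖ ^ 2 ≤ C ^ 2 := by gcongr; exact hC x hxK
    simp only [hv, Pi.add_apply] at h3
    nlinarith [sq_nonneg ‖z‖, mul_nonneg hε.le (sq_nonneg ‖z‖), mul_le_mul_of_nonneg_left h5 hε.le]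
  have ht : Tendsto (fun ε : ℝ => m + ε * C ^ 2) (𝓝[>] 0) (𝓝 m) := by
    have : Continuous (fun ε : ℝ => m + ε * C ^ 2) := by fun_prop
    simpa using (this.tendsto 0).mono_left nhdsWithin_le_nhds
  exact ge_of_tendsto ht (eventually_nhdsWithin_of_forall fun ε hε => main ε hε)

/-- The maximum principle on a strip for functions that are periodic in the real direction. -/
theorem le_of_laplacian_nonneg_strip {u : ℂ → ℝ} {a b : ℝ} (hab : a < b)
    (hper : ∀ z, u (z + 2) = u z)
    (hu : ∀ z : ℂ, a ≤ z.im → ContDiffAt ℝ 2 u z)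
    (hΔ : ∀ z : ℂ, a ≤ z.im → 0 ≤ Laplacian.laplacian u z)
    {m n : ℝ} (hm : ∀ z : ℂ, z.im = a → u z ≤ m) (hn : ∀ z : ℂ, z.im = b → u z ≤ n)
    {z : ℂ} (hza : a ≤ z.im) (hzb : z.im ≤ b) :
    u z ≤ m + (n - m) / (b - a) * (z.im - a) := by
  have hper' : ∀ (k : ℤ) z, u (z + k * 2) = u z := by
    intro k
    induction k with
    | zero => simp
    | succ k ih => intro z; rw [← ih z, ← hper (z + (k : ℤ) * 2)]; congr 1; push_cast; ring
    | pred k ih => intro z; rw [← ih z, ← hper (z + (-(k : ℤ) - 1 : ℤ) * 2)]; congr 1; push_cast; ring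
  set s := (n - m) / (b - a) with hs
  set l : ℂ → ℝ := fun z => m + s * (z.im - a) with hl
  set K : Set ℂ := Set.Icc 0 2 ×ℂ Set.Icc a b with hKdef
  have hK : IsCompact K := isCompact_Icc.reProdIm isCompact_Icc
  have red : ∀ z : ℂ, a ≤ z.im → z.im ≤ b → ∃ k : ℤ, z + k * 2 ∈ K := by
    intro z h1 h2
    refine ⟨-⌊z.re / 2⌋, ?_⟩
    simp only [hKdef, Complex.mem_reProdIm, Set.mem_Icc]
    have := Int.floor_le (z.re / 2)
    have := Int.lt_floor_add_one (z.re / 2)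
    simp
    refine ⟨⟨by linarith, by linarith⟩, h1, h2⟩
  have main : ∀ ε > 0, u z ≤ l z + ε * (b - a) ^ 2 := by
    intro ε hε
    -- The linear part levels the two boundary bounds to m; the quadratic part makes the Laplacian
    -- strictly positive.
    set p : ℂ → ℝ := fun z => ε * (z.im - a) ^ 2 - s * (z.im - a) with hp
    have hpc : ∀ z, ContDiffAt ℝ 2 p z := by
      intro z
      have : ContDiff ℝ 2 (fun z : ℂ => z.im) := Complex.imCLM.contDiff
      have : ContDiff ℝ 2 p := by
        simp only [hp]; fun_prop
      exact this.contDiffAt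
    have hpΔ : ∀ z, Laplacian.laplacian p z = 2 * ε := by
      intro z
      have hlin : ∀ t : ℝ, HasDerivAt (fun t : ℝ => z.im + t - a) 1 t := fun t =>
        ((hasDerivAt_id t).const_add z.im).sub_const a
      rw [laplacian_eq_of_hasDerivAt (hpc z) (a := fun _ => 0)
        (b := fun t => ε * (2 * (z.im + t - a)) - s * 1) (a' := 0) (b' := ε * (2 * 1))]
      · ring
      · refine Eventually.of_forall fun t => ?_
        simp only [hp]
        simpa using hasDerivAt_const t _
      · exact hasDerivAt_const _ _
      · refine Eventually.of_forall fun t => ?_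
        have : HasDerivAt (fun t => ε * (z.im + t - a) ^ 2 - s * (z.im + t - a))
            (ε * (2 * (z.im + t - a)) - s * 1) t :=
          ((((hlin t).pow 2).const_mul ε).sub ((hlin t).const_mul s)).congr_deriv (by simp)
        simpa [hp] using this
      · exact (((hlin 0).const_mul 2).const_mul ε).sub_const _
    set v : ℂ → ℝ := u + p with hv
    have hvper : ∀ (k : ℤ) z, v (z + k * 2) = v z := by
      intro k z; simp [hv, hper', hp]
    have hvc : ContinuousOn v K := by
      intro x hx
      have hx' : a ≤ x.im := by
        simp only [hKdef, Complex.mem_reProdIm, Set.mem_Icc] at hx; exact hx.2.1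
      exact (((hu x hx').add (hpc x)).continuousAt).continuousWithinAt
    obtain ⟨k0, hk0⟩ := red z hza hzb
    obtain ⟨x, hxK, hx⟩ := hK.exists_isMaxOn ⟨_, hk0⟩ hvc
    -- By periodicity the maximum over one period rectangle is a maximum over the whole strip, so
    -- its vertical sides need no boundary bound.
    have hxmax : ∀ y : ℂ, a ≤ y.im → y.im ≤ b → v y ≤ v x := by
      intro y h1 h2
      obtain ⟨k, hk⟩ := red y h1 h2
      rw [← hvper k y]
      exact hx hk
    simp only [hKdef, Complex.mem_reProdIm, Set.mem_Icc] at hxK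
    have hmem : x.im = a ∨ x.im = b := by
      by_contra! hne
      have hlo : a < x.im := lt_of_le_of_ne hxK.2.1 (Ne.symm hne.1)
      have hhi : x.im < b := lt_of_le_of_ne hxK.2.2 hne.2
      have hloc : IsLocalMax v x := by
        have h1 : ∀ᶠ y : ℂ in 𝓝 x, a < y.im := Complex.continuous_im.continuousAt.eventually_const_lt hlo
        have h2 : ∀ᶠ y : ℂ in 𝓝 x, y.im < b := Complex.continuous_im.continuousAt.eventually_lt_const hhi
        filter_upwards [h1, h2] with y h1 h2 using hxmax y h1.le h2.le
      have h1 : Laplacian.laplacian v x ≤ 0 :=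
        laplacian_nonpos_of_isLocalMax ((hu x hlo.le).add (hpc x)) hloc
      rw [hv, (hu x hlo.le).laplacian_add (hpc x), hpΔ] at h1
      linarith [hΔ x hlo.le]
    have h3 : v z ≤ v x := hxmax z hza hzb
    have h4 : v x ≤ m + ε * (b - a) ^ 2 := by
      rcases hmem with h | h
      · have := hm x h
        simp only [hv, hp, Pi.add_apply, h]
        nlinarith [mul_nonneg hε.le (sq_nonneg (b - a))]
      · have := hn x h
        simp only [hv, hp, Pi.add_apply, h]
        have : s * (b - a) = n - m := by
          rw [hs]; field_simp [(sub_pos.mpr hab).ne']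
        linarith
    simp only [hv, hp, Pi.add_apply] at h3 h4
    simp only [hl]
    nlinarith [mul_nonneg hε.le (sq_nonneg (z.im - a))]
  have ht : Tendsto (fun ε : ℝ => l z + ε * (b - a) ^ 2) (𝓝[>] 0) (𝓝 (l z)) := by
    have : Continuous (fun ε : ℝ => l z + ε * (b - a) ^ 2) := by fun_prop
    simpa using (this.tendsto 0).mono_left nhdsWithin_le_nhds
  exact ge_of_tendsto ht (eventually_nhdsWithin_of_forall fun ε hε => main ε hε)

/-! ### The mean value inequality on discs -/

theorem contDiffAt_finset_sum_laplacian {ι : Type*} (s : Finset ι) {f : ι → ℂ → ℝ} {z : ℂ}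
    (hf : ∀ i ∈ s, ContDiffAt ℝ 2 (f i) z) :
    ContDiffAt ℝ 2 (∑ i ∈ s, f i) z ∧
      Laplacian.laplacian (∑ i ∈ s, f i) z = ∑ i ∈ s, Laplacian.laplacian (f i) z := by
  classical
  induction s using Finset.induction_on with
  | empty =>
    refine ⟨contDiffAt_const, ?_⟩
    have : Laplacian.laplacian (fun _ : ℂ => (0 : ℝ)) z = 0 := by
      rw [InnerProductSpace.laplacian_const]; rfl
    exact this
  | insert a s ha ih =>
    obtain ⟨h1, h2⟩ := ih fun i hi => hf i (Finset.mem_insert_of_mem hi)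
    have h3 := hf a (Finset.mem_insert_self a s)
    rw [Finset.sum_insert ha, Finset.sum_insert ha, h3.laplacian_add h1, h2]
    exact ⟨h3.add h1, rfl⟩

/-- The root of unity `exp (2πi k / n)`, as a rotation angle. -/
def rootOfUnity (n k : ℕ) : ℂ := Complex.exp ((2 * Real.pi * k / n : ℝ) * Complex.I)

theorem norm_rootOfUnity (n k : ℕ) : ‖rootOfUnity n k‖ = 1 := Complex.norm_exp_ofReal_mul_I _

theorem rootOfUnity_zero (n : ℕ) : rootOfUnity n 0 = 1 := by simp [rootOfUnity]

theorem rootOfUnity_add (n j k : ℕ) : rootOfUnity n (j + k) = rootOfUnity n j * rootOfUnity n k := by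
  rw [rootOfUnity, rootOfUnity, rootOfUnity, ← Complex.exp_add]
  congr 1; push_cast; ring

theorem rootOfUnity_self {n : ℕ} (hn : n ≠ 0) : rootOfUnity n n = 1 := by
  have : (n : ℝ) ≠ 0 := by exact_mod_cast hn
  rw [rootOfUnity, mul_div_assoc, div_self this, mul_one]
  push_cast
  exact Complex.exp_two_pi_mul_I

/-- Rotate by the largest multiple of 2π/n that does not exceed the angle from z to w. The remaining
angle is at most 2π/n, and a chord is no longer than its arc. -/
theorem exists_rootOfUnity_mul_near {n : ℕ} (hn : n ≠ 0) {z w : ℂ} (h : ‖z‖ = ‖w‖) :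
    ∃ j : ℕ, ‖rootOfUnity n j * z - w‖ ≤ 2 * Real.pi * ‖w‖ / n := by
  have hn' : (0 : ℝ) < n := by exact_mod_cast Nat.pos_of_ne_zero hn
  have hpi := Real.pi_pos
  -- The extra full turn makes the angle nonnegative, as the natural floor requires.
  set x : ℝ := w.arg - z.arg + 2 * Real.pi with hx
  have hx0 : 0 ≤ x := by
    have := Complex.neg_pi_lt_arg w; have := Complex.arg_le_pi z; linarith
  refine ⟨⌊x * n / (2 * Real.pi)⌋₊, ?_⟩
  set j := ⌊x * n / (2 * Real.pi)⌋₊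
  have hj1 : (j : ℝ) ≤ x * n / (2 * Real.pi) := Nat.floor_le (by positivity)
  have hj2 : x * n / (2 * Real.pi) < j + 1 := Nat.lt_floor_add_one _
  have e1 : w = ‖w‖ * Complex.exp (w.arg * Complex.I) := (Complex.norm_mul_exp_arg_mul_I w).symm
  have e2 : z = ‖w‖ * Complex.exp (z.arg * Complex.I) := by
    rw [← h]; exact (Complex.norm_mul_exp_arg_mul_I z).symm
  have e3 : rootOfUnity n j * z - w = w *
      (Complex.exp (Complex.I * ((2 * Real.pi * j / n - x : ℝ) : ℂ)) - 1) := by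
    have : w * Complex.exp (Complex.I * ((2 * Real.pi * j / n - x : ℝ) : ℂ)) =
        rootOfUnity n j * z := by
      nth_rewrite 1 [e1]
      rw [e2, rootOfUnity, mul_assoc, mul_left_comm (Complex.exp _) (‖w‖ : ℂ), ← Complex.exp_add,
        ← Complex.exp_add, hx]
      congr 1
      rw [Complex.exp_eq_exp_iff_exists_int]
      exact ⟨-1, by push_cast; ring⟩
    rw [mul_sub, this, mul_one]
  rw [e3, norm_mul]
  have h4 := Real.norm_exp_I_mul_ofReal_sub_one_le (x := 2 * Real.pi * j / n - x)
  have h5 : |2 * Real.pi * j / n - x| ≤ 2 * Real.pi / n := by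
    rw [abs_le]
    rw [le_div_iff₀ (by positivity)] at hj1
    rw [div_lt_iff₀ (by positivity)] at hj2
    constructor
    · rw [neg_le_sub_iff_le_add, ← add_div, le_div_iff₀ hn']; nlinarith
    · rw [sub_le_iff_le_add, div_le_iff₀ hn', add_mul, div_mul_cancel₀ _ hn'.ne']; nlinarith
  calc _ ≤ ‖w‖ * (2 * Real.pi / n) := by
        gcongr; exact h4.trans h5
    _ = _ := by ring

/-- The sub-mean-value property over discs around the origin. -/
theorem mul_volume_le_setIntegral_zero {u : ℂ → ℝ} {R : ℝ}
    (hu : ∀ z ∈ Metric.closedBall 0 R, ContDiffAt ℝ 2 u z)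
    (hΔ : ∀ z ∈ Metric.closedBall 0 R, 0 ≤ Laplacian.laplacian u z) :
    u 0 * MeasureTheory.volume.real (Metric.ball (0 : ℂ) R) ≤ ∫ z in Metric.ball 0 R, u z := by
  have hcont : ContinuousOn u (Metric.closedBall 0 R) := fun z hz =>
    (hu z hz).continuousAt.continuousWithinAt
  have hint : MeasureTheory.IntegrableOn u (Metric.ball 0 R) :=
    (hcont.integrableOn_compact (isCompact_closedBall 0 R)).mono_set Metric.ball_subset_closedBall
  set V := MeasureTheory.volume.real (Metric.ball (0 : ℂ) R) with hV
  have hV0 : 0 ≤ V := MeasureTheory.measureReal_nonneg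
  have hrot : ∀ n k (z : ℂ), ‖rootOfUnity n k * z‖ = ‖z‖ := by
    intro n k z; rw [norm_mul, norm_rootOfUnity, one_mul]
  have hrotint : ∀ n k, MeasureTheory.IntegrableOn (fun z => u (rootOfUnity n k * z))
      (Metric.ball 0 R) ∧
      ∫ z in Metric.ball 0 R, u (rootOfUnity n k * z) = ∫ z in Metric.ball 0 R, u z := by
    intro n k
    set L : ℂ ≃ₗᵢ[ℝ] ℂ := rotation (Circle.exp (2 * Real.pi * k / n)) with hL
    have hLz : ∀ z, L z = rootOfUnity n k * z := by
      intro z; simp [hL, rotation_apply, rootOfUnity]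
    have hpre : L ⁻¹' (Metric.ball 0 R) = Metric.ball 0 R := by
      ext z; simp
    have h1 := L.measurePreserving.setIntegral_preimage_emb
      L.toHomeomorph.measurableEmbedding u (Metric.ball 0 R)
    have h2 := L.measurePreserving.integrableOn_comp_preimage
      L.toHomeomorph.measurableEmbedding (f := u) (s := Metric.ball 0 R)
    rw [hpre] at h1 h2
    simp only [hLz] at h1
    refine ⟨?_, h1⟩
    have := h2.mpr hint
    refine this.congr_fun (fun z _ => ?_) Metric.isOpen_ball.measurableSet
    simp [hLz]
  have main : ∀ δ > 0, (u 0 - δ) * V ≤ ∫ z in Metric.ball 0 R, u z := by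
    intro δ hδ
    have huc := (isCompact_closedBall (0 : ℂ) R).uniformContinuousOn_of_continuous hcont
    obtain ⟨η, hη, huη⟩ := Metric.uniformContinuousOn_iff.mp huc δ hδ
    -- So many rotations bring any two points of the same modulus in the disc within η of each
    -- other.
    obtain ⟨n, hn⟩ := exists_nat_gt (2 * Real.pi * |R| / η)
    have hn0 : (0 : ℝ) < n := lt_of_le_of_lt (by positivity) hn
    have hn1 : n ≠ 0 := by rintro rfl; simp at hn0
    -- The sum over n rotations is subharmonic and invariant under them. On each circle its maximum
    -- is at least its value n u(0) at the centre, and every point of the circle is close to a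
    -- rotate of the maximum point. So S is almost at least n u(0) everywhere, and integrating over
    -- the disc gives the mean value inequality without circle means.
    set S : ℂ → ℝ := ∑ k ∈ Finset.range n, fun z => u (rootOfUnity n k * z) with hS
    have hSz : ∀ z, S z = ∑ k ∈ Finset.range n, u (rootOfUnity n k * z) := by
      intro z; simp [hS]
    have hana : ∀ k (z : ℂ), AnalyticAt ℂ (fun z => rootOfUnity n k * z) z := by
      intro k z; fun_prop
    have hterm : ∀ z ∈ Metric.closedBall 0 R, ∀ k ∈ Finset.range n,
        ContDiffAt ℝ 2 (fun z => u (rootOfUnity n k * z)) z := by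
      intro z hz k _
      have h1 : rootOfUnity n k * z ∈ Metric.closedBall 0 R := by simpa [norm_rootOfUnity] using hz
      have h2 : ContDiff ℝ 2 (fun z => rootOfUnity n k * z) := by fun_prop
      exact (hu _ h1).comp z h2.contDiffAt
    have hSd : ∀ z ∈ Metric.closedBall 0 R, ContDiffAt ℝ 2 S z := fun z hz =>
      (contDiffAt_finset_sum_laplacian _ (hterm z hz)).1
    have hSΔ : ∀ z ∈ Metric.closedBall 0 R, 0 ≤ Laplacian.laplacian S z := by
      intro z hz
      rw [hS, (contDiffAt_finset_sum_laplacian _ (hterm z hz)).2]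
      refine Finset.sum_nonneg fun k _ => ?_
      have h1 : rootOfUnity n k * z ∈ Metric.closedBall 0 R := by simpa [norm_rootOfUnity] using hz
      rw [laplacian_comp_analyticAt (hana k z) (hu _ h1)]
      exact mul_nonneg (sq_nonneg _) (hΔ _ h1)
    have hshift : ∀ j z, S (rootOfUnity n j * z) = S z := by
      intro j
      induction j with
      | zero => intro z; rw [rootOfUnity_zero, one_mul]
      | succ j ih =>
        intro z
        rw [rootOfUnity_add, mul_assoc, ih, hSz, hSz]
        have h1 := Finset.sum_range_succ (fun k => u (rootOfUnity n k * z)) n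
        rw [Finset.sum_range_succ', rootOfUnity_self hn1, rootOfUnity_zero] at h1
        have h2 := add_right_cancel h1
        rw [← h2]
        refine Finset.sum_congr rfl fun k _ => ?_
        rw [rootOfUnity_add, mul_assoc]
    have hexists : ∀ r, 0 ≤ r → r ≤ R → ∃ z : ℂ, ‖z‖ = r ∧ n * u 0 ≤ S z := by
      intro r hr0 hrR
      have hsub : Metric.closedBall (0 : ℂ) r ⊆ Metric.closedBall 0 R :=
        Metric.closedBall_subset_closedBall hrR
      have hScont : ContinuousOn S (Metric.closedBall 0 r) := fun z hz =>
        (hSd z (hsub hz)).continuousAt.continuousWithinAt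
      obtain ⟨x, hx, hxmax⟩ := (isCompact_sphere (0 : ℂ) r).exists_isMaxOn
        (NormedSpace.sphere_nonempty.mpr hr0) (hScont.mono Metric.sphere_subset_closedBall)
      refine ⟨x, by simpa using hx, ?_⟩
      have h0 : S 0 = n * u 0 := by simp [hSz]
      rw [← h0]
      refine le_of_laplacian_nonneg (isCompact_closedBall 0 r) hScont
        (fun z hz => hSd z (hsub (interior_subset hz)))
        (fun z hz => hSΔ z (hsub (interior_subset hz))) (fun z hz => hxmax ?_)
        (Metric.mem_closedBall_self hr0)
      have h3 : z ∉ Metric.ball (0 : ℂ) r := fun h =>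
        hz.2 (interior_maximal Metric.ball_subset_closedBall Metric.isOpen_ball h)
      have h4 := hz.1
      simp only [Metric.mem_ball, Metric.mem_closedBall, Metric.mem_sphere, not_lt] at h3 h4 ⊢
      exact le_antisymm h4 h3
    have hlow : ∀ z ∈ Metric.ball 0 R, n * (u 0 - δ) ≤ S z := by
      intro z hz
      have hzR : ‖z‖ < R := by simpa using hz
      obtain ⟨x, hx1, hx2⟩ := hexists ‖z‖ (norm_nonneg _) hzR.le
      obtain ⟨j, hj⟩ := exists_rootOfUnity_mul_near hn1 hx1
      rw [← hshift j x] at hx2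
      have hlt : ‖rootOfUnity n j * x - z‖ < η := by
        refine lt_of_le_of_lt hj ?_
        rw [div_lt_iff₀ hη] at hn
        rw [div_lt_iff₀ hn0]
        have : ‖z‖ ≤ |R| := hzR.le.trans (le_abs_self R)
        have : 2 * Real.pi * ‖z‖ ≤ 2 * Real.pi * |R| := by
          have := Real.pi_pos; gcongr
        linarith
      have hdiff : S (rootOfUnity n j * x) - S z ≤ n * δ := by
        rw [hSz, hSz, ← Finset.sum_sub_distrib]
        calc _ ≤ ∑ k ∈ Finset.range n, δ := by
              refine Finset.sum_le_sum fun k _ => ?_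
              have h1 := huη (rootOfUnity n k * (rootOfUnity n j * x))
                (by simp [norm_rootOfUnity, hx1, hzR.le]) (rootOfUnity n k * z)
                (by simp [norm_rootOfUnity, hzR.le])
                (by rw [dist_eq_norm, ← mul_sub, hrot]; exact hlt)
              rw [Real.dist_eq] at h1
              exact (le_abs_self _).trans h1.le
          _ = n * δ := by simp
      linarith
    have hSint : ∫ z in Metric.ball 0 R, S z = n * ∫ z in Metric.ball 0 R, u z := by
      simp only [hSz]
      rw [MeasureTheory.integral_finsetSum _ fun k _ => (hrotint n k).1]
      simp [(hrotint n _).2]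
    have hSi : MeasureTheory.IntegrableOn S (Metric.ball 0 R) := by
      rw [hS]
      exact MeasureTheory.integrable_finsetSum' _ fun k _ => (hrotint n k).1
    have hfin : n * (u 0 - δ) * V ≤ ∫ z in Metric.ball 0 R, S z := by
      have h1 : ∫ z in Metric.ball (0 : ℂ) R, (n * (u 0 - δ)) = V * (n * (u 0 - δ)) := by
        rw [MeasureTheory.setIntegral_const, smul_eq_mul]
      rw [mul_comm, ← h1]
      refine MeasureTheory.setIntegral_mono_on ?_ hSi Metric.isOpen_ball.measurableSet hlow
      exact MeasureTheory.integrableOn_const (by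
        exact (MeasureTheory.measure_ball_lt_top).ne)
    rw [hSint, mul_assoc] at hfin
    exact le_of_mul_le_mul_left hfin hn0
  have ht : Tendsto (fun δ : ℝ => (u 0 - δ) * V) (𝓝[>] 0) (𝓝 (u 0 * V)) := by
    have : Continuous (fun δ : ℝ => (u 0 - δ) * V) := by fun_prop
    simpa using (this.tendsto 0).mono_left nhdsWithin_le_nhds
  exact le_of_tendsto ht (eventually_nhdsWithin_of_forall fun δ hδ => main δ hδ)

/-- The sub-mean-value property over discs. -/
theorem mul_volume_le_setIntegral {u : ℂ → ℝ} {c : ℂ} {R : ℝ} (hR : 0 ≤ R)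
    (hu : ∀ z ∈ Metric.closedBall c R, ContDiffAt ℝ 2 u z)
    (hΔ : ∀ z ∈ Metric.closedBall c R, 0 ≤ Laplacian.laplacian u z) :
    u c * (Real.pi * R ^ 2) ≤ ∫ z in Metric.ball c R, u z := by
  have hmem : ∀ z ∈ Metric.closedBall (0 : ℂ) R, c + z ∈ Metric.closedBall c R := by
    intro z hz; simpa using hz
  have hana : ∀ z : ℂ, AnalyticAt ℂ (fun z => c + z) z := by intro z; fun_prop
  have h := mul_volume_le_setIntegral_zero (u := fun z => u (c + z)) (R := R)
    (fun z hz => (hu _ (hmem z hz)).comp z (by fun_prop))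
    (fun z hz => by
      rw [laplacian_comp_analyticAt (hana z) (hu _ (hmem z hz))]
      exact mul_nonneg (sq_nonneg _) (hΔ _ (hmem z hz)))
  have h1 := (MeasureTheory.measurePreserving_add_left MeasureTheory.volume c).setIntegral_preimage_emb
    (MeasurableEquiv.addLeft c).measurableEmbedding u (Metric.ball c R)
  have hpre : (fun x => c + x) ⁻¹' Metric.ball c R = Metric.ball 0 R := by ext z; simp
  rw [hpre] at h1
  rw [h1] at h
  have hvol : MeasureTheory.volume.real (Metric.ball (0 : ℂ) R) = Real.pi * R ^ 2 := by
    rw [MeasureTheory.measureReal_def, Complex.volume_ball]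
    simp [hR, mul_comm]
  rw [hvol] at h
  simpa using h

/-! ### The Ahlfors–Schwarz lemma on the upper half plane -/

/-- This is the curvature equation of the hyperbolic density 2R / (R² - |z - c|²) of the disc, up to
an additive constant and a sign of the logarithm. -/
theorem laplacian_log_disc {R : ℝ} {c z : ℂ} (hz : ‖z - c‖ < R) :
    Laplacian.laplacian (fun z : ℂ => Real.log (R ^ 2 - ‖z - c‖ ^ 2)) z =
      -(4 * R ^ 2) / (R ^ 2 - ‖z - c‖ ^ 2) ^ 2 := by
  set p := z.re - c.re with hp
  set q := z.im - c.im with hq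
  have hn : ∀ w : ℂ, ‖w - c‖ ^ 2 = (w.re - c.re) ^ 2 + (w.im - c.im) ^ 2 := by
    intro w; rw [← Complex.normSq_eq_norm_sq, Complex.normSq_apply]; simp; ring
  have hpos : 0 < R ^ 2 - ‖z - c‖ ^ 2 := by nlinarith [norm_nonneg (z - c)]
  have hpos' : 0 < R ^ 2 - (p ^ 2 + q ^ 2) := by rw [hn] at hpos; exact hpos
  have hcd : ContDiffAt ℝ 2 (fun z : ℂ => Real.log (R ^ 2 - ‖z - c‖ ^ 2)) z := by
    refine ContDiffAt.log ?_ hpos.ne'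
    have : ContDiff ℝ 2 (fun z : ℂ => ‖z - c‖ ^ 2) := (contDiff_id.sub contDiff_const).norm_sq ℝ
    exact (contDiff_const.sub this).contDiffAt
  have hpoly : ∀ p q : ℝ, ∀ t : ℝ, HasDerivAt (fun t : ℝ => R ^ 2 - ((p + t) ^ 2 + q ^ 2))
      (-(2 * (p + t))) t := by
    intro p q t
    have := ((((hasDerivAt_id t).const_add p).pow 2).add_const (q ^ 2)).const_sub (R ^ 2)
    exact this.congr_deriv (by simp)
  have hev : ∀ p q : ℝ, 0 < R ^ 2 - (p ^ 2 + q ^ 2) →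
      ∀ᶠ t : ℝ in 𝓝 0, R ^ 2 - ((p + t) ^ 2 + q ^ 2) ≠ 0 := by
    intro p q h
    have : ContinuousAt (fun t : ℝ => R ^ 2 - ((p + t) ^ 2 + q ^ 2)) 0 := by fun_prop
    exact this.eventually_ne (by simpa using h.ne')
  have hlin : ∀ p : ℝ, HasDerivAt (fun t : ℝ => -(2 * (p + t))) (-2) 0 := by
    intro p
    exact ((((hasDerivAt_id (0 : ℝ)).const_add p).const_mul 2).neg).congr_deriv (by simp)
  have hq' : 0 < R ^ 2 - (q ^ 2 + p ^ 2) := by linarith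
  rw [laplacian_eq_of_hasDerivAt hcd
    (a := fun t => -(2 * (p + t)) / (R ^ 2 - ((p + t) ^ 2 + q ^ 2)))
    (b := fun t => -(2 * (q + t)) / (R ^ 2 - ((q + t) ^ 2 + p ^ 2)))
    (a' := _) (b' := _) ?_
    ((hlin p).div (hpoly p q 0) (by simpa using hpos'.ne')) ?_
    ((hlin q).div (hpoly q p 0) (by simpa using hq'.ne'))]
  · rw [hn]
    simp only [add_zero]
    rw [show (z.re - c.re) = p from rfl, show (z.im - c.im) = q from rfl,
      show q ^ 2 + p ^ 2 = p ^ 2 + q ^ 2 by ring, ← add_div]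
    congr 1
    ring
  · filter_upwards [hev p q hpos'] with t ht
    have := (hpoly p q t).log ht
    simp only [hn]
    convert this using 4
    simp [hp, hq]
    ring
  · filter_upwards [hev q p hq'] with t ht
    have := (hpoly q p t).log ht
    simp only [hn]
    convert this using 4
    simp [hp, hq]
    ring

/-- A metric of curvature `-1` near a closed disc is at most the hyperbolic metric of the disc. -/
theorem le_hyperbolic_disc {μ : ℂ → ℝ} {c : ℂ} {R : ℝ}
    (hpos : ∀ z ∈ Metric.closedBall c R, 0 < μ z)
    (hμ : ∀ z ∈ Metric.closedBall c R, ContDiffAt ℝ 2 μ z)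
    (hΔ : ∀ z ∈ Metric.closedBall c R, Laplacian.laplacian (fun z => Real.log (μ z)) z = μ z ^ 2)
    {z : ℂ} (hz : ‖z - c‖ < R) : μ z * (R ^ 2 - ‖z - c‖ ^ 2) ≤ 2 * R := by
  have hR : 0 < R := (norm_nonneg _).trans_lt hz
  -- P is 2R times the quotient of μ by the hyperbolic density of the disc. It vanishes on the
  -- boundary circle, so its maximum is interior, and there the two curvature equations compare the
  -- densities.
  set P : ℂ → ℝ := fun z => μ z * (R ^ 2 - ‖z - c‖ ^ 2) with hP
  have hcont : ContinuousOn P (Metric.closedBall c R) := fun x hx =>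
    ((hμ x hx).continuousAt.mul (by fun_prop)).continuousWithinAt
  have hzm : z ∈ Metric.closedBall c R := by simpa [dist_eq_norm] using hz.le
  obtain ⟨x, hx, hmax⟩ := (isCompact_closedBall c R).exists_isMaxOn ⟨z, hzm⟩ hcont
  have hpz : 0 < P z := mul_pos (hpos z hzm) (by nlinarith [norm_nonneg (z - c)])
  have hpx : 0 < P x := hpz.trans_le (hmax hzm)
  have hxlt : ‖x - c‖ < R := by
    have h1 := (pos_iff_pos_of_mul_pos hpx).mp (hpos x hx)
    nlinarith [norm_nonneg (x - c)]
  have hxpos : 0 < R ^ 2 - ‖x - c‖ ^ 2 := by nlinarith [norm_nonneg (x - c)]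
  have hcd2 : ContDiffAt ℝ 2 (fun z : ℂ => Real.log (R ^ 2 - ‖z - c‖ ^ 2)) x := by
    refine ContDiffAt.log ?_ hxpos.ne'
    have : ContDiff ℝ 2 (fun z : ℂ => ‖z - c‖ ^ 2) := (contDiff_id.sub contDiff_const).norm_sq ℝ
    exact (contDiff_const.sub this).contDiffAt
  have hcd1 : ContDiffAt ℝ 2 (fun z => Real.log (μ z)) x := (hμ x hx).log (hpos x hx).ne'
  have hball : Metric.ball c R ∈ 𝓝 x := Metric.isOpen_ball.mem_nhds (by simpa [dist_eq_norm] using hxlt)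
  have hloc : IsLocalMax ((fun z => Real.log (μ z)) + fun z => Real.log (R ^ 2 - ‖z - c‖ ^ 2)) x := by
    filter_upwards [hball] with y hy
    have hy' : ‖y - c‖ < R := by simpa [dist_eq_norm] using hy
    have hyK := Metric.ball_subset_closedBall hy
    have h2 : 0 < R ^ 2 - ‖y - c‖ ^ 2 := by nlinarith [norm_nonneg (y - c)]
    simp only [Pi.add_apply]
    rw [← Real.log_mul (hpos y hyK).ne' h2.ne', ← Real.log_mul (hpos x hx).ne' hxpos.ne']
    exact Real.log_le_log (mul_pos (hpos y hyK) h2) (hmax hyK)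
  have h1 := laplacian_nonpos_of_isLocalMax (hcd1.add hcd2) hloc
  change Laplacian.laplacian ((fun z => Real.log (μ z)) +
    fun z => Real.log (R ^ 2 - ‖z - c‖ ^ 2)) x ≤ 0 at h1
  rw [hcd1.laplacian_add hcd2, hΔ x hx, laplacian_log_disc hxlt] at h1
  refine (hmax hzm).trans ?_
  have h2 : P x ^ 2 ≤ (2 * R) ^ 2 := by
    rw [hP, mul_pow]
    have h3 : μ x ^ 2 ≤ 4 * R ^ 2 / (R ^ 2 - ‖x - c‖ ^ 2) ^ 2 := by
      rw [neg_div] at h1; linarith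
    rw [le_div_iff₀ (by positivity)] at h3
    linarith
  exact abs_le_of_sq_le_sq' h2 (by positivity) |>.2

/-- **Ahlfors–Schwarz lemma**: a metric of curvature `-1` on the upper half plane is at most the
hyperbolic metric. -/
theorem mul_im_le_one_of_curvature {μ : ℂ → ℝ}
    (hpos : ∀ z : ℂ, 0 < z.im → 0 < μ z)
    (hμ : ∀ z : ℂ, 0 < z.im → ContDiffAt ℝ 2 μ z)
    (hΔ : ∀ z : ℂ, 0 < z.im → Laplacian.laplacian (fun z => Real.log (μ z)) z = μ z ^ 2)
    {z : ℂ} (hz : 0 < z.im) : μ z * z.im ≤ 1 := by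
  set y := z.im with hy
  -- Discs centred at height K above z, with closure in the half plane. Letting R → K makes them
  -- tangent to the real axis, and K → ∞ exhausts the half plane.
  have step : ∀ K R : ℝ, y < K → K - y < R → R < K → μ z * (R ^ 2 - (K - y) ^ 2) ≤ 2 * R := by
    intro K R h1 h2 h3
    set c : ℂ := ⟨z.re, K⟩ with hc
    have hzc : ‖z - c‖ = K - y := by
      have : z - c = ((y - K : ℝ) : ℂ) * Complex.I := by
        apply Complex.ext <;> simp [hc, hy]
      rw [this, norm_mul, Complex.norm_I, mul_one, Complex.norm_real, Real.norm_eq_abs,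
        abs_of_neg (by linarith)]
      ring
    have hsub : ∀ w ∈ Metric.closedBall c R, 0 < w.im := by
      intro w hw
      have h4 : ‖w - c‖ ≤ R := by simpa [dist_eq_norm] using hw
      have h5 := (abs_le.mp ((Complex.abs_im_le_norm (w - c)).trans h4)).1
      simp [hc] at h5
      linarith
    have := le_hyperbolic_disc (fun w hw => hpos w (hsub w hw)) (fun w hw => hμ w (hsub w hw))
      (fun w hw => hΔ w (hsub w hw)) (z := z) (by rw [hzc]; exact h2)
    rwa [hzc] at this
  have step2 : ∀ K : ℝ, y < K → μ z * (K ^ 2 - (K - y) ^ 2) ≤ 2 * K := by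
    intro K hK
    have h1 : Tendsto (fun R : ℝ => μ z * (R ^ 2 - (K - y) ^ 2)) (𝓝[<] K)
        (𝓝 (μ z * (K ^ 2 - (K - y) ^ 2))) := by
      have : Continuous (fun R : ℝ => μ z * (R ^ 2 - (K - y) ^ 2)) := by fun_prop
      exact (this.tendsto K).mono_left nhdsWithin_le_nhds
    have h2 : Tendsto (fun R : ℝ => 2 * R) (𝓝[<] K) (𝓝 (2 * K)) := by
      have : Continuous (fun R : ℝ => 2 * R) := by fun_prop
      exact (this.tendsto K).mono_left nhdsWithin_le_nhds
    refine le_of_tendsto_of_tendsto h1 h2 ?_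
    have h3 : ∀ᶠ R in 𝓝[<] K, K - y < R :=
      (eventually_gt_nhds (by linarith)).filter_mono nhdsWithin_le_nhds
    filter_upwards [h3, self_mem_nhdsWithin] with R h4 h5 using step K R hK h4 h5
  have h1 : Tendsto (fun K : ℝ => μ z * (y - y ^ 2 / 2 * K⁻¹)) atTop (𝓝 (μ z * (y - y ^ 2 / 2 * 0))) :=
    (tendsto_const_nhds.sub (tendsto_const_nhds.mul tendsto_inv_atTop_zero)).const_mul _
  rw [mul_zero, sub_zero] at h1
  refine le_of_tendsto h1 ?_
  filter_upwards [eventually_gt_atTop y] with K hK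
  have hK0 : 0 < K := hz.trans hK
  have := step2 K hK
  have h2 : μ z * (y - y ^ 2 / 2 * K⁻¹) = μ z * (K ^ 2 - (K - y) ^ 2) / (2 * K) := by
    field_simp; ring
  rw [h2, div_le_one (by positivity)]
  exact this

/-! ### Theta constants -/

/-- The theta constant `θ₄(τ) = θ₃(τ + 1)`. -/
def theta4 (τ : ℂ) : ℂ := jacobiTheta (τ + 1)

theorem theta2_term_eq (n : ℤ) (τ : ℂ) :
    Complex.exp (Real.pi * Complex.I * ((n : ℂ) + 1 / 2) ^ 2 * τ) =
      Complex.exp (Real.pi * Complex.I * τ / 4) * jacobiTheta₂_term n (τ / 2) τ := by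
  rw [jacobiTheta₂_term, ← Complex.exp_add]
  congr 1; ring

theorem hasSum_theta2 {τ : ℂ} (hτ : 0 < τ.im) :
    HasSum (fun n : ℤ => Complex.exp (Real.pi * Complex.I * ((n : ℂ) + 1 / 2) ^ 2 * τ))
      (theta2 τ) := by
  have h : Summable (fun n : ℤ =>
      Complex.exp (Real.pi * Complex.I * ((n : ℂ) + 1 / 2) ^ 2 * τ)) := by
    simp only [theta2_term_eq]
    exact ((summable_jacobiTheta₂_term_iff _ _).mpr hτ).mul_left _
  exact h.hasSum

theorem theta2_eq (τ : ℂ) :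
    theta2 τ = Complex.exp (Real.pi * Complex.I * τ / 4) * jacobiTheta₂ (τ / 2) τ := by
  simp only [theta2, theta2_term_eq, tsum_mul_left, jacobiTheta₂]

theorem hasSum_jacobiTheta {τ : ℂ} (hτ : 0 < τ.im) :
    HasSum (fun n : ℤ => Complex.exp (Real.pi * Complex.I * (n : ℂ) ^ 2 * τ)) (jacobiTheta τ) := by
  have := hasSum_jacobiTheta₂_term 0 hτ
  rw [← jacobiTheta_eq_jacobiTheta₂] at this
  simpa [jacobiTheta₂_term] using this

theorem exp_pi_I_mul_int (n : ℤ) : Complex.exp (Real.pi * Complex.I * n) = (-1) ^ n := by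
  rw [mul_comm, Complex.exp_int_mul, Complex.exp_pi_mul_I]

theorem theta4_term_eq (n : ℤ) (τ : ℂ) :
    Complex.exp (Real.pi * Complex.I * (n : ℂ) ^ 2 * (τ + 1)) =
      (-1) ^ n * Complex.exp (Real.pi * Complex.I * (n : ℂ) ^ 2 * τ) := by
  have h : (-1 : ℂ) ^ (n ^ 2) = (-1) ^ n := by
    rcases Int.even_or_odd n with h | h
    · rw [h.neg_one_zpow, (h.pow_of_ne_zero two_ne_zero).neg_one_zpow]
    · rw [h.neg_one_zpow, (h.pow).neg_one_zpow]
  rw [← h, ← exp_pi_I_mul_int, ← Complex.exp_add]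
  congr 1; push_cast; ring

theorem hasSum_theta4 {τ : ℂ} (hτ : 0 < τ.im) :
    HasSum (fun n : ℤ => (-1) ^ n * Complex.exp (Real.pi * Complex.I * (n : ℂ) ^ 2 * τ))
      (theta4 τ) := by
  have := hasSum_jacobiTheta (τ := τ + 1) (by simpa using hτ)
  simp only [theta4_term_eq] at this
  exact this

theorem theta4_eq (τ : ℂ) : theta4 τ = jacobiTheta₂ (1 / 2) τ := by
  rw [theta4, jacobiTheta, jacobiTheta₂]
  refine tsum_congr fun n => ?_
  rw [theta4_term_eq, jacobiTheta₂_term, ← exp_pi_I_mul_int, ← Complex.exp_add]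
  congr 1; ring

/-- Splitting a double sum over the integers according to the parity of `m + n`. -/
theorem hasSum_int_prod_parity {f : ℤ × ℤ → ℂ} {a b : ℂ}
    (h1 : HasSum (fun p : ℤ × ℤ => f (p.1 + p.2, p.1 - p.2)) a)
    (h2 : HasSum (fun p : ℤ × ℤ => f (p.1 + p.2 + 1, p.1 - p.2)) b) : HasSum f (a + b) := by
  let F : (ℤ × ℤ) ⊕ (ℤ × ℤ) → ℤ × ℤ :=
    Sum.elim (fun p => (p.1 + p.2, p.1 - p.2)) (fun p => (p.1 + p.2 + 1, p.1 - p.2))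
  have hF : Function.Bijective F := by
    constructor
    · rintro (⟨a, b⟩ | ⟨a, b⟩) (⟨c, d⟩ | ⟨c, d⟩) h <;>
        simp [F] at h ⊢ <;> omega
    · rintro ⟨m, n⟩
      rcases Int.even_or_odd (m + n) with ⟨k, hk⟩ | ⟨k, hk⟩
      · exact ⟨Sum.inl (k, m - k), by simp [F]; omega⟩
      · exact ⟨Sum.inr (k, m - k - 1), by simp [F]; omega⟩
  rw [← (Equiv.ofBijective F hF).hasSum_iff]
  exact HasSum.sum h1 h2

theorem hasSum_mul_prod {g h : ℤ → ℂ} {a b : ℂ} (hg : HasSum g a) (hh : HasSum h b) :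
    HasSum (fun p : ℤ × ℤ => g p.1 * h p.2) (a * b) :=
  hg.mul hh (summable_mul_of_summable_norm hg.summable.norm hh.summable.norm)

theorem two_mul_im_pos {τ : ℂ} (hτ : 0 < τ.im) : 0 < (2 * τ).im := by simpa using hτ

/-- (j + k)² + (j - k)² = 2j² + 2k². -/
theorem hasSum_even_part {τ : ℂ} (hτ : 0 < τ.im) :
    HasSum (fun p : ℤ × ℤ => Complex.exp (Real.pi * Complex.I * ((p.1 + p.2 : ℤ) : ℂ) ^ 2 * τ) *
      Complex.exp (Real.pi * Complex.I * ((p.1 - p.2 : ℤ) : ℂ) ^ 2 * τ)) (jacobiTheta (2 * τ) ^ 2) := by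
  have h := hasSum_mul_prod (hasSum_jacobiTheta (two_mul_im_pos hτ))
    (hasSum_jacobiTheta (two_mul_im_pos hτ))
  rw [← sq] at h
  refine h.congr_fun fun p => ?_
  rw [← Complex.exp_add, ← Complex.exp_add]
  congr 1; push_cast; ring

/-- (j + k + 1)² + (j - k)² = 2(j + 1/2)² + 2(k + 1/2)². -/
theorem hasSum_odd_part {τ : ℂ} (hτ : 0 < τ.im) :
    HasSum (fun p : ℤ × ℤ => Complex.exp (Real.pi * Complex.I * ((p.1 + p.2 + 1 : ℤ) : ℂ) ^ 2 * τ) *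
      Complex.exp (Real.pi * Complex.I * ((p.1 - p.2 : ℤ) : ℂ) ^ 2 * τ)) (theta2 (2 * τ) ^ 2) := by
  have h := hasSum_mul_prod (hasSum_theta2 (two_mul_im_pos hτ)) (hasSum_theta2 (two_mul_im_pos hτ))
  rw [← sq] at h
  refine h.congr_fun fun p => ?_
  rw [← Complex.exp_add, ← Complex.exp_add]
  congr 1; push_cast; ring

theorem jacobiTheta_sq {τ : ℂ} (hτ : 0 < τ.im) :
    jacobiTheta τ ^ 2 = jacobiTheta (2 * τ) ^ 2 + theta2 (2 * τ) ^ 2 := by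
  have h := hasSum_mul_prod (hasSum_jacobiTheta hτ) (hasSum_jacobiTheta hτ)
  rw [sq]
  exact h.unique (hasSum_int_prod_parity (hasSum_even_part hτ) (hasSum_odd_part hτ))

theorem theta4_sq {τ : ℂ} (hτ : 0 < τ.im) :
    theta4 τ ^ 2 = jacobiTheta (2 * τ) ^ 2 - theta2 (2 * τ) ^ 2 := by
  have h := hasSum_mul_prod (hasSum_theta4 hτ) (hasSum_theta4 hτ)
  rw [sq, sub_eq_add_neg]
  refine h.unique (hasSum_int_prod_parity ((hasSum_even_part hτ).congr_fun fun p => ?_)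
    ((hasSum_odd_part hτ).neg.congr_fun fun p => ?_))
  · have : (-1 : ℂ) ^ (p.1 + p.2) * (-1) ^ (p.1 - p.2) = 1 := by
      rw [← zpow_add₀ (by norm_num)]
      exact Even.neg_one_zpow ⟨p.1, by ring⟩
    simp only
    rw [mul_mul_mul_comm, this, one_mul]
  · have : (-1 : ℂ) ^ (p.1 + p.2 + 1) * (-1) ^ (p.1 - p.2) = -1 := by
      rw [← zpow_add₀ (by norm_num)]
      exact Odd.neg_one_zpow ⟨p.1, by ring⟩
    simp only
    rw [mul_mul_mul_comm, this, neg_one_mul]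

/-- Both parity classes contribute the same product; in the odd class the summation index of θ₃ is
shifted by one. -/
theorem theta2_sq {τ : ℂ} (hτ : 0 < τ.im) :
    theta2 τ ^ 2 = 2 * (theta2 (2 * τ) * jacobiTheta (2 * τ)) := by
  have h := hasSum_mul_prod (hasSum_theta2 hτ) (hasSum_theta2 hτ)
  have h1 := hasSum_mul_prod (hasSum_theta2 (two_mul_im_pos hτ))
    (hasSum_jacobiTheta (two_mul_im_pos hτ))
  have hshift : HasSum (fun n : ℤ => Complex.exp (Real.pi * Complex.I * ((n + 1 : ℤ) : ℂ) ^ 2 * (2 * τ)))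
      (jacobiTheta (2 * τ)) :=
    ((Equiv.addRight (1 : ℤ)).hasSum_iff).mpr (hasSum_jacobiTheta (two_mul_im_pos hτ))
  have h2 := hasSum_mul_prod hshift (hasSum_theta2 (two_mul_im_pos hτ))
  rw [sq, two_mul]
  rw [mul_comm (jacobiTheta _)] at h2
  refine h.unique (hasSum_int_prod_parity (h1.congr_fun fun p => ?_) (h2.congr_fun fun p => ?_)) <;>
  · simp only
    rw [← Complex.exp_add, ← Complex.exp_add]
    congr 1; push_cast; ring

/-- Jacobi's identity `θ₃⁴ = θ₂⁴ + θ₄⁴`. -/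
theorem jacobi_identity {τ : ℂ} (hτ : 0 < τ.im) :
    jacobiTheta τ ^ 4 = theta2 τ ^ 4 + theta4 τ ^ 4 := by
  have h1 := jacobiTheta_sq hτ
  have h2 := theta4_sq hτ
  have h3 := theta2_sq hτ
  have e : ∀ x : ℂ, x ^ 4 = (x ^ 2) ^ 2 := fun x => by ring
  rw [e, e (theta2 τ), e (theta4 τ), h1, h2, h3]
  ring

/-- This formula carries a zero of θ₃ or θ₄ at τ to a zero of θ₄ at 2τ, from which the nonvanishing
of the theta constants follows. -/
theorem theta4_two_mul_pow {τ : ℂ} (hτ : 0 < τ.im) :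
    theta4 (2 * τ) ^ 4 = jacobiTheta τ ^ 2 * theta4 τ ^ 2 := by
  have h1 := jacobi_identity (two_mul_im_pos hτ)
  rw [jacobiTheta_sq hτ, theta4_sq hτ]
  linear_combination -h1

/-- A zero would propagate to all points 2ⁿ τ by doubling, whereas θ₄ → 1 as the imaginary part
grows. -/
theorem theta4_ne_zero {τ : ℂ} (hτ : 0 < τ.im) : theta4 τ ≠ 0 := by
  intro h0
  have hz : ∀ n : ℕ, theta4 (2 ^ n * τ) = 0 := by
    intro n
    induction n with
    | zero => simpa using h0
    | succ n ih =>
      have him : 0 < (2 ^ n * τ).im := by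
        have : (2 ^ n * τ : ℂ).im = 2 ^ n * τ.im := by
          have : ((2 : ℂ) ^ n) = ((2 ^ n : ℝ) : ℂ) := by push_cast; rfl
          rw [this, Complex.im_ofReal_mul]
        rw [this]; positivity
      have := theta4_two_mul_pow him
      rw [ih, zero_pow two_ne_zero, mul_zero, ← mul_assoc, ← pow_succ'] at this
      exact eq_zero_of_pow_eq_zero this
  have hlim : Tendsto (fun n : ℕ => (2 ^ n * τ + 1 : ℂ)) atTop (comap Complex.im atTop) := by
    rw [tendsto_comap_iff]
    have : (Complex.im ∘ fun n : ℕ => (2 ^ n * τ + 1 : ℂ)) = fun n : ℕ => 2 ^ n * τ.im := by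
      funext n
      have : ((2 : ℂ) ^ n) = ((2 ^ n : ℝ) : ℂ) := by push_cast; rfl
      simp only [Function.comp, Complex.add_im, Complex.one_im, add_zero]
      rw [this, Complex.im_ofReal_mul]
    rw [this]
    exact (tendsto_pow_atTop_atTop_of_one_lt (by norm_num)).atTop_mul_const hτ
  have h1 : Tendsto (fun τ => jacobiTheta τ - 1) (comap Complex.im atTop) (𝓝 0) := by
    refine isBigO_at_im_infty_jacobiTheta_sub_one.trans_tendsto ?_
    refine Real.tendsto_exp_atBot.comp ?_
    exact tendsto_comap.const_mul_atTop_of_neg (by linarith [Real.pi_pos])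
  have h2 := h1.comp hlim
  have h3 : ((fun τ => jacobiTheta τ - 1) ∘ fun n : ℕ => (2 ^ n * τ + 1 : ℂ)) = fun _ => -1 := by
    funext n
    have := hz n
    rw [theta4] at this
    simp [this]
  rw [h3] at h2
  have := tendsto_nhds_unique h2 tendsto_const_nhds
  norm_num at this

theorem jacobiTheta_ne_zero {τ : ℂ} (hτ : 0 < τ.im) : jacobiTheta τ ≠ 0 := by
  intro h
  have := theta4_two_mul_pow hτ
  rw [h, zero_pow two_ne_zero, zero_mul] at this
  exact theta4_ne_zero (two_mul_im_pos hτ) (eq_zero_of_pow_eq_zero this)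

/-! ### Modular transformations of theta constants -/

theorem neg_inv_im_pos {τ : ℂ} (hτ : 0 < τ.im) : 0 < (-1 / τ).im := by
  have h0 : τ ≠ 0 := by rintro rfl; simp at hτ
  rw [neg_div, Complex.neg_im, one_div, Complex.inv_im]
  have := Complex.normSq_pos.mpr h0
  rw [neg_div, neg_neg]; positivity

theorem cpow_half_pow_four {z : ℂ} : (z ^ (1 / 2 : ℂ)) ^ 4 = z ^ 2 := by
  rw [← Complex.cpow_nat_mul]
  norm_num

/-- The functional equation of the two-variable theta function at the point 1/2; taking fourth
powers removes the branch of the square root. -/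
theorem theta2_S {τ : ℂ} (hτ : 0 < τ.im) :
    theta2 (-1 / τ) ^ 4 = -τ ^ 2 * theta4 τ ^ 4 := by
  have h0 : τ ≠ 0 := by rintro rfl; simp at hτ
  have h1 : (-Complex.I * τ) ^ 2 ≠ 0 := by simp [h0]
  have h := jacobiTheta₂_functional_equation (1 / 2) τ
  rw [← theta4_eq] at h
  have h2 : theta2 (-1 / τ) =
      Complex.exp (-Real.pi * Complex.I * (1 / 2) ^ 2 / τ) * jacobiTheta₂ (1 / 2 / τ) (-1 / τ) := by
    rw [theta2_eq]
    congr 1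
    · congr 1; ring
    · rw [← jacobiTheta₂_neg_left]; congr 1; ring
  rw [mul_assoc, ← h2] at h
  rw [h, mul_pow, div_pow, cpow_half_pow_four, mul_pow, neg_sq, Complex.I_sq]
  field_simp

theorem theta4_S {τ : ℂ} (hτ : 0 < τ.im) : theta4 (-1 / τ) ^ 4 = -τ ^ 2 * theta2 τ ^ 4 := by
  have h0 : τ ≠ 0 := by rintro rfl; simp at hτ
  have h := theta2_S (neg_inv_im_pos hτ)
  rw [show -1 / (-1 / τ) = τ by field_simp] at h
  rw [h]; field_simp

theorem jacobiTheta_S {τ : ℂ} (hτ : 0 < τ.im) :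
    jacobiTheta (-1 / τ) ^ 4 = -τ ^ 2 * jacobiTheta τ ^ 4 := by
  rw [jacobi_identity hτ, jacobi_identity (neg_inv_im_pos hτ), theta2_S hτ, theta4_S hτ]
  ring

theorem theta2_ne_zero {τ : ℂ} (hτ : 0 < τ.im) : theta2 τ ≠ 0 := by
  have h0 : τ ≠ 0 := by rintro rfl; simp at hτ
  intro h
  have h1 := theta4_S hτ
  rw [h, zero_pow (by norm_num), mul_zero] at h1
  exact theta4_ne_zero (neg_inv_im_pos hτ) (eq_zero_of_pow_eq_zero h1)

theorem theta2_T (τ : ℂ) : theta2 (τ + 1) ^ 4 = -theta2 τ ^ 4 := by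
  have h : theta2 (τ + 1) = Complex.exp (Real.pi * Complex.I / 4) * theta2 τ := by
    rw [theta2, theta2, ← tsum_mul_left]
    refine tsum_congr fun n => ?_
    -- (n + 1/2)² = n(n + 1) + 1/4 with n(n + 1) even, so all terms acquire the same eighth root of
    -- unity.
    have h1 : Complex.exp (Real.pi * Complex.I * ((n * (n + 1) : ℤ) : ℂ)) = 1 := by
      rw [exp_pi_I_mul_int]
      exact (Int.even_mul_succ_self n).neg_one_zpow
    have h2 : Real.pi * Complex.I * ((n : ℂ) + 1 / 2) ^ 2 * (τ + 1) =
        (Real.pi * Complex.I / 4 + Real.pi * Complex.I * ((n : ℂ) + 1 / 2) ^ 2 * τ) +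
          Real.pi * Complex.I * ((n * (n + 1) : ℤ) : ℂ) := by push_cast; ring
    rw [h2, Complex.exp_add, h1, mul_one, Complex.exp_add]
  rw [h, mul_pow, ← Complex.exp_nat_mul]
  have : Complex.exp ((4 : ℕ) * (Real.pi * Complex.I / 4)) = -1 := by
    rw [← Complex.exp_pi_mul_I]; congr 1; push_cast; ring
  rw [this, neg_one_mul]

theorem theta4_T (τ : ℂ) : theta4 (τ + 1) = jacobiTheta τ := by
  rw [theta4, ← jacobiTheta_two_add τ]; congr 1; ring

theorem differentiableAt_theta2 {τ : ℂ} (hτ : 0 < τ.im) : DifferentiableAt ℂ theta2 τ := by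
  have h : theta2 = fun τ => Complex.exp (Real.pi * Complex.I * τ / 4) * jacobiTheta₂ (τ / 2) τ :=
    funext theta2_eq
  rw [h]
  refine DifferentiableAt.mul (by fun_prop) ?_
  exact DifferentiableAt.comp τ (f := fun τ : ℂ => (τ / 2, τ))
    (hasFDerivAt_jacobiTheta₂ (τ / 2) hτ).differentiableAt (by fun_prop)

theorem differentiableAt_theta4 {τ : ℂ} (hτ : 0 < τ.im) : DifferentiableAt ℂ theta4 τ :=
  DifferentiableAt.comp τ (f := fun τ : ℂ => τ + 1)
    (differentiableAt_jacobiTheta (by simpa using hτ)) (by fun_prop)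

/-! ### The modular function as a function on `ℂ` -/

/-- The modular function `λ`, as a function on `ℂ` (of interest on the upper half plane). -/
def lam (τ : ℂ) : ℂ := (theta2 τ / jacobiTheta τ) ^ 4

theorem modularLambda_eq_lam (τ : ℍ) : modularLambda τ = lam τ := rfl

theorem differentiableAt_lam {τ : ℂ} (hτ : 0 < τ.im) : DifferentiableAt ℂ lam τ :=
  ((differentiableAt_theta2 hτ).div (differentiableAt_jacobiTheta hτ) (jacobiTheta_ne_zero hτ)).pow 4

theorem analyticAt_lam {τ : ℂ} (hτ : 0 < τ.im) : AnalyticAt ℂ lam τ := by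
  have h : DifferentiableOn ℂ lam {z | 0 < z.im} := fun z hz =>
    (differentiableAt_lam hz).differentiableWithinAt
  exact h.analyticAt ((isOpen_lt continuous_const Complex.continuous_im).mem_nhds hτ)

theorem lam_ne_zero {τ : ℂ} (hτ : 0 < τ.im) : lam τ ≠ 0 :=
  pow_ne_zero _ (div_ne_zero (theta2_ne_zero hτ) (jacobiTheta_ne_zero hτ))

theorem one_sub_lam {τ : ℂ} (hτ : 0 < τ.im) : 1 - lam τ = (theta4 τ / jacobiTheta τ) ^ 4 := by
  have h := jacobi_identity hτ
  have h0 : jacobiTheta τ ≠ 0 := jacobiTheta_ne_zero hτ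
  rw [lam, div_pow, div_pow]
  field_simp
  linear_combination h

theorem lam_ne_one {τ : ℂ} (hτ : 0 < τ.im) : lam τ ≠ 1 := by
  intro h
  have h1 := one_sub_lam hτ
  rw [h, sub_self] at h1
  exact pow_ne_zero _ (div_ne_zero (theta4_ne_zero hτ) (jacobiTheta_ne_zero hτ)) h1.symm

theorem lam_S {τ : ℂ} (hτ : 0 < τ.im) : lam (-1 / τ) = 1 - lam τ := by
  have h0 : τ ≠ 0 := by rintro rfl; simp at hτ
  rw [one_sub_lam hτ, lam, div_pow, div_pow, theta2_S hτ, jacobiTheta_S hτ]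
  exact mul_div_mul_left _ _ (by simp [h0])

theorem lam_T {τ : ℂ} (hτ : 0 < τ.im) : lam (τ + 1) = lam τ / (lam τ - 1) := by
  have h : lam τ - 1 = -(theta4 τ / jacobiTheta τ) ^ 4 := by rw [← one_sub_lam hτ]; ring
  have h1 : jacobiTheta τ ≠ 0 := jacobiTheta_ne_zero hτ
  have h2 : theta4 τ ≠ 0 := theta4_ne_zero hτ
  rw [h, lam, lam, div_pow, div_pow, div_pow, theta2_T, ← theta4]
  field_simp

/-! ### The expansion of `λ` at the cusp `∞` -/

/-- The parameter `exp (π i τ)` as a function on `ℂ`. -/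
def qpar (τ : ℂ) : ℂ := Complex.exp (Real.pi * Complex.I * τ)

theorem norm_qpar (τ : ℂ) : ‖qpar τ‖ = Real.exp (-Real.pi * τ.im) := by
  rw [qpar, Complex.norm_exp]; simp

theorem norm_qpar_lt_one {τ : ℂ} (hτ : 0 < τ.im) : ‖qpar τ‖ < 1 := by
  rw [norm_qpar, Real.exp_lt_one_iff]
  nlinarith [Real.pi_pos]

theorem qpar_ne_zero (τ : ℂ) : qpar τ ≠ 0 := Complex.exp_ne_zero _

theorem hasDerivAt_qpar (τ : ℂ) : HasDerivAt qpar (qpar τ * (Real.pi * Complex.I)) τ := by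
  have := ((hasDerivAt_id τ).const_mul (Real.pi * Complex.I : ℂ)).cexp
  exact (this.congr_deriv (by simp [qpar]))

/-- The lacunary power series with exponents `e`. -/
def lacunary (e : ℕ → ℕ) (q : ℂ) : ℂ := ∑' n, q ^ e n

theorem hasSum_lacunary {e : ℕ → ℕ} (he : ∀ n, n ≤ e n) {q : ℂ} (hq : ‖q‖ < 1) :
    HasSum (fun n => q ^ e n) (lacunary e q) := by
  have : Summable (fun n => q ^ e n) := by
    refine Summable.of_norm_bounded (summable_geometric_of_lt_one (norm_nonneg q) hq) fun n => ?_
    rw [norm_pow]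
    exact pow_le_pow_of_le_one (norm_nonneg q) hq.le (he n)
  exact this.hasSum

theorem analyticAt_lacunary {e : ℕ → ℕ} (he : ∀ n, n ≤ e n) : AnalyticAt ℂ (lacunary e) 0 := by
  have h : DifferentiableOn ℂ (lacunary e) (Metric.ball 0 (1 / 2)) := by
    refine Complex.differentiableOn_tsum_of_summable_norm
      (summable_geometric_of_lt_one (r := 1 / 2) (by norm_num) (by norm_num))
      (fun n => (differentiable_id.pow _).differentiableOn) Metric.isOpen_ball fun n q hq => ?_
    have hq' : ‖q‖ < 1 / 2 := by simpa using hq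
    rw [norm_pow]
    calc ‖q‖ ^ e n ≤ ‖q‖ ^ n := pow_le_pow_of_le_one (norm_nonneg q) (by linarith) (he n)
      _ ≤ _ := pow_le_pow_left₀ (norm_nonneg q) hq'.le n
  exact h.analyticAt (Metric.ball_mem_nhds _ (by norm_num))

theorem lacunary_zero {e : ℕ → ℕ} (h0 : e 0 = 0) (he : ∀ n, n ≤ e n) : lacunary e 0 = 1 := by
  rw [lacunary, tsum_eq_single 0]
  · simp [h0]
  · intro n hn
    have := he n
    rw [zero_pow (by omega)]

theorem jacobiTheta_eq_lacunary {τ : ℂ} (hτ : 0 < τ.im) :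
    jacobiTheta τ = 1 + 2 * qpar τ * lacunary (fun n => n ^ 2 + 2 * n) (qpar τ) := by
  have h1 := hasSum_nat_jacobiTheta hτ
  have h2 := (hasSum_lacunary (e := fun n => n ^ 2 + 2 * n) (fun n => by nlinarith)
    (norm_qpar_lt_one hτ)).mul_left (qpar τ)
  have h3 := h1.unique (h2.congr_fun fun n => ?_)
  · linear_combination 2 * h3
  · rw [qpar, ← Complex.exp_nat_mul, ← Complex.exp_add]
    congr 1; push_cast; ring

/-- The indices n and -n - 1 give equal terms, whence the factor 2, and (n + 1/2)² = n² + n + 1/4.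
-/
theorem theta2_eq_lacunary {τ : ℂ} (hτ : 0 < τ.im) :
    theta2 τ = 2 * Complex.exp (Real.pi * Complex.I * τ / 4) *
      lacunary (fun n => n ^ 2 + n) (qpar τ) := by
  have h1 := (hasSum_lacunary (e := fun n => n ^ 2 + n) (fun n => by nlinarith)
    (norm_qpar_lt_one hτ)).mul_left (Complex.exp (Real.pi * Complex.I * τ / 4))
  have h2 := HasSum.of_nat_of_neg_add_one
    (f := fun n : ℤ => Complex.exp (Real.pi * Complex.I * ((n : ℂ) + 1 / 2) ^ 2 * τ))
    (h1.congr_fun fun n => ?_) (h1.congr_fun fun n => ?_)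
  · rw [(hasSum_theta2 hτ).unique h2]; ring
  all_goals
    rw [qpar, ← Complex.exp_nat_mul, ← Complex.exp_add]
    congr 1; push_cast; ring

/-- This form shows that the series has no linear term, so θ₂ does not contribute to the coefficient
-8 of the expansion of λ. -/
theorem lacunary_pronic {q : ℂ} (hq : ‖q‖ < 1) :
    lacunary (fun n => n ^ 2 + n) q = 1 + q ^ 2 * lacunary (fun n => n ^ 2 + 3 * n) q := by
  have h1 := hasSum_lacunary (e := fun n => n ^ 2 + n) (fun n => by nlinarith) hq
  have h2 := (hasSum_lacunary (e := fun n => n ^ 2 + 3 * n) (fun n => by nlinarith) hq).mul_left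
    (q ^ 2)
  have h3 := (hasSum_nat_add_iff' 1).mpr h1
  have h4 := h3.unique (h2.congr_fun fun n => ?_)
  · simp at h4; linear_combination h4
  · rw [← pow_add]; congr 1; ring

/-- The expansion `λ = 16 q (1 - 8 q + O(q²))`. -/
theorem exists_lam_expansion : ∃ U : ℂ → ℂ, AnalyticAt ℂ U 0 ∧ U 0 = 1 ∧ deriv U 0 = -8 ∧
    ∀ τ : ℂ, 0 < τ.im → lam τ = 16 * qpar τ * U (qpar τ) := by
  set A := lacunary (fun n => n ^ 2 + 2 * n) with hA
  set B := lacunary (fun n => n ^ 2 + n) with hB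
  set C := lacunary (fun n => n ^ 2 + 3 * n) with hC
  have hAa : AnalyticAt ℂ A 0 := analyticAt_lacunary fun n => by nlinarith
  have hBa : AnalyticAt ℂ B 0 := analyticAt_lacunary fun n => by nlinarith
  have hCa : AnalyticAt ℂ C 0 := analyticAt_lacunary fun n => by nlinarith
  have hA0 : A 0 = 1 := lacunary_zero (by simp) fun n => by nlinarith
  have hB0 : B 0 = 1 := lacunary_zero (by simp) fun n => by nlinarith
  have hBd : HasDerivAt B 0 0 := by
    have h1 : HasDerivAt (fun q => 1 + q ^ 2 * C q) 0 0 := by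
      have := (((hasDerivAt_id (0 : ℂ)).pow 2).mul hCa.differentiableAt.hasDerivAt).const_add 1
      exact this.congr_deriv (by simp)
    refine h1.congr_of_eventuallyEq ?_
    filter_upwards [Metric.ball_mem_nhds (0 : ℂ) one_pos] with q hq
    exact lacunary_pronic (by simpa using hq)
  have hDd : HasDerivAt (fun q => 1 + 2 * q * A q) 2 0 := by
    have := ((((hasDerivAt_id (0 : ℂ)).const_mul 2).mul hAa.differentiableAt.hasDerivAt).const_add 1)
    exact this.congr_deriv (by simp [hA0])
  refine ⟨fun q => (B q / (1 + 2 * q * A q)) ^ 4, ?_, by simp [hB0], ?_, fun τ hτ => ?_⟩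
  · refine (hBa.div ?_ (by simp)).pow 4
    exact analyticAt_const.add ((analyticAt_const.mul analyticAt_id).mul hAa)
  · have := ((hBd.div hDd (by simp)).pow 4).deriv
    rw [show (fun q => (B q / (1 + 2 * q * A q)) ^ 4) = (B / fun q => 1 + 2 * q * A q) ^ 4 from rfl,
      this]
    simp [hB0]; norm_num
  · rw [lam, theta2_eq_lacunary hτ, jacobiTheta_eq_lacunary hτ]
    have h4 : Complex.exp (Real.pi * Complex.I * τ / 4) ^ 4 = qpar τ := by
      rw [← Complex.exp_nat_mul, qpar]; congr 1; push_cast; ring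
    rw [mul_div_assoc, mul_pow, mul_pow, h4]
    norm_num [hA, hB]

theorem tendsto_qpar : Tendsto qpar (comap Complex.im atTop) (𝓝 0) := by
  rw [tendsto_zero_iff_norm_tendsto_zero]
  simp only [norm_qpar]
  exact Real.tendsto_exp_atBot.comp (tendsto_comap.const_mul_atTop_of_neg (by linarith [Real.pi_pos]))

theorem eventually_im_pos : ∀ᶠ τ : ℂ in comap Complex.im atTop, 0 < τ.im :=
  tendsto_comap.eventually (eventually_gt_atTop 0)

theorem tendsto_lam : Tendsto lam (comap Complex.im atTop) (𝓝 0) := by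
  obtain ⟨U, hU, hU0, -, hlam⟩ := exists_lam_expansion
  have h1 : Tendsto (fun q => 16 * q * U q) (𝓝 0) (𝓝 0) := by
    have : ContinuousAt (fun q => 16 * q * U q) 0 :=
      (continuousAt_const.mul continuousAt_id).mul hU.continuousAt
    simpa [ContinuousAt] using this
  refine (h1.comp tendsto_qpar).congr' ?_
  filter_upwards [eventually_im_pos] with τ hτ using (hlam τ hτ).symm

theorem tendsto_theta4 : Tendsto theta4 (comap Complex.im atTop) (𝓝 1) := by
  have h1 : Tendsto (fun τ => jacobiTheta τ - 1) (comap Complex.im atTop) (𝓝 0) := by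
    refine isBigO_at_im_infty_jacobiTheta_sub_one.trans_tendsto ?_
    refine Real.tendsto_exp_atBot.comp ?_
    exact tendsto_comap.const_mul_atTop_of_neg (by linarith [Real.pi_pos])
  have h2 : Tendsto (fun τ : ℂ => τ + 1) (comap Complex.im atTop) (comap Complex.im atTop) := by
    rw [tendsto_comap_iff]
    have : Complex.im ∘ (fun τ : ℂ => τ + 1) = Complex.im := by funext τ; simp
    rw [this]; exact tendsto_comap
  have h3 := (h1.comp h2).add_const 1
  simp only [Function.comp_def, sub_add_cancel, zero_add] at h3
  exact h3

/-! ### The action of the modular group on `λ` -/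

open ModularGroup in
theorem coe_T_smul (τ : ℍ) : ((T • τ : ℍ) : ℂ) = τ + 1 := by
  rw [UpperHalfPlane.modular_T_smul, UpperHalfPlane.coe_vadd]; push_cast; ring

open ModularGroup in
theorem coe_S_smul (τ : ℍ) : ((S • τ : ℍ) : ℂ) = -1 / τ := by
  rw [UpperHalfPlane.modular_S_smul]
  simp [neg_div, inv_neg]

/-- The anharmonic action of the matrices mod `2` on the values of `λ`. -/
def anharmonic (a b c d : ZMod 2) (l : ℂ) : ℂ :=
  if b = 0 ∧ c = 0 then l else if c = 0 then l / (l - 1) else if a = 0 ∧ d = 0 then 1 - l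
  else if a = 0 then 1 / (1 - l) else if d = 0 then (l - 1) / l else 1 / l

theorem zmod_two_cases : ∀ a : ZMod 2, a = 0 ∨ a = 1 := by decide

/-- A finite check over the matrices mod 2: right multiplication by S corresponds to the
substitution l ↦ 1 - l. -/
theorem anharmonic_S (a b c d : ZMod 2) (h : a * d - b * c = 1) {l : ℂ} (h1 : l ≠ 1) :
    anharmonic b (-a) d (-c) l = anharmonic a b c d (1 - l) := by
  have h2 : l - 1 ≠ 0 := sub_ne_zero.mpr h1
  have h3 : 1 - l ≠ 0 := sub_ne_zero.mpr h1.symm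
  have e1 : (-1 : ZMod 2) = 1 := rfl
  rcases zmod_two_cases a with rfl | rfl <;> rcases zmod_two_cases b with rfl | rfl <;>
    rcases zmod_two_cases c with rfl | rfl <;> rcases zmod_two_cases d with rfl | rfl <;>
    simp [anharmonic, e1] at h ⊢ <;> grind

theorem anharmonic_T (a b c d : ZMod 2) (h : a * d - b * c = 1) {l : ℂ} (h0 : l ≠ 0) (h1 : l ≠ 1) :
    anharmonic a (a + b) c (c + d) l = anharmonic a b c d (l / (l - 1)) := by
  have h2 : l - 1 ≠ 0 := sub_ne_zero.mpr h1
  have h3 : 1 - l ≠ 0 := sub_ne_zero.mpr h1.symm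
  have e1 : (-1 : ZMod 2) = 1 := rfl
  have e2 : (1 + 1 : ZMod 2) = 0 := rfl
  rcases zmod_two_cases a with rfl | rfl <;> rcases zmod_two_cases b with rfl | rfl <;>
    rcases zmod_two_cases c with rfl | rfl <;> rcases zmod_two_cases d with rfl | rfl <;>
    simp [anharmonic, e1, e2] at h ⊢ <;> grind

open scoped MatrixGroups in
open ModularGroup in
/-- Induction along the generators `S`, `T` of the modular group. -/
theorem modular_induction {P : SL(2, ℤ) → Prop} (one : P 1) (hS : ∀ γ, P γ → P (γ * S))
    (hT : ∀ γ, P γ → P (γ * T)) (hT' : ∀ γ, P γ → P (γ * T⁻¹)) (γ : SL(2, ℤ)) : P γ := by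
  have hmem : γ ∈ Subgroup.closure {S, T} := by
    rw [SpecialLinearGroup.SL2Z_generators]; trivial
  have hSinv : S⁻¹ = S * S * S := by decide
  induction hmem using Subgroup.closure_induction_right with
  | one => exact one
  | mul_right x hx y hy h =>
    rcases hy with rfl | rfl
    · exact hS _ h
    · exact hT _ h
  | mul_inv_cancel x hx y hy h =>
    rcases hy with rfl | rfl
    · rw [hSinv, ← mul_assoc, ← mul_assoc]; exact hS _ (hS _ (hS _ h))
    · exact hT' _ h

open scoped MatrixGroups in
open ModularGroup in
/-- A function on `ℍ` that is invariant under `S` and `T` is invariant under the modular group. -/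
theorem modular_invariant {α : Type*} {f : ℍ → α} (hS : ∀ τ, f (S • τ) = f τ)
    (hT : ∀ τ, f (T • τ) = f τ) (γ : SL(2, ℤ)) (τ : ℍ) : f (γ • τ) = f τ := by
  induction γ using modular_induction generalizing τ with
  | one => rw [one_smul]
  | hS γ h => rw [mul_smul, h, hS]
  | hT γ h => rw [mul_smul, h, hT]
  | hT' γ h => rw [mul_smul, h, ← hT, smul_inv_smul]

theorem lam_coe_ne_zero (τ : ℍ) : lam τ ≠ 0 := lam_ne_zero τ.im_pos
theorem lam_coe_ne_one (τ : ℍ) : lam τ ≠ 1 := lam_ne_one τ.im_pos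

open scoped MatrixGroups in
open ModularGroup in
-- Words grow on the right because (γS) • τ = γ • (S • τ): the induction hypothesis is used at S •
-- τ, and the transformation law of λ then composes with the anharmonic function of γ.
theorem lam_smul (γ : SL(2, ℤ)) (τ : ℍ) :
    lam ↑(γ • τ) = anharmonic (γ 0 0 : ℤ) (γ 0 1 : ℤ) (γ 1 0 : ℤ) (γ 1 1 : ℤ) (lam τ) := by
  have hdet : ∀ γ : SL(2, ℤ), ((γ 0 0 : ℤ) : ZMod 2) * (γ 1 1 : ℤ) - (γ 0 1 : ℤ) * (γ 1 0 : ℤ) = 1 := by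
    intro γ
    have := γ.det_coe
    rw [Matrix.det_fin_two] at this
    exact_mod_cast congrArg (Int.cast : ℤ → ZMod 2) this
  induction γ using modular_induction generalizing τ with
  | one => simp [anharmonic]
  | hS γ h =>
    rw [mul_smul, h, coe_S_smul, lam_S τ.im_pos, ← anharmonic_S _ _ _ _ (hdet γ)
      (lam_coe_ne_one τ)]
    simp [Matrix.SpecialLinearGroup.coe_mul, coe_S, Matrix.mul_apply, Fin.sum_univ_two]
  | hT γ h =>
    rw [mul_smul, h, coe_T_smul, lam_T τ.im_pos, ← anharmonic_T _ _ _ _ (hdet γ)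
      (lam_coe_ne_zero τ) (lam_coe_ne_one τ)]
    simp [Matrix.SpecialLinearGroup.coe_mul, coe_T, Matrix.mul_apply, Fin.sum_univ_two]
  | hT' γ h =>
    -- l ↦ l/(l - 1) is an involution, so T⁻¹ acts on λ as T does.
    have h1 : lam ↑(T⁻¹ • τ) = lam τ / (lam τ - 1) := by
      have h2 := lam_T (T⁻¹ • τ).im_pos
      rw [← coe_T_smul, smul_inv_smul] at h2
      have h3 : lam ↑(T⁻¹ • τ) - 1 ≠ 0 := sub_ne_zero.mpr (lam_coe_ne_one _)
      rw [h2]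
      field_simp
      ring
    rw [mul_smul, h, h1, ← anharmonic_T _ _ _ _ (hdet γ) (lam_coe_ne_zero τ) (lam_coe_ne_one τ)]
    have e : ∀ x : ZMod 2, -x = x := by decide
    simp [Matrix.SpecialLinearGroup.coe_mul, Matrix.mul_apply, Fin.sum_univ_two, e]

theorem lam_smul_of_mem {γ : Matrix.SpecialLinearGroup (Fin 2) ℤ}
    (hγ : γ ∈ CongruenceSubgroup.Gamma 2) (τ : ℍ) : lam ↑(γ • τ) = lam τ := by
  rw [lam_smul]
  obtain ⟨-, h1, h2, -⟩ := CongruenceSubgroup.Gamma_mem.mp hγ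
  have h1' : ((γ 0 1 : ℤ) : ZMod 2) = 0 := by exact_mod_cast h1
  have h2' : ((γ 1 0 : ℤ) : ZMod 2) = 0 := by exact_mod_cast h2
  rw [anharmonic, if_pos ⟨h1', h2'⟩]

/-! ### The derivative of `λ` -/

theorem eventually_comap_im_iff {p : ℂ → Prop} :
    (∀ᶠ τ in comap Complex.im atTop, p τ) ↔ ∃ Y, ∀ τ : ℂ, Y ≤ τ.im → p τ := by
  rw [eventually_comap, eventually_atTop]
  exact ⟨fun ⟨Y, h⟩ => ⟨Y, fun τ hτ => h _ hτ τ rfl⟩, fun ⟨Y, h⟩ => ⟨Y, fun _ hy τ e => h τ (e ▸ hy)⟩⟩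

theorem eventually_im_pos_nhds {τ : ℂ} (hτ : 0 < τ.im) : ∀ᶠ z : ℂ in 𝓝 τ, 0 < z.im :=
  Complex.continuous_im.continuousAt.eventually_const_lt hτ

/-- The logarithmic derivative of `λ` divided by `θ₄⁴`. -/
def lamRatio (τ : ℂ) : ℂ := deriv lam τ / (lam τ * theta4 τ ^ 4)

theorem deriv_lam_T {τ : ℂ} (hτ : 0 < τ.im) :
    deriv lam (τ + 1) = -deriv lam τ / (lam τ - 1) ^ 2 := by
  have h1 : lam τ - 1 ≠ 0 := sub_ne_zero.mpr (lam_ne_one hτ)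
  have hd := (differentiableAt_lam hτ).hasDerivAt
  have h2 := (hd.div (hd.sub_const 1) h1).deriv
  rw [← deriv_comp_add_const]
  have : (fun z => lam (z + 1)) =ᶠ[𝓝 τ] lam / fun z => lam z - 1 := by
    filter_upwards [eventually_im_pos_nhds hτ] with z hz using lam_T hz
  rw [this.deriv_eq, h2]
  congr 1; ring

theorem deriv_lam_S {τ : ℂ} (hτ : 0 < τ.im) : deriv lam (-1 / τ) = -τ ^ 2 * deriv lam τ := by
  have h0 : τ ≠ 0 := by rintro rfl; simp at hτ
  have hd := (differentiableAt_lam hτ).hasDerivAt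
  have hi : HasDerivAt (fun z : ℂ => -1 / z) (1 / τ ^ 2) τ := by
    have := (hasDerivAt_inv h0).const_mul (-1)
    simpa [div_eq_mul_inv] using this
  have h1 := ((differentiableAt_lam (neg_inv_im_pos hτ)).hasDerivAt).comp τ hi
  have h2 : (lam ∘ fun z : ℂ => -1 / z) =ᶠ[𝓝 τ] fun z => 1 - lam z := by
    filter_upwards [eventually_im_pos_nhds hτ] with z hz using lam_S hz
  have h3 := h1.unique ((hd.const_sub 1).congr_of_eventuallyEq h2)
  rw [mul_one_div, div_eq_iff (pow_ne_zero 2 h0)] at h3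
  linear_combination h3

theorem lamRatio_T {τ : ℂ} (hτ : 0 < τ.im) : lamRatio (τ + 1) = lamRatio τ := by
  have h1 : lam τ - 1 ≠ 0 := sub_ne_zero.mpr (lam_ne_one hτ)
  have h2 := lam_ne_zero hτ
  have h3 : jacobiTheta τ ≠ 0 := jacobiTheta_ne_zero hτ
  have h4 := theta4_ne_zero hτ
  have h5 : lam τ - 1 = -(theta4 τ / jacobiTheta τ) ^ 4 := by rw [← one_sub_lam hτ]; ring
  rw [lamRatio, lamRatio, deriv_lam_T hτ, lam_T hτ, theta4_T, div_div]
  rw [show (lam τ - 1) ^ 2 * (lam τ / (lam τ - 1) * jacobiTheta τ ^ 4) =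
    (lam τ - 1) * (lam τ * jacobiTheta τ ^ 4) by field_simp, h5]
  field_simp

theorem lamRatio_S {τ : ℂ} (hτ : 0 < τ.im) : lamRatio (-1 / τ) = lamRatio τ := by
  have h0 : τ ≠ 0 := by rintro rfl; simp at hτ
  have h1 : 1 - lam τ ≠ 0 := sub_ne_zero.mpr (lam_ne_one hτ).symm
  have h2 := lam_ne_zero hτ
  have h3 : jacobiTheta τ ≠ 0 := jacobiTheta_ne_zero hτ
  have h4 := theta4_ne_zero hτ
  have h5 := theta2_ne_zero hτ
  rw [lamRatio, lamRatio, deriv_lam_S hτ, lam_S hτ, theta4_S hτ, one_sub_lam hτ, lam]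
  field_simp

theorem isOpen_im_pos : IsOpen {z : ℂ | 0 < z.im} := isOpen_lt continuous_const Complex.continuous_im

theorem differentiableOn_lamRatio : DifferentiableOn ℂ lamRatio {z | 0 < z.im} := by
  intro z hz
  refine DifferentiableAt.differentiableWithinAt ?_
  exact (analyticAt_lam hz).deriv.differentiableAt.div
    ((differentiableAt_lam hz).mul ((differentiableAt_theta4 hz).pow 4))
    (mul_ne_zero (lam_ne_zero hz) (pow_ne_zero _ (theta4_ne_zero hz)))

/-- With λ = 16 q U(q) and q' = πi q the logarithmic derivative of λ is πi (1 + q U'(q)/U(q)), and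
θ₄ → 1. -/
theorem tendsto_lamRatio : Tendsto lamRatio (comap Complex.im atTop) (𝓝 (Real.pi * Complex.I)) := by
  obtain ⟨U, hU, hU0, -, hlam⟩ := exists_lam_expansion
  set W : ℂ → ℂ := fun q => (U q + q * deriv U q) / U q * (Real.pi * Complex.I) with hW
  have hWc : ContinuousAt W 0 := by
    have := hU.deriv.continuousAt
    have := hU.continuousAt
    exact ((this.add (continuousAt_id.mul hU.deriv.continuousAt)).div this
      (by simp [hU0])).mul continuousAt_const
  have hW0 : W 0 = Real.pi * Complex.I := by simp [hW, hU0]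
  have h1 : Tendsto (fun τ => W (qpar τ) / theta4 τ ^ 4) (comap Complex.im atTop)
      (𝓝 (Real.pi * Complex.I / 1 ^ 4)) := by
    refine Tendsto.div ?_ (tendsto_theta4.pow 4) (by norm_num)
    have := hWc.tendsto.comp tendsto_qpar
    rwa [hW0] at this
  rw [one_pow, div_one] at h1
  refine h1.congr' ?_
  have hUa := tendsto_qpar.eventually hU.eventually_analyticAt
  filter_upwards [eventually_im_pos, hUa] with τ hτ hUq
  have hd : HasDerivAt lam (16 * (qpar τ * (Real.pi * Complex.I)) * U (qpar τ) +
      16 * qpar τ * (deriv U (qpar τ) * (qpar τ * (Real.pi * Complex.I)))) τ := by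
    have h2 := ((hasDerivAt_qpar τ).const_mul 16).mul
      (hUq.differentiableAt.hasDerivAt.comp τ (hasDerivAt_qpar τ))
    refine h2.congr_of_eventuallyEq ?_
    filter_upwards [eventually_im_pos_nhds hτ] with z hz using hlam z hz
  have h3 := qpar_ne_zero τ
  have h4 := theta4_ne_zero hτ
  have h5 : U (qpar τ) ≠ 0 := by
    intro h; have := hlam τ hτ; rw [h, mul_zero] at this; exact lam_ne_zero hτ this
  rw [lamRatio, hd.deriv, hlam τ hτ, hW]
  field_simp

open scoped MatrixGroups in
open ModularGroup in
theorem lamRatio_smul (γ : SL(2, ℤ)) (τ : ℍ) : lamRatio ↑(γ • τ) = lamRatio τ :=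
  modular_invariant (f := fun τ : ℍ => lamRatio τ)
    (fun τ => by rw [coe_S_smul, lamRatio_S τ.im_pos])
    (fun τ => by rw [coe_T_smul, lamRatio_T τ.im_pos]) γ τ

open ModularGroup in
-- G is modular invariant and tends to 0 at the cusp. If it is nonzero somewhere, the compactness of
-- the truncated fundamental domain makes |G| attain a positive maximum; by the maximum modulus
-- principle |G| is then constant, which contradicts the limit.
theorem lamRatio_eq {τ : ℂ} (hτ : 0 < τ.im) : lamRatio τ = Real.pi * Complex.I := by
  by_contra hne
  set c : ℂ := Real.pi * Complex.I
  set G : ℂ → ℂ := fun z => lamRatio z - c with hG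
  have hGd : DifferentiableOn ℂ G {z | 0 < z.im} := differentiableOn_lamRatio.sub_const c
  have hGinv : ∀ (γ : Matrix.SpecialLinearGroup (Fin 2) ℤ) (z : ℍ), G ↑(γ • z) = G z := fun γ z => by simp only [hG, lamRatio_smul]
  have hG0 : 0 < ‖G τ‖ := norm_pos_iff.mpr (sub_ne_zero.mpr hne)
  have hlim : Tendsto (fun z => ‖G z‖) (comap Complex.im atTop) (𝓝 0) := by
    have := (tendsto_lamRatio.sub_const c).norm
    simpa [hG, c] using this
  obtain ⟨Y, hY⟩ := eventually_comap_im_iff.mp (hlim.eventually (gt_mem_nhds hG0))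
  have hGc : ContinuousOn (fun z : ℍ => ‖G z‖) (truncatedFundamentalDomain Y) := by
    refine Continuous.continuousOn ?_
    refine (continuous_iff_continuousAt.mpr fun z => ?_).norm
    exact ((hGd.differentiableAt (isOpen_im_pos.mem_nhds z.im_pos)).continuousAt.comp
      UpperHalfPlane.continuous_coe.continuousAt)
  have hmove : ∀ z : ℍ, (∃ w ∈ truncatedFundamentalDomain Y, G w = G z) ∨ ‖G z‖ < ‖G τ‖ := by
    intro z
    obtain ⟨γ, hγ⟩ := exists_smul_mem_fd z
    rcases le_or_gt (γ • z).im Y with h | h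
    · exact Or.inl ⟨γ • z, ⟨hγ, h⟩, hGinv γ z⟩
    · right; rw [← hGinv γ z]; exact hY _ h.le
  obtain ⟨w, hw, hwτ⟩ := (hmove ⟨τ, hτ⟩).resolve_right (lt_irrefl _)
  obtain ⟨x, hx, hxmax⟩ := (isCompact_truncatedFundamentalDomain Y).exists_isMaxOn ⟨w, hw⟩ hGc
  have hxτ : ‖G τ‖ ≤ ‖G x‖ := by
    have := hxmax hw
    simp only [Set.mem_ofPred_eq] at this
    rwa [hwτ] at this
  have hmax : IsMaxOn (norm ∘ G) {z : ℂ | 0 < z.im} x := by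
    intro z hz
    rcases hmove ⟨z, hz⟩ with ⟨v, hv, hvz⟩ | h
    · have := hxmax hv
      simp only [Set.mem_ofPred_eq] at this
      rwa [hvz] at this
    · exact h.le.trans hxτ
  have hconst := Complex.norm_eqOn_of_isPreconnected_of_isMaxOn
    (convex_halfSpace_im_gt 0).isPreconnected isOpen_im_pos hGd x.im_pos hmax
  set z0 : ℂ := ((max Y 1 : ℝ) : ℂ) * Complex.I
  have hz0 : z0.im = max Y 1 := by simp [z0]
  have h1 : ‖G z0‖ < ‖G τ‖ := hY z0 (by rw [hz0]; exact le_max_left _ _)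
  have h2 : ‖G z0‖ = ‖G x‖ := hconst (by
    change 0 < z0.im
    rw [hz0]; exact lt_of_lt_of_le one_pos (le_max_right _ _))
  linarith

theorem deriv_lam_eq {τ : ℂ} (hτ : 0 < τ.im) :
    deriv lam τ = Real.pi * Complex.I * (lam τ * theta4 τ ^ 4) := by
  have h := lamRatio_eq hτ
  rw [lamRatio, div_eq_iff (mul_ne_zero (lam_ne_zero hτ) (pow_ne_zero _ (theta4_ne_zero hτ)))] at h
  exact h

theorem deriv_lam_ne_zero {τ : ℂ} (hτ : 0 < τ.im) : deriv lam τ ≠ 0 := by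
  rw [deriv_lam_eq hτ]
  have := lam_ne_zero hτ
  have := theta4_ne_zero hτ
  have : (Real.pi : ℂ) ≠ 0 := by exact_mod_cast Real.pi_ne_zero
  simp [*]

/-! ### The fibres of `λ` -/

/-- A holomorphic function with nonzero derivative is a local homeomorphism. -/
theorem exists_openPartialHomeomorph {f : ℂ → ℂ} {z : ℂ} (hf : AnalyticAt ℂ f z)
    (hd : deriv f z ≠ 0) : ∃ e : OpenPartialHomeomorph ℂ ℂ, z ∈ e.source ∧ (e : ℂ → ℂ) = f := by
  have h := (hf.hasStrictDerivAt).hasStrictFDerivAt_equiv hd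
  exact ⟨h.toOpenPartialHomeomorph f, h.mem_toOpenPartialHomeomorph_source, rfl⟩

theorem exists_injOn {f : ℂ → ℂ} {z : ℂ} (hf : AnalyticAt ℂ f z)
    (hd : deriv f z ≠ 0) : ∃ U ∈ 𝓝 z, Set.InjOn f U := by
  obtain ⟨e, he, rfl⟩ := exists_openPartialHomeomorph hf hd
  exact ⟨e.source, e.open_source.mem_nhds he, e.injOn⟩

open scoped MatrixGroups in
-- Transported from the image of the group in GL₂(ℝ) along an injective homomorphism.
instance properlyDiscontinuousSMul_modular : ProperlyDiscontinuousSMul SL(2, ℤ) ℍ where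
  finite_disjoint_inter_image {K L} hK hL := by
    have h := (Subgroup.properlyDiscontinuousSMul_iff _).mp properlyDiscontinuousSL2ZRange hK hL
    refine Set.Finite.of_finite_image (f := Matrix.SpecialLinearGroup.mapGL ℝ) (h.subset ?_)
      (Matrix.SpecialLinearGroup.mapGL_injective).injOn
    rintro _ ⟨γ, hγ, rfl⟩
    exact ⟨⟨γ, rfl⟩, hγ⟩

open scoped MatrixGroups in
instance continuousConstSMul_modular : ContinuousConstSMul SL(2, ℤ) ℍ where
  continuous_const_smul γ := continuous_const_smul (Matrix.SpecialLinearGroup.mapGL ℝ γ)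

instance continuousConstSMul_subgroup (G : Subgroup (Matrix.SpecialLinearGroup (Fin 2) ℤ)) :
    ContinuousConstSMul G ℍ where
  continuous_const_smul γ := continuous_const_smul (γ : Matrix.SpecialLinearGroup (Fin 2) ℤ)

theorem continuous_lam_coe : Continuous fun τ : ℍ => lam τ :=
  continuous_iff_continuousAt.mpr fun τ =>
    (differentiableAt_lam τ.im_pos).continuousAt.comp UpperHalfPlane.continuous_coe.continuousAt

/-- `λ` is locally injective. -/
theorem lam_locally_injective (τ : ℍ) : ∃ U ∈ 𝓝 τ, Set.InjOn (fun τ : ℍ => lam τ) U := by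
  obtain ⟨U, hU, hinj⟩ := exists_injOn (analyticAt_lam τ.im_pos) (deriv_lam_ne_zero τ.im_pos)
  refine ⟨UpperHalfPlane.coe ⁻¹' U, UpperHalfPlane.continuous_coe.continuousAt.preimage_mem_nhds hU, fun x hx y hy h => ?_⟩
  exact UpperHalfPlane.ext (hinj hx hy h)

theorem isOpenMap_lam : IsOpenMap fun τ : ℍ => lam τ := by
  refine IsOpenMap.of_nhds_le fun τ => ?_
  have h1 : map lam (𝓝 (τ : ℂ)) = 𝓝 (lam τ) :=
    (analyticAt_lam τ.im_pos).hasStrictDerivAt.map_nhds_eq (deriv_lam_ne_zero τ.im_pos)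
  have h2 : map ((↑) : ℍ → ℂ) (𝓝 τ) = 𝓝 (τ : ℂ) :=
    UpperHalfPlane.isOpenEmbedding_coe.map_nhds_eq τ
  rw [← h1, ← h2, map_map]; rfl

/-- The absolute invariant (up to a constant) as a function of `λ`. -/
def jOfLam (l : ℂ) : ℂ := (l ^ 2 - l + 1) ^ 3 / (l ^ 2 * (1 - l) ^ 2)

open scoped MatrixGroups in
theorem jOfLam_smul (γ : SL(2, ℤ)) (τ : ℍ) : jOfLam (lam ↑(γ • τ)) = jOfLam (lam τ) := by
  refine modular_invariant (f := fun τ : ℍ => jOfLam (lam τ)) (fun τ => ?_) (fun τ => ?_) γ τ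
  · rw [coe_S_smul, lam_S τ.im_pos, jOfLam, jOfLam]
    congr 1 <;> ring
  · have h1 : lam τ - 1 ≠ 0 := sub_ne_zero.mpr (lam_coe_ne_one τ)
    have h2 : 1 - lam τ ≠ 0 := sub_ne_zero.mpr (lam_coe_ne_one τ).symm
    have h3 := lam_coe_ne_zero τ
    have h4 : 1 - lam τ / (lam τ - 1) = -1 / (lam τ - 1) := by field_simp; ring
    rw [coe_T_smul, lam_T τ.im_pos, jOfLam, jOfLam, h4]
    field_simp
    ring

theorem tendsto_norm_jOfLam : Tendsto (fun l => ‖jOfLam l‖) (𝓝[≠] 0) atTop := by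
  have h1 : Tendsto (fun l : ℂ => ‖(l ^ 2 - l + 1) ^ 3‖) (𝓝[≠] 0) (𝓝 1) := by
    have : ContinuousAt (fun l : ℂ => ‖(l ^ 2 - l + 1) ^ 3‖) 0 := by fun_prop
    have := this.tendsto.mono_left (nhdsWithin_le_nhds (s := {0}ᶜ))
    simpa using this
  have h2 : Tendsto (fun l : ℂ => ‖l ^ 2 * (1 - l) ^ 2‖) (𝓝[≠] 0) (𝓝[>] 0) := by
    refine tendsto_nhdsWithin_iff.mpr ⟨?_, ?_⟩
    · have : ContinuousAt (fun l : ℂ => ‖l ^ 2 * (1 - l) ^ 2‖) 0 := by fun_prop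
      have := this.tendsto.mono_left (nhdsWithin_le_nhds (s := {0}ᶜ))
      simpa using this
    · have h3 : ∀ᶠ l : ℂ in 𝓝[≠] 0, l ≠ 1 :=
        nhdsWithin_le_nhds (isOpen_ne.mem_nhds (by norm_num))
      filter_upwards [h3, self_mem_nhdsWithin] with l hl hl0
      have : 1 - l ≠ 0 := sub_ne_zero.mpr hl.symm
      have : l ≠ 0 := hl0
      exact norm_pos_iff.mpr (by positivity)
  refine (h1.pos_mul_atTop one_pos h2.inv_tendsto_nhdsGT_zero).congr fun l => ?_
  rw [jOfLam, norm_div, div_eq_mul_inv]; rfl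

theorem tendsto_lam_punctured : Tendsto lam (comap Complex.im atTop) (𝓝[≠] 0) :=
  tendsto_nhdsWithin_iff.mpr ⟨tendsto_lam, eventually_im_pos.mono fun _ h => lam_ne_zero h⟩

open ModularGroup in
open scoped MatrixGroups in
/-- Where the absolute invariant is bounded, `τ` can be moved into a compact set by `Γ(2)`. -/
theorem exists_isCompact_smul_mem (M : ℝ) : ∃ C : Set ℍ, IsCompact C ∧
    ∀ τ : ℍ, ‖jOfLam (lam τ)‖ ≤ M → ∃ γ ∈ CongruenceSubgroup.Gamma 2, γ • τ ∈ C := by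
  obtain ⟨Y, hY⟩ := eventually_comap_im_iff.mp
    ((tendsto_norm_jOfLam.comp tendsto_lam_punctured).eventually_gt_atTop M)
  -- Above height Y the invariant exceeds M, so the representative of τ in the fundamental domain
  -- lies below Y. Finitely many translates, one for each coset of Γ(2), then suffice.
  refine ⟨⋃ q : SL(2, ℤ) ⧸ CongruenceSubgroup.Gamma 2,
    (fun τ => q.out⁻¹ • τ) '' truncatedFundamentalDomain Y, ?_, fun τ hτ => ?_⟩
  · exact isCompact_iUnion fun q =>
      (isCompact_truncatedFundamentalDomain Y).image (continuous_const_smul _)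
  · obtain ⟨g, hg⟩ := exists_smul_mem_fd τ
    have him : (g • τ).im ≤ Y := by
      by_contra! h
      have := hY _ h.le
      simp only [Function.comp, jOfLam_smul] at this
      linarith
    refine ⟨(g : SL(2, ℤ) ⧸ CongruenceSubgroup.Gamma 2).out⁻¹ * g, ?_, ?_⟩
    · exact QuotientGroup.eq.mp (QuotientGroup.out_eq' _)
    · refine Set.mem_iUnion.mpr ⟨(g : SL(2, ℤ) ⧸ CongruenceSubgroup.Gamma 2), g • τ, ⟨hg, him⟩, ?_⟩
      exact (mul_smul _ _ _).symm

theorem exists_isCompact_of_isCompact {K : Set ℂ} (hK : IsCompact K) (h0 : (0 : ℂ) ∉ K)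
    (h1 : (1 : ℂ) ∉ K) : ∃ C : Set ℍ, IsCompact C ∧
      ∀ τ : ℍ, lam τ ∈ K → ∃ γ ∈ CongruenceSubgroup.Gamma 2, γ • τ ∈ C := by
  have hc : ContinuousOn (fun l => jOfLam l) K := by
    unfold jOfLam
    refine ContinuousOn.div (by fun_prop) (by fun_prop) fun l hl => ?_
    have : l ≠ 0 := fun h => h0 (h ▸ hl)
    have : 1 - l ≠ 0 := sub_ne_zero.mpr fun h => h1 (h ▸ hl)
    positivity
  obtain ⟨M, hM⟩ := hK.exists_bound_of_continuousOn hc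
  obtain ⟨C, hC, h⟩ := exists_isCompact_smul_mem M
  exact ⟨C, hC, fun τ hτ => h τ (hM _ hτ)⟩

open ModularGroup in
open scoped MatrixGroups in
/-- Where `λ` is small, `τ` can be moved up by `Γ(2)`. -/
theorem exists_smul_high (Y : ℝ) : ∃ δ > 0, ∀ τ : ℍ, ‖lam τ‖ < δ →
    ∃ γ ∈ CongruenceSubgroup.Gamma 2, Y ≤ (γ • τ).im := by
  obtain ⟨Y₀, hY₀⟩ := eventually_comap_im_iff.mp
    (tendsto_lam.eventually (Metric.ball_mem_nhds 0 (by norm_num : (0 : ℝ) < 1 / 4)))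
  have hc : ContinuousOn (fun τ : ℍ => jOfLam (lam τ)) (truncatedFundamentalDomain (max Y Y₀)) := by
    have := continuous_lam_coe
    unfold jOfLam
    refine (Continuous.div (by fun_prop) (by fun_prop) fun τ => ?_).continuousOn
    have := lam_coe_ne_zero τ
    have : 1 - lam τ ≠ 0 := sub_ne_zero.mpr (lam_coe_ne_one τ).symm
    positivity
  obtain ⟨M, hM⟩ := (isCompact_truncatedFundamentalDomain _).exists_bound_of_continuousOn hc
  have h1 := tendsto_norm_jOfLam.eventually_gt_atTop M
  rw [eventually_nhdsWithin_iff, Metric.eventually_nhds_iff] at h1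
  obtain ⟨δ, hδ, hj⟩ := h1
  refine ⟨min δ (1 / 4), lt_min hδ (by norm_num), fun τ hτ => ?_⟩
  obtain ⟨g, hg⟩ := exists_smul_mem_fd τ
  have him : max Y Y₀ < (g • τ).im := by
    by_contra! h
    have h2 := hM (g • τ : ℍ) ⟨hg, h⟩
    have h3 := hj (y := lam τ) (by simpa using hτ.trans_le (min_le_left _ _)) (lam_coe_ne_zero τ)
    simp only [jOfLam_smul] at h2
    linarith
  have h4 : ‖lam ↑(g • τ)‖ < 1 / 4 := by
    simpa using hY₀ ↑(g • τ) ((le_max_right _ _).trans him.le)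
  have h5 : ‖lam τ‖ < 1 / 4 := hτ.trans_le (min_le_right _ _)
  have hl0 : 0 < ‖lam τ‖ := norm_pos_iff.mpr (lam_coe_ne_zero τ)
  have h6 : 3 / 4 ≤ ‖1 - lam τ‖ := by
    have := norm_sub_norm_le (1 : ℂ) (lam τ); rw [norm_one] at this; linarith
  have h6' : ‖1 - lam τ‖ ≤ 5 / 4 := by
    have := norm_sub_le (1 : ℂ) (lam τ); rw [norm_one] at this; linarith
  have hdet : ((g 0 0 : ℤ) : ZMod 2) * (g 1 1 : ℤ) - (g 0 1 : ℤ) * (g 1 0 : ℤ) = 1 := by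
    have := g.det_coe
    rw [Matrix.det_fin_two] at this
    exact_mod_cast congrArg (Int.cast : ℤ → ZMod 2) this
  -- Both λ(τ) and λ(g • τ) are smaller than 1/4. Of the six anharmonic functions only l and l/(l -
  -- 1) are small for small l, and these are the ones with even lower left entry.
  have hc0 : ((g 1 0 : ℤ) : ZMod 2) = 0 := by
    by_contra hc0
    rw [lam_smul, anharmonic, if_neg (fun h => hc0 h.2), if_neg hc0] at h4
    split_ifs at h4
    · linarith
    · rw [norm_div, norm_one, div_lt_iff₀ (by linarith)] at h4; linarith
    · rw [norm_div, div_lt_iff₀ hl0, norm_sub_rev] at h4; linarith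
    · rw [norm_div, norm_one, div_lt_iff₀ hl0] at h4; linarith
  rw [hc0, mul_zero, sub_zero] at hdet
  have hY : Y ≤ (g • τ).im := (le_max_left _ _).trans him.le
  have hmul : ∀ a d : ZMod 2, a * d = 1 → a = 1 ∧ d = 1 := by decide
  obtain ⟨ha, hd⟩ := hmul _ _ hdet
  rcases zmod_two_cases ((g 0 1 : ℤ) : ZMod 2) with hb | hb
  · exact ⟨g, CongruenceSubgroup.Gamma_mem.mpr ⟨ha, hb, hc0, hd⟩, hY⟩
  -- For odd upper right entry a further translation leads back to Γ(2) and does not change the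
  -- height.
  · refine ⟨T * g, CongruenceSubgroup.Gamma_mem.mpr ?_, ?_⟩
    · have e2 : (1 + 1 : ZMod 2) = 0 := rfl
      simp [Matrix.SpecialLinearGroup.coe_mul, coe_T, Matrix.mul_apply, Fin.sum_univ_two, ha, hb,
        hc0, hd, e2]
    · rw [mul_smul, ← UpperHalfPlane.coe_im, coe_T_smul]
      simpa using hY

/-- High up, `λ` is injective up to translations by even integers. -/
theorem exists_height_injective : ∃ Y : ℝ, 0 < Y ∧ ∀ τ τ' : ℂ, Y ≤ τ.im → Y ≤ τ'.im →
    lam τ = lam τ' → ∃ n : ℤ, τ' = τ + 2 * n := by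
  obtain ⟨U, hU, hU0, -, hlam⟩ := exists_lam_expansion
  have hf : AnalyticAt ℂ (fun q => 16 * q * U q) 0 := by fun_prop
  have hd : deriv (fun q => 16 * q * U q) 0 ≠ 0 := by
    have h := (((hasDerivAt_id (0 : ℂ)).const_mul 16).mul hU.differentiableAt.hasDerivAt)
    have := h.deriv
    simp only [id, Pi.mul_def] at this
    rw [this]; simp [hU0]
  obtain ⟨V, hV, hinj⟩ := exists_injOn hf hd
  obtain ⟨Y, hY⟩ := eventually_comap_im_iff.mp (tendsto_qpar.eventually hV)
  refine ⟨max Y 1, by positivity, fun τ τ' h h' he => ?_⟩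
  have hp : 0 < τ.im := lt_of_lt_of_le one_pos ((le_max_right _ _).trans h)
  have hp' : 0 < τ'.im := lt_of_lt_of_le one_pos ((le_max_right _ _).trans h')
  rw [hlam τ hp, hlam τ' hp'] at he
  have h1 := hinj (hY τ ((le_max_left _ _).trans h)) (hY τ' ((le_max_left _ _).trans h')) he
  obtain ⟨n, hn⟩ := Complex.exp_eq_exp_iff_exists_int.mp h1.symm
  refine ⟨n, ?_⟩
  have hpi : (Real.pi * Complex.I : ℂ) ≠ 0 := by simp [Real.pi_ne_zero]
  apply mul_left_cancel₀ hpi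
  linear_combination hn

open ModularGroup in
theorem T_zpow_two_mul_mem (n : ℤ) : T ^ (2 * n) ∈ CongruenceSubgroup.Gamma 2 :=
  CongruenceSubgroup.ModularGroup_T_pow_mem_Gamma 2 (2 * n) (dvd_mul_right _ _)

theorem isConnected_compl_zero_one : IsConnected ({0, 1}ᶜ : Set ℂ) :=
  ((Set.toFinite {0, 1}).countable).isConnected_compl_of_one_lt_rank (by simp)

theorem isOpen_compl_zero_one : IsOpen ({0, 1}ᶜ : Set ℂ) :=
  (Set.toFinite {0, 1}).isClosed.isOpen_compl

theorem exists_compact_nhds_compl_zero_one {z : ℂ} (hz : z ∈ ({0, 1}ᶜ : Set ℂ)) :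
    ∃ K ∈ 𝓝 z, IsCompact K ∧ (0 : ℂ) ∉ K ∧ (1 : ℂ) ∉ K := by
  obtain ⟨K, hK, hsub, hc⟩ :=
    local_compact_nhds (isOpen_compl_zero_one.mem_nhds hz)
  exact ⟨K, hK, hc, fun h => hsub h (by simp), fun h => hsub h (by simp)⟩

/-- The image is open, and relatively closed in the connected set ℂ ∖ {0, 1}: preimages of points
near a limit point can be moved by Γ(2) into one compact set. -/
theorem exists_lam_eq {z : ℂ} (h0 : z ≠ 0) (h1 : z ≠ 1) : ∃ τ : ℍ, lam τ = z := by
  have hsub : ({0, 1}ᶜ : Set ℂ) ⊆ Set.range fun τ : ℍ => lam τ := by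
    refine isConnected_compl_zero_one.isPreconnected.subset_of_closure_inter_subset
      isOpenMap_lam.isOpen_range ?_ ?_
    · exact ⟨lam (UpperHalfPlane.I : ℍ), by
        have := lam_coe_ne_zero UpperHalfPlane.I
        have := lam_coe_ne_one UpperHalfPlane.I
        simp_all,
        ⟨UpperHalfPlane.I, rfl⟩⟩
    · rintro z ⟨hz, hz'⟩
      obtain ⟨K, hK, hKc, hK0, hK1⟩ := exists_compact_nhds_compl_zero_one hz'
      obtain ⟨C, hC, h⟩ := exists_isCompact_of_isCompact hKc hK0 hK1
      have h2 : z ∈ closure ((fun τ : ℍ => lam τ) '' C) := by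
        rw [mem_closure_iff_nhds]
        intro t ht
        obtain ⟨_, ⟨hx1, hx2⟩, τ, rfl⟩ := mem_closure_iff_nhds.mp hz _ (inter_mem ht hK)
        obtain ⟨γ, hγ, hγC⟩ := h τ hx2
        exact ⟨_, hx1, γ • τ, hγC, lam_smul_of_mem hγ τ⟩
      rw [(hC.image continuous_lam_coe).isClosed.closure_eq] at h2
      exact Set.image_subset_range _ _ h2
  exact hsub (by simp [h0, h1])

/-- The values over which the fibre is a single orbit form a nonempty, open and relatively closed
subset of the connected set ℂ ∖ {0, 1}. -/
theorem exists_smul_eq_of_lam_eq {τ τ' : ℍ} (h : lam τ = lam τ') :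
    ∃ γ ∈ CongruenceSubgroup.Gamma 2, γ • τ = τ' := by
  set R : ℍ → ℍ → Prop := fun τ τ' => ∃ γ ∈ CongruenceSubgroup.Gamma 2, γ • τ = τ' with hR
  have hRsmul : ∀ {γ γ' τ τ'}, γ ∈ CongruenceSubgroup.Gamma 2 → γ' ∈ CongruenceSubgroup.Gamma 2 →
      R (γ • τ) (γ' • τ') → R τ τ' := by
    rintro γ γ' τ τ' hγ hγ' ⟨g, hg, he⟩
    refine ⟨γ'⁻¹ * g * γ, mul_mem (mul_mem (inv_mem hγ') hg) hγ, ?_⟩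
    rw [mul_smul, mul_smul, he, inv_smul_smul]
  set S : Set ℂ := {z | z ∈ ({0, 1}ᶜ : Set ℂ) ∧ ∀ τ τ' : ℍ, lam τ = z → lam τ' = z → R τ τ'} with hS
  suffices h1 : ({0, 1}ᶜ : Set ℂ) ⊆ S from
    (h1 (show lam τ ∈ ({0, 1}ᶜ : Set ℂ) by simp [lam_coe_ne_zero, lam_coe_ne_one])).2 τ τ' rfl h.symm
  refine isConnected_compl_zero_one.isPreconnected.subset_of_closure_inter_subset ?_ ?_ ?_
  -- Openness: over a compact neighbourhood, inequivalent pairs with equal value can be moved into C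
  -- × C. There they form a compact set, so the values they take form a closed set, which misses z.
  · rw [isOpen_iff_mem_nhds]
    rintro z ⟨hz, hzS⟩
    obtain ⟨K, hK, hKc, hK0, hK1⟩ := exists_compact_nhds_compl_zero_one hz
    obtain ⟨C, hC, hlift⟩ := exists_isCompact_of_isCompact hKc hK0 hK1
    set B : Set (ℍ × ℍ) := {p | lam p.1 = lam p.2 ∧ ¬ R p.1 p.2} with hB
    -- Near a pair (σ, γ • σ), equal values of λ force equivalence by the same γ, since λ is locally
    -- injective at σ.
    have hBc : IsClosed B := by
      rw [← isOpen_compl_iff, isOpen_iff_mem_nhds]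
      rintro ⟨σ, σ'⟩ hσ
      by_cases he : lam σ = lam σ'
      · have hRσ : R σ σ' := by by_contra hn; exact hσ ⟨he, hn⟩
        obtain ⟨γ, hγ, rfl⟩ := hRσ
        obtain ⟨U, hU, hinj⟩ := lam_locally_injective σ
        have hU' : ∀ᶠ p : ℍ × ℍ in 𝓝 (σ, γ • σ), p.1 ∈ U ∧ γ⁻¹ • p.2 ∈ U := by
          refine Filter.Eventually.and (p := fun p : ℍ × ℍ => p.1 ∈ U)
            (continuous_fst.tendsto (σ, γ • σ) hU) ?_
          have hc : Continuous fun p : ℍ × ℍ => γ⁻¹ • p.2 :=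
            (continuous_const_smul γ⁻¹).comp continuous_snd
          refine hc.continuousAt.preimage_mem_nhds ?_
          simpa only [inv_smul_smul] using hU
        filter_upwards [hU'] with p hp hpB
        refine hpB.2 ⟨γ, hγ, ?_⟩
        rw [hinj hp.1 hp.2 ?_, smul_inv_smul]
        simp only [lam_smul_of_mem (inv_mem hγ)]
        exact hpB.1
      · have hc : Continuous fun p : ℍ × ℍ => lam p.1 - lam p.2 :=
          (continuous_lam_coe.comp continuous_fst).sub (continuous_lam_coe.comp continuous_snd)
        filter_upwards [hc.continuousAt.eventually (isOpen_ne.mem_nhds (sub_ne_zero.mpr he))]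
          with p hp hpB
        exact hp (sub_eq_zero.mpr hpB.1)
    have hcl : IsClosed ((fun p : ℍ × ℍ => lam p.1) '' (C ×ˢ C ∩ B)) :=
      (((hC.prod hC).inter_right hBc).image (continuous_lam_coe.comp continuous_fst)).isClosed
    have hzn : z ∉ (fun p : ℍ × ℍ => lam p.1) '' (C ×ˢ C ∩ B) := by
      rintro ⟨p, ⟨-, hp⟩, rfl⟩
      exact hp.2 (hzS _ _ rfl hp.1.symm)
    filter_upwards [hcl.isOpen_compl.mem_nhds hzn, hK, isOpen_compl_zero_one.mem_nhds hz]
      with w hw hwK hw01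
    refine ⟨hw01, fun σ σ' h1 h2 => ?_⟩
    obtain ⟨γ, hγ, hγC⟩ := hlift σ (h1 ▸ hwK)
    obtain ⟨γ', hγ', hγC'⟩ := hlift σ' (h2 ▸ hwK)
    by_contra hn
    refine hw ⟨(γ • σ, γ' • σ'), ⟨⟨hγC, hγC'⟩, ?_, fun h => hn (hRsmul hγ hγ' h)⟩, ?_⟩
    · simp only [lam_smul_of_mem hγ, lam_smul_of_mem hγ', h1, h2]
    · simp only [lam_smul_of_mem hγ, h1]
  -- Nonemptiness: the preimages of a small value can be moved high up, where λ is injective up to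
  -- even translations.
  · obtain ⟨Y, hY, hinj⟩ := exists_height_injective
    obtain ⟨δ, hδ, hhigh⟩ := exists_smul_high Y
    set z : ℂ := ((min (δ / 2) (1 / 2) : ℝ) : ℂ) with hz
    have hr : 0 < min (δ / 2) (1 / 2) := by positivity
    have hz0 : z ≠ 0 := by rw [hz]; exact_mod_cast hr.ne'
    have hz1 : z ≠ 1 := by
      rw [hz]; norm_cast
      exact (lt_of_le_of_lt (min_le_right _ _) (by norm_num : (1 / 2 : ℝ) < 1)).ne
    have hn : ‖z‖ < δ := by
      rw [hz, Complex.norm_real, Real.norm_of_nonneg hr.le]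
      exact lt_of_le_of_lt (min_le_left _ _) (by linarith)
    refine ⟨z, by simp [hz0, hz1], by simp [hz0, hz1], fun σ σ' h1 h2 => ?_⟩
    obtain ⟨γ, hγ, hγY⟩ := hhigh σ (h1 ▸ hn)
    obtain ⟨γ', hγ', hγY'⟩ := hhigh σ' (h2 ▸ hn)
    refine hRsmul hγ hγ' ?_
    obtain ⟨n, hn⟩ := hinj ↑(γ • σ) ↑(γ' • σ') hγY hγY'
      (by rw [lam_smul_of_mem hγ, lam_smul_of_mem hγ', h1, h2])
    refine ⟨ModularGroup.T ^ (2 * n), T_zpow_two_mul_mem n, UpperHalfPlane.ext ?_⟩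
    rw [ModularGroup.coe_T_zpow_smul_eq, hn]; push_cast; ring
  -- Closedness: inequivalent points over z have disjoint saturated neighbourhoods, by the Hausdorff
  -- property of the quotient. As λ is open, some value in S is taken in both of them, which is
  -- impossible.
  · rintro z ⟨hz, hz01⟩
    refine ⟨hz01, fun σ σ' h1 h2 => ?_⟩
    by_contra hn
    let Q := Quotient (MulAction.orbitRel (CongruenceSubgroup.Gamma 2) ℍ)
    have hT2 : T2Space Q := t2Space_of_properlyDiscontinuousSMul_of_t2Space
    let π : ℍ → Q := Quotient.mk _
    have hπ : Continuous π := continuous_quotient_mk'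
    have hRπ : ∀ x y, π x = π y → R x y := by
      intro x y hxy
      obtain ⟨g, hg⟩ := MulAction.orbitRel_apply.mp (Quotient.exact hxy.symm)
      exact ⟨g, g.2, hg⟩
    have hne : π σ ≠ π σ' := fun h => hn (hRπ _ _ h)
    obtain ⟨V, V', hV, hV', hσ, hσ', hdisj⟩ := t2_separation hne
    have hW := isOpenMap_lam _ (hV.preimage hπ)
    have hW' := isOpenMap_lam _ (hV'.preimage hπ)
    obtain ⟨w, ⟨⟨x, hx, hxw⟩, ⟨y, hy, hyw⟩⟩, hwS⟩ := mem_closure_iff.mp hz _ (hW.inter hW')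
      ⟨⟨σ, hσ, h1⟩, ⟨σ', hσ', h2⟩⟩
    obtain ⟨γ, hγ, hxy⟩ := hwS.2 x y hxw hyw
    refine Set.disjoint_left.mp hdisj hx ?_
    have : π x = π y := by
      refine Quotient.sound (MulAction.orbitRel_apply.mpr ?_)
      exact ⟨⟨γ⁻¹, inv_mem hγ⟩, by rw [← hxy]; exact inv_smul_smul γ x⟩
    rw [this]; exact hy

theorem lam_eq_lam_iff {τ τ' : ℍ} :
    lam τ = lam τ' ↔ ∃ γ ∈ CongruenceSubgroup.Gamma 2, γ • τ = τ' := by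
  refine ⟨exists_smul_eq_of_lam_eq, ?_⟩
  rintro ⟨γ, hγ, rfl⟩
  exact (lam_smul_of_mem hγ τ).symm

/-! ### Möbius transformations of the sphere -/

theorem hpt_of_ne {x y : ℂ} (hy : y ≠ 0) : hpt x y = ((x / y : ℂ) : OnePoint ℂ) := if_neg hy

@[simp] theorem hpt_zero (x : ℂ) : hpt x 0 = OnePoint.infty := if_pos rfl

theorem hpt_eq_infty_iff {x y : ℂ} : hpt x y = OnePoint.infty ↔ y = 0 := by
  by_cases h : y = 0 <;> simp [hpt, h]

@[simp] theorem zCoord_infty : zCoord OnePoint.infty = 0 := rfl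

theorem zCoord_hpt (x y : ℂ) : zCoord (hpt x y) = x / y := by
  by_cases h : y = 0 <;> simp [hpt, h]

theorem wCoord_hpt (x y : ℂ) : wCoord (hpt x y) = y / x := by
  by_cases h : y = 0 <;> simp [hpt, h]

theorem hpt_mul {k : ℂ} (hk : k ≠ 0) (x y : ℂ) : hpt (k * x) (k * y) = hpt x y := by
  by_cases h : y = 0
  · simp [h]
  · rw [hpt_of_ne h, hpt_of_ne (mul_ne_zero hk h), mul_div_mul_left _ _ hk]

@[simp] theorem hpt_hx_hy (p : OnePoint ℂ) : hpt (hx p) (hy p) = p := by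
  induction p using OnePoint.rec with
  | infty => simp
  | coe z => simp [hpt]

theorem hx_ne_zero_or (p : OnePoint ℂ) : hx p ≠ 0 ∨ hy p ≠ 0 := by
  induction p using OnePoint.rec with
  | infty => simp
  | coe z => simp

theorem exists_hx_hpt {x y : ℂ} (h : x ≠ 0 ∨ y ≠ 0) :
    ∃ k ≠ 0, x = k * hx (hpt x y) ∧ y = k * hy (hpt x y) := by
  by_cases hy0 : y = 0
  · subst hy0; exact ⟨x, by simpa using h, by simp, by simp⟩
  · exact ⟨y, hy0, by rw [hpt_of_ne hy0]; simp; field_simp, by rw [hpt_of_ne hy0]; simp⟩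

theorem hpt_eq_of_mul_eq {p : OnePoint ℂ} {x y k : ℂ} (hk : k ≠ 0) (hxk : x = k * hx p)
    (hyk : y = k * hy p) : hpt x y = p := by
  rw [hxk, hyk, hpt_mul hk, hpt_hx_hy]

theorem diff_eq_zero_iff {p q : OnePoint ℂ} : diff p q = 0 ↔ p = q := by
  induction p using OnePoint.rec <;> induction q using OnePoint.rec <;> simp [diff, sub_eq_zero]

/-- Continuity of the projection from nonzero pairs to the sphere. If the limit is ∞, then |f|
eventually exceeds any multiple of |g|, and points with g = 0 are sent to ∞ itself. -/
theorem tendsto_hpt {α : Type*} {l : Filter α} {f g : α → ℂ} {x y : ℂ} (hf : Tendsto f l (𝓝 x))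
    (hg : Tendsto g l (𝓝 y)) (h : x ≠ 0 ∨ y ≠ 0) :
    Tendsto (fun t => hpt (f t) (g t)) l (𝓝 (hpt x y)) := by
  by_cases hy0 : y = 0
  · subst hy0
    have hx0 : x ≠ 0 := by simpa using h
    rw [hpt_zero, OnePoint.nhds_infty_eq, coclosedCompact_eq_cocompact, ← Metric.cobounded_eq_cocompact]
    rw [tendsto_def]
    intro s hs
    obtain ⟨hs1, hs2⟩ := hs
    obtain ⟨r, -, hr⟩ := (hasBasis_cobounded_norm (E := ℂ)).mem_iff.mp hs1
    have h1 : ∀ᶠ t in l, r * ‖g t‖ < ‖f t‖ := by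
      refine Tendsto.eventually_lt (hg.norm.const_mul r) hf.norm ?_
      simpa using hx0
    filter_upwards [h1] with t ht
    by_cases hgt : g t = 0
    · simp only [Set.mem_preimage, hgt, hpt_zero]; exact hs2
    · simp only [Set.mem_preimage, hpt_of_ne hgt]
      refine hr ?_
      simp only [Set.mem_ofPred_eq, norm_div]
      rw [le_div_iff₀ (norm_pos_iff.mpr hgt)]; exact ht.le
  · have h1 : ∀ᶠ t in l, g t ≠ 0 := hg.eventually (isOpen_ne.mem_nhds hy0)
    rw [hpt_of_ne hy0]
    refine Tendsto.congr' (h1.mono fun t ht => (hpt_of_ne ht).symm) ?_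
    exact (OnePoint.continuous_coe.tendsto _).comp (hf.div hg hy0)

/-- The Möbius transformation with matrix `(a, b; c, d)`. -/
def mobius (a b c d : ℂ) (p : OnePoint ℂ) : OnePoint ℂ :=
  hpt (a * hx p + b * hy p) (c * hx p + d * hy p)

theorem mobius_coe (a b c d z : ℂ) : mobius a b c d z = hpt (a * z + b) (c * z + d) := by
  simp [mobius]

theorem mobius_infty (a b c d : ℂ) : mobius a b c d OnePoint.infty = hpt a c := by
  simp [mobius]

theorem mobius_hpt (a b c d : ℂ) {x y : ℂ} (h : x ≠ 0 ∨ y ≠ 0) :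
    mobius a b c d (hpt x y) = hpt (a * x + b * y) (c * x + d * y) := by
  obtain ⟨k, hk, h1, h2⟩ := exists_hx_hpt h
  rw [mobius, ← hpt_mul hk]
  congr 1
  · linear_combination -a * h1 - b * h2
  · linear_combination -c * h1 - d * h2

theorem mobius_ne_zero_or {a b c d : ℂ} (h : a * d - b * c ≠ 0) {x y : ℂ} (hxy : x ≠ 0 ∨ y ≠ 0) :
    a * x + b * y ≠ 0 ∨ c * x + d * y ≠ 0 := by
  by_contra! h'
  have h1 : (a * d - b * c) * x = 0 := by linear_combination d * h'.1 - b * h'.2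
  have h2 : (a * d - b * c) * y = 0 := by linear_combination a * h'.2 - c * h'.1
  simp [h] at h1 h2
  simp [h1, h2] at hxy

theorem mobius_inv {a b c d : ℂ} (h : a * d - b * c ≠ 0) (p : OnePoint ℂ) :
    mobius d (-b) (-c) a (mobius a b c d p) = p := by
  rw [mobius.eq_def a b c d p, mobius_hpt _ _ _ _ (mobius_ne_zero_or h (hx_ne_zero_or p))]
  exact hpt_eq_of_mul_eq h (by ring) (by ring)

theorem continuous_mobius {a b c d : ℂ} (h : a * d - b * c ≠ 0) : Continuous (mobius a b c d) := by
  rw [OnePoint.continuous_iff]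
  constructor
  · rw [coclosedCompact_eq_cocompact, ← Metric.cobounded_eq_cocompact, mobius_infty]
    have h1 : Tendsto (fun z : ℂ => z⁻¹) (Bornology.cobounded ℂ) (𝓝 0) := tendsto_inv₀_cobounded
    have h2 : Tendsto (fun z : ℂ => hpt (a + b * z⁻¹) (c + d * z⁻¹)) (Bornology.cobounded ℂ)
        (𝓝 (hpt a c)) := by
      refine tendsto_hpt (by simpa using (h1.const_mul b).const_add a)
        (by simpa using (h1.const_mul d).const_add c) ?_
      by_contra! h'; simp [h'.1, h'.2] at h
    refine h2.congr' ?_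
    have h3 : ∀ᶠ z : ℂ in Bornology.cobounded ℂ, z ≠ 0 := by
      rw [Metric.cobounded_eq_cocompact]
      exact isCompact_singleton.compl_mem_cocompact
    filter_upwards [h3] with z hz
    rw [mobius_coe, ← hpt_mul hz]
    congr 1 <;> field_simp
  · refine continuous_iff_continuousAt.mpr fun z => ?_
    simp only [ContinuousAt, mobius_coe]
    have hz := mobius_ne_zero_or h (x := z) (y := 1) (Or.inr one_ne_zero)
    simp only [mul_one] at hz
    have h1 : Continuous fun z : ℂ => a * z + b := by fun_prop
    have h2 : Continuous fun z : ℂ => c * z + d := by fun_prop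
    exact tendsto_hpt (h1.tendsto z) (h2.tendsto z) hz

/-- A Möbius transformation as a homeomorphism of the sphere. -/
def mobiusHomeo {a b c d : ℂ} (h : a * d - b * c ≠ 0) : OnePoint ℂ ≃ₜ OnePoint ℂ where
  toFun := mobius a b c d
  invFun := mobius d (-b) (-c) a
  left_inv := mobius_inv h
  right_inv p := by
    have := mobius_inv (a := d) (b := -b) (c := -c) (d := a) (by rw [← sub_ne_zero] at h ⊢; convert h using 1; ring) p
    simpa using this
  continuous_toFun := continuous_mobius h
  continuous_invFun := continuous_mobius (by convert h using 1; ring)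

/-! ### Holomorphic immersions of the upper half plane in the sphere -/

/-- The map `f` read in the coordinate `z`. -/
def zMap (f : ℍ → OnePoint ℂ) (z : ℂ) : ℂ := zCoord (f (ofComplex z))

/-- The map `f` read in the coordinate `w`. -/
def wMap (f : ℍ → OnePoint ℂ) (z : ℂ) : ℂ := wCoord (f (ofComplex z))

/-- A holomorphic map with nonvanishing derivative. -/
structure IsImmersion (f : ℍ → OnePoint ℂ) : Prop where
  holomorphic : IsHolomorphic f
  deriv_zMap_ne : ∀ τ : ℍ, f τ ≠ OnePoint.infty → deriv (zMap f) τ ≠ 0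
  deriv_wMap_ne : ∀ τ : ℍ, f τ = OnePoint.infty → deriv (wMap f) τ ≠ 0

/-- The determinant is the product of the three differences. -/
theorem det_coverMap_ne_zero {a₁ a₂ a₃ : OnePoint ℂ} (h₁₂ : a₁ ≠ a₂) (h₁₃ : a₁ ≠ a₃)
    (h₂₃ : a₂ ≠ a₃) : (-(hx a₃ * diff a₂ a₁)) * (hy a₁ * diff a₂ a₃) -
      (hx a₁ * diff a₂ a₃) * (-(hy a₃ * diff a₂ a₁)) ≠ 0 := by
  have h1 := diff_eq_zero_iff.not.mpr h₁₂.symm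
  have h2 := diff_eq_zero_iff.not.mpr h₁₃
  have h3 := diff_eq_zero_iff.not.mpr h₂₃
  have := mul_ne_zero (mul_ne_zero h1 h2) h3
  intro h
  apply this
  rw [← h, diff.eq_def a₁ a₃]
  ring

theorem coverMap_eq_mobius (a₁ a₂ a₃ : OnePoint ℂ) (τ : ℍ) :
    coverMap a₁ a₂ a₃ τ = mobius (-(hx a₃ * diff a₂ a₁)) (hx a₁ * diff a₂ a₃)
      (-(hy a₃ * diff a₂ a₁)) (hy a₁ * diff a₂ a₃) (lam τ) := by
  rw [mobius_coe, coverMap, modularLambda_eq_lam]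
  congr 1 <;> ring

/-- The derivative is the determinant times λ', divided by the square of the denominator. The
coordinate w is treated by exchanging the rows of the matrix. -/
theorem isImmersion_mobius_lam {a b c d : ℂ} (h : a * d - b * c ≠ 0) :
    IsImmersion fun τ : ℍ => mobius a b c d (lam τ) := by
  have hz : ∀ τ : ℍ, zMap (fun τ : ℍ => mobius a b c d (lam τ)) =ᶠ[𝓝 (τ : ℂ)]
      fun z => (a * lam z + b) / (c * lam z + d) := by
    intro τ
    filter_upwards [eventually_im_pos_nhds τ.im_pos] with z hz
    rw [zMap, mobius_coe, zCoord_hpt, UpperHalfPlane.ofComplex_apply_of_im_pos hz]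
  have hw : ∀ τ : ℍ, wMap (fun τ : ℍ => mobius a b c d (lam τ)) =ᶠ[𝓝 (τ : ℂ)]
      fun z => (c * lam z + d) / (a * lam z + b) := by
    intro τ
    filter_upwards [eventually_im_pos_nhds τ.im_pos] with z hz
    rw [wMap, mobius_coe, wCoord_hpt, UpperHalfPlane.ofComplex_apply_of_im_pos hz]
  have hne : ∀ τ : ℍ, a * lam τ + b ≠ 0 ∨ c * lam τ + d ≠ 0 := fun τ => by
    have := mobius_ne_zero_or h (x := lam τ) (y := 1) (Or.inr one_ne_zero)
    simpa using this
  have hinf : ∀ τ : ℍ, mobius a b c d (lam τ) = OnePoint.infty ↔ c * lam τ + d = 0 := fun τ => by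
    rw [mobius_coe, hpt_eq_infty_iff]
  have hN : ∀ (a b : ℂ) (τ : ℍ), HasDerivAt (fun z => a * lam z + b) (a * deriv lam τ) τ :=
    fun a b τ => ((differentiableAt_lam τ.im_pos).hasDerivAt.const_mul a).add_const b
  have key : ∀ {a b c d : ℂ}, a * d - b * c ≠ 0 → ∀ τ : ℍ, c * lam τ + d ≠ 0 →
      ∃ f' ≠ 0, HasDerivAt (fun z => (a * lam z + b) / (c * lam z + d)) f' τ := by
    intro a b c d h τ hτ
    refine ⟨_, ?_, (hN a b τ).div (hN c d τ) hτ⟩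
    refine div_ne_zero ?_ (pow_ne_zero 2 hτ)
    have := mul_ne_zero h (deriv_lam_ne_zero τ.im_pos)
    convert this using 1; ring
  have h' : c * b - d * a ≠ 0 := by
    have := neg_ne_zero.mpr h
    convert this using 1; ring
  refine ⟨⟨?_, fun τ => ⟨fun hτ => ?_, fun hτ => ?_⟩⟩, fun τ hτ => ?_, fun τ hτ => ?_⟩
  · exact (continuous_mobius h).comp (OnePoint.continuous_coe.comp continuous_lam_coe)
  · obtain ⟨f', -, hf⟩ := key h τ ((hinf τ).not.mp hτ)
    exact (hf.congr_of_eventuallyEq (hz τ)).differentiableAt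
  · obtain ⟨f', -, hf⟩ := key h' τ ((hne τ).resolve_right fun h => h ((hinf τ).mp hτ))
    exact (hf.congr_of_eventuallyEq (hw τ)).differentiableAt
  · obtain ⟨f', hf', hf⟩ := key h τ ((hinf τ).not.mp hτ)
    rwa [(hf.congr_of_eventuallyEq (hz τ)).deriv]
  · obtain ⟨f', hf', hf⟩ := key h' τ ((hne τ).resolve_right fun h => h ((hinf τ).mp hτ))
    rwa [(hf.congr_of_eventuallyEq (hw τ)).deriv]

theorem isImmersion_coverMap {a₁ a₂ a₃ : OnePoint ℂ} (h₁₂ : a₁ ≠ a₂) (h₁₃ : a₁ ≠ a₃)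
    (h₂₃ : a₂ ≠ a₃) : IsImmersion (coverMap a₁ a₂ a₃) := by
  have := isImmersion_mobius_lam (det_coverMap_ne_zero h₁₂ h₁₃ h₂₃)
  simp only [← coverMap_eq_mobius] at this
  exact this

/-! ### The covering map -/

/-- The linear relation between three vectors of ℂ². It shows that λ = 1 corresponds to a₂ and makes
S and T permute the punctures. -/
theorem mul_diff_sub (a₁ a₂ a₃ : OnePoint ℂ) :
    hx a₁ * diff a₂ a₃ - hx a₃ * diff a₂ a₁ = hx a₂ * diff a₁ a₃ ∧
      hy a₁ * diff a₂ a₃ - hy a₃ * diff a₂ a₁ = hy a₂ * diff a₁ a₃ := by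
  simp only [diff]; constructor <;> ring

/-- λ ↦ 1 - λ exchanges the values 0 and 1, hence a₁ and a₂; likewise T exchanges 1 and ∞, hence a₂
and a₃. In this way the limits at the cusps 0 and 1 reduce to the one at ∞. -/
theorem coverMap_S (a₁ a₂ a₃ : OnePoint ℂ) (τ : ℍ) :
    coverMap a₁ a₂ a₃ (ModularGroup.S • τ) = coverMap a₂ a₁ a₃ τ := by
  obtain ⟨h1, h2⟩ := mul_diff_sub a₁ a₂ a₃
  have h3 : diff a₁ a₂ = -diff a₂ a₁ := by simp only [diff]; ring
  simp only [coverMap, modularLambda_eq_lam, coe_S_smul, lam_S τ.im_pos]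
  congr 1
  · rw [← h1, h3]; ring
  · rw [← h2, h3]; ring

theorem coverMap_T (a₁ a₂ a₃ : OnePoint ℂ) (τ : ℍ) :
    coverMap a₁ a₂ a₃ (ModularGroup.T • τ) = coverMap a₁ a₃ a₂ τ := by
  obtain ⟨h1, h2⟩ := mul_diff_sub a₁ a₂ a₃
  have h3 : diff a₃ a₂ = -diff a₂ a₃ := by simp only [diff]; ring
  have h4 : diff a₃ a₁ = -diff a₁ a₃ := by simp only [diff]; ring
  have h5 : lam τ - 1 ≠ 0 := sub_ne_zero.mpr (lam_coe_ne_one τ)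
  simp only [coverMap, modularLambda_eq_lam, coe_T_smul, lam_T τ.im_pos]
  rw [← hpt_mul h5]
  congr 1
  · field_simp
    rw [h3, h4]; linear_combination lam τ * h1
  · field_simp
    rw [h3, h4]; linear_combination lam τ * h2

theorem coverMap_eq_iff {a₁ a₂ a₃ : OnePoint ℂ} (h₁₂ : a₁ ≠ a₂) (h₁₃ : a₁ ≠ a₃)
    (h₂₃ : a₂ ≠ a₃) {τ τ' : ℍ} : coverMap a₁ a₂ a₃ τ = coverMap a₁ a₂ a₃ τ' ↔ lam τ = lam τ' := by
  rw [coverMap_eq_mobius, coverMap_eq_mobius]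
  exact (mobiusHomeo (det_coverMap_ne_zero h₁₂ h₁₃ h₂₃)).injective.eq_iff.trans OnePoint.coe_eq_coe

theorem fibres_coverMap {a₁ a₂ a₃ : OnePoint ℂ} (h₁₂ : a₁ ≠ a₂) (h₁₃ : a₁ ≠ a₃)
    (h₂₃ : a₂ ≠ a₃) : FibresAreGammaTwoOrbits (coverMap a₁ a₂ a₃) := fun _ _ => by
  rw [coverMap_eq_iff h₁₂ h₁₃ h₂₃, lam_eq_lam_iff]

/-- The images of the points `0, 1, ∞`. -/
theorem mobius_coverMap_values {a₁ a₂ a₃ : OnePoint ℂ} (h₁₂ : a₁ ≠ a₂) (h₁₃ : a₁ ≠ a₃)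
    (h₂₃ : a₂ ≠ a₃) :
    let M := mobius (-(hx a₃ * diff a₂ a₁)) (hx a₁ * diff a₂ a₃) (-(hy a₃ * diff a₂ a₁))
      (hy a₁ * diff a₂ a₃)
    M ((0 : ℂ) : OnePoint ℂ) = a₁ ∧ M ((1 : ℂ) : OnePoint ℂ) = a₂ ∧ M OnePoint.infty = a₃ := by
  obtain ⟨h1, h2⟩ := mul_diff_sub a₁ a₂ a₃
  refine ⟨?_, ?_, ?_⟩
  · rw [mobius_coe]
    exact hpt_eq_of_mul_eq (diff_eq_zero_iff.not.mpr h₂₃) (by ring) (by ring)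
  · rw [mobius_coe]
    exact hpt_eq_of_mul_eq (diff_eq_zero_iff.not.mpr h₁₃) (by linear_combination h1)
      (by linear_combination h2)
  · rw [mobius_infty]
    exact hpt_eq_of_mul_eq (neg_ne_zero.mpr (diff_eq_zero_iff.not.mpr h₁₂.symm)) (by ring) (by ring)

theorem range_coverMap {a₁ a₂ a₃ : OnePoint ℂ} (h₁₂ : a₁ ≠ a₂) (h₁₃ : a₁ ≠ a₃)
    (h₂₃ : a₂ ≠ a₃) : Set.range (coverMap a₁ a₂ a₃) = {a₁, a₂, a₃}ᶜ := by
  obtain ⟨h1, h2, h3⟩ := mobius_coverMap_values h₁₂ h₁₃ h₂₃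
  set M := mobiusHomeo (det_coverMap_ne_zero h₁₂ h₁₃ h₂₃) with hM
  have hc : ∀ τ, coverMap a₁ a₂ a₃ τ = M (lam τ) := coverMap_eq_mobius _ _ _
  have h1 : M ((0 : ℂ) : OnePoint ℂ) = a₁ := h1
  have h2 : M ((1 : ℂ) : OnePoint ℂ) = a₂ := h2
  have h3 : M OnePoint.infty = a₃ := h3
  ext p
  simp only [Set.mem_range, hc, Set.mem_compl_iff, Set.mem_insert_iff, Set.mem_singleton_iff, not_or]
  constructor
  · rintro ⟨τ, rfl⟩
    rw [← h1, ← h2, ← h3, M.injective.eq_iff, M.injective.eq_iff, M.injective.eq_iff]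
    refine ⟨?_, ?_, OnePoint.coe_ne_infty _⟩
    · exact_mod_cast lam_coe_ne_zero τ
    · exact_mod_cast lam_coe_ne_one τ
  · rintro ⟨hp1, hp2, hp3⟩
    obtain ⟨x, rfl⟩ := M.surjective p
    rw [← h1, M.injective.eq_iff] at hp1
    rw [← h2, M.injective.eq_iff] at hp2
    rw [← h3, M.injective.eq_iff] at hp3
    induction x using OnePoint.rec with
    | infty => exact absurd rfl hp3
    | coe z =>
      obtain ⟨τ, rfl⟩ := exists_lam_eq (z := z) (by exact_mod_cast hp1) (by exact_mod_cast hp2)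
      exact ⟨τ, rfl⟩

theorem isOpenMap_coverMap {a₁ a₂ a₃ : OnePoint ℂ} (h₁₂ : a₁ ≠ a₂) (h₁₃ : a₁ ≠ a₃)
    (h₂₃ : a₂ ≠ a₃) : IsOpenMap (coverMap a₁ a₂ a₃) := by
  have := (mobiusHomeo (det_coverMap_ne_zero h₁₂ h₁₃ h₂₃)).isOpenMap.comp
    ((OnePoint.isOpenEmbedding_coe (X := ℂ)).isOpenMap.comp isOpenMap_lam)
  convert this using 1
  funext τ
  exact coverMap_eq_mobius _ _ _ _

/-! ### A freely acting group with the orbits of Γ(2), and the covering property -/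

/-- The subgroup of `Γ(2)` of the matrices whose diagonal is `1` modulo `4`; it acts freely. -/
def freeGamma : Subgroup (Matrix.SpecialLinearGroup (Fin 2) ℤ) where
  carrier := {γ | γ 0 0 % 4 = 1 ∧ γ 0 1 % 2 = 0 ∧ γ 1 0 % 2 = 0 ∧ γ 1 1 % 4 = 1}
  one_mem' := by simp
  mul_mem' {γ γ'} h h' := by
    obtain ⟨h1, h2, h3, h4⟩ := h
    obtain ⟨h1', h2', h3', h4'⟩ := h'
    have e : ∀ x : ℤ, x % 4 = 1 → ∃ y, x = 4 * y + 1 := fun x hx => ⟨x / 4, by omega⟩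
    have e' : ∀ x : ℤ, x % 2 = 0 → ∃ y, x = 2 * y := fun x hx => ⟨x / 2, by omega⟩
    obtain ⟨a, ha⟩ := e _ h1; obtain ⟨b, hb⟩ := e' _ h2
    obtain ⟨c, hc⟩ := e' _ h3; obtain ⟨d, hd⟩ := e _ h4
    obtain ⟨a', ha'⟩ := e _ h1'; obtain ⟨b', hb'⟩ := e' _ h2'
    obtain ⟨c', hc'⟩ := e' _ h3'; obtain ⟨d', hd'⟩ := e _ h4'
    simp only [Set.mem_ofPred_eq, Matrix.SpecialLinearGroup.coe_mul, Matrix.mul_apply,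
      Fin.sum_univ_two, ha, hb, hc, hd, ha', hb', hc', hd']
    refine ⟨?_, ?_, ?_, ?_⟩ <;> ring_nf <;> omega
  inv_mem' {γ} h := by
    obtain ⟨h1, h2, h3, h4⟩ := h
    rw [Matrix.SpecialLinearGroup.SL2_inv_expl]
    refine ⟨h4, ?_, ?_, h1⟩
    · change (-γ 0 1) % 2 = 0; omega
    · change (-γ 1 0) % 2 = 0; omega

theorem mem_Gamma_two_iff {γ : Matrix.SpecialLinearGroup (Fin 2) ℤ} :
    γ ∈ CongruenceSubgroup.Gamma 2 ↔
      γ 0 0 % 2 = 1 ∧ γ 0 1 % 2 = 0 ∧ γ 1 0 % 2 = 0 ∧ γ 1 1 % 2 = 1 := by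
  rw [CongruenceSubgroup.Gamma_mem]
  have h1 : ∀ n : ℤ, ((n : ZMod 2) = 1) ↔ n % 2 = 1 := fun n => by
    have := ZMod.intCast_eq_intCast_iff n 1 2
    simpa [Int.ModEq] using this
  have h0 : ∀ n : ℤ, ((n : ZMod 2) = 0) ↔ n % 2 = 0 := fun n => by
    have := ZMod.intCast_eq_intCast_iff n 0 2
    simpa [Int.ModEq] using this
  rw [h1, h0, h0, h1]

theorem freeGamma_le : freeGamma ≤ CongruenceSubgroup.Gamma 2 := by
  rintro γ ⟨h1, h2, h3, h4⟩
  exact mem_Gamma_two_iff.mpr ⟨by omega, h2, h3, by omega⟩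

/-- The off-diagonal entries are even, so the product of the diagonal entries is 1 mod 4 and both
are 1 or both are -1 mod 4. In the second case -γ, which acts in the same way, is used. -/
theorem exists_freeGamma {γ : Matrix.SpecialLinearGroup (Fin 2) ℤ}
    (hγ : γ ∈ CongruenceSubgroup.Gamma 2) (τ : ℍ) : ∃ γ' ∈ freeGamma, γ' • τ = γ • τ := by
  obtain ⟨h1, h2, h3, h4⟩ := mem_Gamma_two_iff.mp hγ
  have hdet := γ.det_coe
  rw [Matrix.det_fin_two] at hdet
  obtain ⟨b, hb⟩ : ∃ y, γ 0 1 = 2 * y := ⟨γ 0 1 / 2, by omega⟩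
  obtain ⟨c, hc⟩ : ∃ y, γ 1 0 = 2 * y := ⟨γ 1 0 / 2, by omega⟩
  have hor : γ 0 0 % 4 = 1 ∨ γ 0 0 % 4 = 3 := by omega
  rcases hor with ha | ha
  · obtain ⟨a, ha'⟩ : ∃ y, γ 0 0 = 4 * y + 1 := ⟨γ 0 0 / 4, by omega⟩
    have : γ 1 1 = 1 + 4 * (b * c - a * γ 1 1) := by
      rw [ha', hb, hc] at hdet; linear_combination hdet
    exact ⟨γ, ⟨ha, h2, h3, by omega⟩, rfl⟩
  · obtain ⟨a, ha'⟩ : ∃ y, γ 0 0 = 4 * y - 1 := ⟨(γ 0 0 + 1) / 4, by omega⟩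
    have : γ 1 1 = -1 + 4 * (a * γ 1 1 - b * c) := by
      rw [ha', hb, hc] at hdet; linear_combination -hdet
    refine ⟨-γ, ⟨?_, ?_, ?_, ?_⟩, ModularGroup.SL_neg_smul γ τ⟩
    · change (-γ 0 0) % 4 = 1; omega
    · change (-γ 0 1) % 2 = 0; omega
    · change (-γ 1 0) % 2 = 0; omega
    · change (-γ 1 1) % 4 = 1; omega

/-- A fixed point gives (a + d)² + 4 (c Im τ)² = 4. As a + d is 2 mod 4, it cannot be smaller than 2
in absolute value, so c = 0. Then a = d and b = 0, and the condition mod 4 selects 1 from ±1. -/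
theorem freeGamma_eq_one {γ : Matrix.SpecialLinearGroup (Fin 2) ℤ} (hγ : γ ∈ freeGamma) {τ : ℍ}
    (h : γ • τ = τ) : γ = 1 := by
  obtain ⟨h1, h2, h3, h4⟩ := hγ
  have hdet := γ.det_coe
  rw [Matrix.det_fin_two] at hdet
  have he := congrArg UpperHalfPlane.coe h
  rw [UpperHalfPlane.coe_specialLinearGroup_apply] at he
  have hden : ((algebraMap ℤ ℝ (γ 1 0) : ℝ) : ℂ) * τ + ((algebraMap ℤ ℝ (γ 1 1) : ℝ) : ℂ) ≠ 0 := by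
    have := UpperHalfPlane.denom_ne_zero (Matrix.SpecialLinearGroup.mapGL ℝ γ) τ
    simpa [UpperHalfPlane.denom] using this
  rw [div_eq_iff hden] at he
  have hre := congrArg Complex.re he
  have him := congrArg Complex.im he
  simp at hre him
  have hy : τ.im ≠ 0 := τ.im_pos.ne'
  have hy0 := τ.im_pos
  set a := γ 0 0
  set b := γ 0 1
  set c := γ 1 0
  set d := γ 1 1
  have hdet' : (a : ℝ) * d - b * c = 1 := by exact_mod_cast hdet
  have e1 : (a : ℝ) - d = 2 * c * τ.re := by
    apply mul_right_cancel₀ hy; linear_combination him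
  have e2 : ((a : ℝ) + d) ^ 2 + 4 * (c * τ.im) ^ 2 = 4 := by
    linear_combination 4 * hdet' + (a - d - 2 * c * τ.re) * e1 + 4 * c * hre
  have hc0 : c = 0 := by
    by_contra hc0
    have hc1 : 0 < 4 * ((c : ℝ) * τ.im) ^ 2 := by
      have : (c : ℝ) ≠ 0 := by exact_mod_cast hc0
      positivity
    have h5 : ((a : ℝ) + d) ^ 2 < 2 ^ 2 := by linarith
    have h6 : (a + d) ^ 2 < 2 ^ 2 := by exact_mod_cast h5
    have h7 := abs_lt_of_sq_lt_sq h6 (by norm_num)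
    rw [abs_lt] at h7
    omega
  rw [hc0] at e1 e2 hre
  have e3 : a = d := by
    have : (a : ℝ) = d := by simpa [sub_eq_zero] using e1
    exact_mod_cast this
  have hb : b = 0 := by
    have : (b : ℝ) = 0 := by
      have : (a : ℝ) = d := by exact_mod_cast e3
      rw [this] at hre
      simp only [Int.cast_zero] at hre
      linear_combination hre
    exact_mod_cast this
  have hd1 : d = 1 := by
    rw [hc0, hb, e3, mul_zero, sub_zero] at hdet
    rcases Int.eq_one_or_neg_one_of_mul_eq_one hdet with h | h <;> omega
  ext i j
  fin_cases i <;> fin_cases j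
  · exact e3.trans hd1
  · exact hb
  · exact hc0
  · exact hd1

instance isCancelSMul_freeGamma : IsCancelSMul freeGamma ℍ where
  right_cancel' g g' τ h := by
    have h1 : (g'⁻¹ * g) • τ = τ := by rw [mul_smul, h, inv_smul_smul]
    have h2 := freeGamma_eq_one (g'⁻¹ * g).2 h1
    have h3 : g'⁻¹ * g = 1 := Subtype.ext h2
    rw [inv_mul_eq_one] at h3
    exact h3.symm

/-- The map is an open surjection whose fibres are the orbits of a free, properly discontinuous
action. Γ(2) contains -1, which acts trivially, so `freeGamma` takes its place. -/
theorem isHolomorphicCovering_coverMap {a₁ a₂ a₃ : OnePoint ℂ} (h₁₂ : a₁ ≠ a₂) (h₁₃ : a₁ ≠ a₃)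
    (h₂₃ : a₂ ≠ a₃) : IsHolomorphicCovering ({a₁, a₂, a₃}ᶜ) (coverMap a₁ a₂ a₃) := by
  have hhol := (isImmersion_coverMap h₁₂ h₁₃ h₂₃).holomorphic
  refine ⟨hhol, range_coverMap h₁₂ h₁₃ h₂₃, ?_⟩
  have hmem : ∀ τ, coverMap a₁ a₂ a₃ τ ∈ ({a₁, a₂, a₃}ᶜ : Set (OnePoint ℂ)) := fun τ =>
    range_coverMap h₁₂ h₁₃ h₂₃ ▸ Set.mem_range_self τ
  have hopen : IsOpenMap (Set.codRestrict (coverMap a₁ a₂ a₃) _ hmem) :=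
    (isOpenMap_coverMap h₁₂ h₁₃ h₂₃).codRestrict hmem
  have hcont : Continuous (Set.codRestrict (coverMap a₁ a₂ a₃) _ hmem) := hhol.1.codRestrict hmem
  have hsurj : Function.Surjective (Set.codRestrict (coverMap a₁ a₂ a₃) _ hmem) := by
    rintro ⟨p, hp⟩
    rw [← range_coverMap h₁₂ h₁₃ h₂₃] at hp
    obtain ⟨τ, rfl⟩ := hp
    exact ⟨τ, rfl⟩
  have hq := hopen.isQuotientMap hcont hsurj
  refine (hq.isQuotientCoveringMap_of_properlyDiscontinuousSMul (G := freeGamma)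
    fun {τ τ'} => ?_).isCoveringMap
  rw [← Subtype.coe_inj]
  simp only [Set.val_codRestrict_apply]
  rw [eq_comm, coverMap_eq_iff h₁₂ h₁₃ h₂₃, lam_eq_lam_iff]
  constructor
  · rintro ⟨γ, hγ, rfl⟩
    obtain ⟨γ', hγ', h⟩ := exists_freeGamma hγ τ'
    exact ⟨⟨γ', hγ'⟩, h⟩
  · rintro ⟨γ, h⟩
    exact ⟨γ, freeGamma_le γ.2, h⟩

/-! ### The values at the cusps -/

theorem tendsto_coe_atImInfty : Tendsto UpperHalfPlane.coe atImInfty (comap Complex.im atTop) := by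
  rw [tendsto_comap_iff]
  exact tendsto_comap

theorem tendsto_coverMap {a₁ a₂ a₃ : OnePoint ℂ} (h₁₂ : a₁ ≠ a₂) (h₁₃ : a₁ ≠ a₃)
    (h₂₃ : a₂ ≠ a₃) : Tendsto (coverMap a₁ a₂ a₃) atImInfty (𝓝 a₁) := by
  have h1 := (continuous_mobius (det_coverMap_ne_zero h₁₂ h₁₃ h₂₃)).tendsto ((0 : ℂ) : OnePoint ℂ)
  rw [(mobius_coverMap_values h₁₂ h₁₃ h₂₃).1] at h1
  refine (h1.comp ((OnePoint.continuous_coe.tendsto 0).comp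
    (tendsto_lam.comp tendsto_coe_atImInfty))).congr fun τ => ?_
  exact (coverMap_eq_mobius _ _ _ _).symm

theorem tendsto_vertical_inv :
    Tendsto (fun y : ℝ => ofComplex ((y⁻¹ : ℝ) * Complex.I)) (𝓝[>] 0) atImInfty := by
  rw [atImInfty, tendsto_comap_iff]
  refine tendsto_inv_nhdsGT_zero.congr' ?_
  filter_upwards [self_mem_nhdsWithin] with y hy
  have hy' : 0 < (((y⁻¹ : ℝ) : ℂ) * Complex.I).im := by simpa using hy
  rw [Function.comp, ← UpperHalfPlane.coe_im, UpperHalfPlane.ofComplex_apply_of_im_pos hy']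
  simp

theorem ofComplex_vertical {y : ℝ} (hy : 0 < y) : ofComplex (y * Complex.I) =
    ModularGroup.S • ofComplex ((y⁻¹ : ℝ) * Complex.I) := by
  have h1 : 0 < (((y : ℝ) : ℂ) * Complex.I).im := by simpa using hy
  have h2 : 0 < (((y⁻¹ : ℝ) : ℂ) * Complex.I).im := by simpa using hy
  apply UpperHalfPlane.ext
  rw [coe_S_smul, UpperHalfPlane.ofComplex_apply_of_im_pos h1,
    UpperHalfPlane.ofComplex_apply_of_im_pos h2]
  have : (y : ℂ) ≠ 0 := by exact_mod_cast hy.ne'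
  push_cast
  field_simp
  simp

theorem ofComplex_one_add_vertical {y : ℝ} (hy : 0 < y) : ofComplex (1 + y * Complex.I) =
    ModularGroup.T • ofComplex (y * Complex.I) := by
  have h1 : 0 < (1 + ((y : ℝ) : ℂ) * Complex.I).im := by simpa using hy
  have h2 : 0 < (((y : ℝ) : ℂ) * Complex.I).im := by simpa using hy
  apply UpperHalfPlane.ext
  rw [coe_T_smul, UpperHalfPlane.ofComplex_apply_of_im_pos h1,
    UpperHalfPlane.ofComplex_apply_of_im_pos h2]
  exact add_comm _ _

theorem hasCuspValues_coverMap {a₁ a₂ a₃ : OnePoint ℂ} (h₁₂ : a₁ ≠ a₂) (h₁₃ : a₁ ≠ a₃)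
    (h₂₃ : a₂ ≠ a₃) : HasCuspValues (coverMap a₁ a₂ a₃) a₁ a₂ a₃ := by
  refine ⟨tendsto_coverMap h₁₂ h₁₃ h₂₃, ?_, ?_⟩
  · refine ((tendsto_coverMap h₁₂.symm h₂₃ h₁₃).comp tendsto_vertical_inv).congr' ?_
    filter_upwards [self_mem_nhdsWithin] with y hy
    rw [ofComplex_vertical hy, coverMap_S]; rfl
  · refine ((tendsto_coverMap h₁₃.symm h₂₃.symm h₁₂).comp tendsto_vertical_inv).congr' ?_
    filter_upwards [self_mem_nhdsWithin] with y hy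
    rw [ofComplex_one_add_vertical hy, coverMap_T, ofComplex_vertical hy, coverMap_S]; rfl

/-! ### Local behaviour of holomorphic functions -/

/-- An injective holomorphic function has nonvanishing derivative. -/
theorem deriv_ne_zero_of_injOn {f : ℂ → ℂ} {z : ℂ} (hf : AnalyticAt ℂ f z) {U : Set ℂ}
    (hU : U ∈ 𝓝 z) (hinj : Set.InjOn f U) : deriv f z ≠ 0 := by
  intro hd
  have hg : AnalyticAt ℂ (fun x => f x - f z) z := hf.sub analyticAt_const
  have hne : analyticOrderAt (fun x => f x - f z) z ≠ ⊤ := by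
    intro h
    rw [analyticOrderAt_eq_top] at h
    have h1 : ∀ᶠ x in 𝓝[≠] z, False := by
      filter_upwards [nhdsWithin_le_nhds h, nhdsWithin_le_nhds hU, self_mem_nhdsWithin]
        with x hx hxU hxz
      exact hxz (hinj hxU (mem_of_mem_nhds hU) (sub_eq_zero.mp hx))
    exact h1.exists.elim fun _ h => h
  obtain ⟨g, hga, hg0, hfg⟩ := (hg.analyticOrderAt_ne_top).mp hne
  set n := analyticOrderNatAt (fun x => f x - f z) z with hn
  have hn0 : n ≠ 0 := by
    intro h0
    have := hfg.self_of_nhds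
    rw [h0] at this
    simp at this
    exact hg0 this.symm
  have hn1 : n ≠ 1 := by
    intro h1
    have h2 : HasDerivAt (fun x => (x - z) ^ n • g x) (g z) z := by
      rw [h1]
      have := ((hasDerivAt_id z).sub_const z).mul hga.differentiableAt.hasDerivAt
      simpa [Pi.mul_def] using this
    have h3 := (h2.congr_of_eventuallyEq hfg).deriv
    rw [deriv_sub_const] at h3
    exact hg0 (h3.symm.trans hd)
  -- In the local coordinate s = (x - z) r the function is f(z) + g(z) sⁿ. For n ≥ 2 the two points
  -- with coordinates ε/2 and ζ ε/2, where ζ is a primitive n-th root of unity, have the same image.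
  set r : ℂ → ℂ := fun x => (g x / g z) ^ (1 / n : ℂ) with hr
  have hra : AnalyticAt ℂ r z := by
    refine AnalyticAt.cpow (hga.div_const) analyticAt_const ?_
    simp [div_self hg0]
  have hrz : r z = 1 := by simp [hr, div_self hg0]
  have hrn : ∀ x, r x ^ n = g x / g z := fun x => by
    rw [hr]; simp only [one_div]
    exact Complex.cpow_nat_inv_pow _ hn0
  set s : ℂ → ℂ := fun x => (x - z) * r x with hs
  have hsa : AnalyticAt ℂ s z := by fun_prop
  have hsd : deriv s z = 1 := by
    have := ((hasDerivAt_id z).sub_const z).mul hra.differentiableAt.hasDerivAt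
    have := this.deriv
    simp only [id, Pi.mul_def] at this
    rw [hs, this]; simp [hrz]
  have hmap : map s (𝓝 z) = 𝓝 0 := by
    have := hsa.hasStrictDerivAt.map_nhds_eq (by rw [hsd]; exact one_ne_zero)
    rw [this]; simp [hs]
  have hW : s '' (U ∩ {x | f x - f z = (x - z) ^ n • g x}) ∈ 𝓝 (0 : ℂ) := by
    rw [← hmap]; exact image_mem_map (inter_mem hU hfg)
  obtain ⟨ε, hε, hball⟩ := Metric.mem_nhds_iff.mp hW
  set ζ : ℂ := Complex.exp (2 * Real.pi * Complex.I / n) with hζ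
  have hprim : IsPrimitiveRoot ζ n := Complex.isPrimitiveRoot_exp n hn0
  have hζ1 : ζ ≠ 1 := hprim.ne_one (by omega)
  have hζn : ‖ζ‖ = 1 := hprim.norm'_eq_one hn0
  have ht : ‖((ε / 2 : ℝ) : ℂ)‖ < ε := by
    rw [Complex.norm_real, Real.norm_of_nonneg (by positivity)]; linarith
  obtain ⟨x, ⟨hxU, hx⟩, hxs⟩ := hball (show ((ε / 2 : ℝ) : ℂ) ∈ Metric.ball 0 ε by simpa using ht)
  obtain ⟨y, ⟨hyU, hy⟩, hys⟩ := hball (show ζ * ((ε / 2 : ℝ) : ℂ) ∈ Metric.ball 0 ε by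
    rw [mem_ball_zero_iff, norm_mul, hζn, one_mul]; exact ht)
  have key : ∀ x, f x - f z = (x - z) ^ n • g x → f x = f z + g z * s x ^ n := fun x hx => by
    rw [hs, mul_pow, hrn]
    rw [smul_eq_mul] at hx
    field_simp
    linear_combination hx
  have hxy : x = y := by
    apply hinj hxU hyU
    rw [key x hx, key y hy, hxs, hys, mul_pow, hprim.pow_eq_one, one_mul]
  rw [← hxy, hxs] at hys
  apply hζ1
  have : ((ε / 2 : ℝ) : ℂ) ≠ 0 := by exact_mod_cast (by positivity : ε / 2 ≠ 0)
  exact mul_right_cancel₀ this (by rw [← hys, one_mul])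

theorem exists_local_inverse {f : ℂ → ℂ} {z : ℂ} (hf : AnalyticAt ℂ f z) (hd : deriv f z ≠ 0) :
    ∃ Q : ℂ → ℂ, AnalyticAt ℂ Q (f z) ∧ Q (f z) = z ∧ (∀ᶠ w in 𝓝 (f z), f (Q w) = w) ∧
      ∀ᶠ x in 𝓝 z, Q (f x) = x := by
  have hs := hf.hasStrictDerivAt
  have hse := hs.hasStrictFDerivAt_equiv hd
  exact ⟨hs.localInverse f _ z hd, hf.analyticAt_localInverse hd, hse.localInverse_apply_image,
    hse.eventually_right_inverse, hse.eventually_left_inverse⟩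

/-- A holomorphic map of the sphere minus `0, 1, ∞` in itself that is injective and extends
continuously by fixing `0`, `1` and `∞` is the identity. Here the limits at `1` and `∞` are only
given along some filters. -/
theorem eq_id_of_injective {φ : ℂ → ℂ} (hd : ∀ z, z ≠ 0 → z ≠ 1 → DifferentiableAt ℂ φ z)
    (hinj : Set.InjOn φ {0, 1}ᶜ) (hφ0 : ∀ z, z ≠ 0 → z ≠ 1 → φ z ≠ 0)
    (h0 : Tendsto φ (𝓝[≠] 0) (𝓝 0)) {l1 l2 : Filter ℂ} [l1.NeBot] [l2.NeBot] (hl1 : l1 ≤ 𝓝[≠] 1)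
    (h1 : Tendsto φ l1 (𝓝 1)) (hl2 : l2 ≤ Bornology.cobounded ℂ)
    (h2 : Tendsto φ l2 (Bornology.cobounded ℂ)) {z : ℂ} (hz0 : z ≠ 0) (hz1 : z ≠ 1) : φ z = z := by
  -- extension to `0`
  set φ0 := Function.update φ 0 0 with hφ0def
  have hev0 : φ0 =ᶠ[𝓝[≠] 0] φ := by
    filter_upwards [self_mem_nhdsWithin] with x hx
    exact Function.update_of_ne hx _ _
  have hne1 : ∀ᶠ x : ℂ in 𝓝 0, x ≠ 1 := isOpen_ne.mem_nhds (by norm_num)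
  have hdiff : ∀ x, x ≠ 0 → x ≠ 1 → DifferentiableAt ℂ φ0 x := fun x hx hx1 =>
    (hd x hx hx1).congr_of_eventuallyEq ((isOpen_ne.eventually_mem hx).mono
      fun y hy => Function.update_of_ne hy _ _)
  have hana0 : AnalyticAt ℂ φ0 0 := by
    refine Complex.analyticAt_of_differentiable_on_punctured_nhds_of_continuousAt ?_ ?_
    · filter_upwards [self_mem_nhdsWithin, nhdsWithin_le_nhds hne1] with x hx hx1
      exact hdiff x hx hx1
    · exact continuousAt_update_same.mpr h0
  -- `φ` is bounded away from `0` away from `0`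
  have hopen : 𝓝 (0 : ℂ) ≤ map φ0 (𝓝 0) := by
    have := hana0.eventually_constant_or_nhds_le_map_nhds
    rw [show φ0 0 = 0 from Function.update_self _ _ _] at this
    refine this.resolve_left fun h => ?_
    have : ∀ᶠ x : ℂ in 𝓝[≠] 0, False := by
      filter_upwards [nhdsWithin_le_nhds h, hev0, self_mem_nhdsWithin, nhdsWithin_le_nhds hne1]
        with x hx hx2 hx3 hx4
      exact hφ0 x hx3 hx4 (hx2 ▸ hx)
    exact this.exists.elim fun _ h => h
  -- The image of the disc of radius 1/2 contains an ε-disc. By injectivity no other point has its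
  -- image in this ε-disc, so 1/φ is bounded near 1 and near ∞ and both singularities are removable.
  obtain ⟨ε, hε, hball⟩ := Metric.mem_nhds_iff.mp
    (hopen (image_mem_map (Metric.ball_mem_nhds 0 (by norm_num : (0 : ℝ) < 1 / 2))))
  have hlow : ∀ x : ℂ, 1 / 2 ≤ ‖x‖ → x ≠ 1 → ε ≤ ‖φ x‖ := by
    intro x hx hx1
    by_contra! hlt
    have hx0 : x ≠ 0 := by rintro rfl; norm_num at hx
    obtain ⟨y, hy, hyx⟩ := hball (mem_ball_zero_iff.mpr hlt)
    rw [mem_ball_zero_iff] at hy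
    have hy0 : y ≠ 0 := by
      rintro rfl
      rw [show φ0 0 = 0 from Function.update_self _ _ _] at hyx
      exact hφ0 x hx0 hx1 hyx.symm
    have hy1 : y ≠ 1 := by rintro rfl; norm_num at hy
    rw [show φ0 y = φ y from Function.update_of_ne hy0 _ _] at hyx
    have := hinj (by simp [hy0, hy1]) (by simp [hx0, hx1]) hyx
    rw [this] at hy; linarith
  have hbdd : ∀ x : ℂ, 1 / 2 ≤ ‖x‖ → x ≠ 1 → ‖(φ x)⁻¹‖ ≤ ε⁻¹ := fun x hx hx1 => by
    rw [norm_inv]; exact inv_anti₀ hε (hlow x hx hx1)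
  -- the limit at `1`
  have hlim1 : Tendsto φ (𝓝[≠] 1) (𝓝 1) := by
    have hfar : ∀ᶠ x : ℂ in 𝓝[≠] 1, 1 / 2 ≤ ‖x‖ ∧ x ≠ 0 ∧ x ≠ 1 := by
      have h3 : ∀ᶠ x : ℂ in 𝓝 1, 1 / 2 < ‖x‖ :=
        continuous_norm.continuousAt.eventually_const_lt (by norm_num)
      filter_upwards [nhdsWithin_le_nhds h3, self_mem_nhdsWithin] with x hx hx1
      exact ⟨hx.le, by rintro rfl; norm_num at hx, hx1⟩
    have h4 := Complex.tendsto_limUnder_of_differentiable_on_punctured_nhds_of_bounded_under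
      (f := fun x => (φ x)⁻¹) (c := 1)
      (hfar.mono fun x hx => (hd x hx.2.1 hx.2.2).inv (hφ0 x hx.2.1 hx.2.2))
      ⟨ε⁻¹ + ‖(φ 1)⁻¹‖, eventually_map.mpr (hfar.mono fun x hx =>
        (norm_sub_le _ _).trans (add_le_add (hbdd x hx.1 hx.2.2) le_rfl))⟩
    have h5 := (h4.mono_left hl1)
    have h6 := tendsto_nhds_unique h5 (h1.inv₀ one_ne_zero)
    rw [h6] at h4
    have := h4.inv₀ (by simp)
    simpa using this
  -- the extended function
  set Φ := Function.update φ0 1 1 with hΦ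
  have hΦeq : ∀ x, x ≠ 0 → x ≠ 1 → Φ x = φ x := fun x hx hx1 => by
    rw [hΦ, Function.update_of_ne hx1, hφ0def, Function.update_of_ne hx]
  have hΦ0 : Φ 0 = 0 := by
    rw [hΦ, Function.update_of_ne (by norm_num), hφ0def, Function.update_self]
  have hΦ1 : Φ 1 = 1 := Function.update_self _ _ _
  have hcongr : ∀ x, x ≠ 1 → Φ =ᶠ[𝓝 x] φ0 := fun x hx =>
    (isOpen_ne.eventually_mem hx).mono fun y hy => Function.update_of_ne hy _ _
  have hent : Differentiable ℂ Φ := by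
    intro x
    by_cases hx1 : x = 1
    · subst hx1
      have hn0 : ∀ᶠ x : ℂ in 𝓝 1, x ≠ 0 := isOpen_ne.mem_nhds (by norm_num)
      refine (Complex.analyticAt_of_differentiable_on_punctured_nhds_of_continuousAt ?_
        ?_).differentiableAt
      · filter_upwards [self_mem_nhdsWithin, nhdsWithin_le_nhds hn0] with x hx hx0
        exact (hdiff x hx0 hx).congr_of_eventuallyEq (hcongr x hx)
      · refine continuousAt_update_same.mpr (hlim1.congr' ?_)
        filter_upwards [nhdsWithin_le_nhds hn0] with x hx
        exact (Function.update_of_ne hx _ _).symm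
    · by_cases hx0 : x = 0
      · subst hx0; exact hana0.differentiableAt.congr_of_eventuallyEq (hcongr 0 hx1)
      · exact (hdiff x hx0 hx1).congr_of_eventuallyEq (hcongr x hx1)
  -- behaviour at `∞`
  set g : ℂ → ℂ := Function.update (fun w => (φ w⁻¹)⁻¹) 0 0 with hg
  have hgeq : ∀ w, w ≠ 0 → g w = (φ w⁻¹)⁻¹ := fun w hw => Function.update_of_ne hw _ _
  have hsmall : ∀ᶠ w : ℂ in 𝓝 0, ‖w‖ < 1 := by
    filter_upwards [Metric.ball_mem_nhds (0 : ℂ) one_pos] with w hw using mem_ball_zero_iff.mp hw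
  have hwinv : ∀ w : ℂ, w ≠ 0 → ‖w‖ < 1 → 1 / 2 ≤ ‖w⁻¹‖ ∧ w⁻¹ ≠ 0 ∧ w⁻¹ ≠ 1 := by
    intro w hw hw1
    have h3 : 0 < ‖w‖ := norm_pos_iff.mpr hw
    have h4 : 1 < ‖w⁻¹‖ := by rw [norm_inv]; exact (one_lt_inv₀ h3).mpr hw1
    refine ⟨by linarith, inv_ne_zero hw, ?_⟩
    intro h; rw [h] at h4; norm_num at h4
  have hgd : ∀ᶠ w : ℂ in 𝓝[≠] 0, DifferentiableAt ℂ (fun w => (φ w⁻¹)⁻¹) w := by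
    filter_upwards [nhdsWithin_le_nhds hsmall, self_mem_nhdsWithin] with w hw hw0
    obtain ⟨-, h3, h4⟩ := hwinv w hw0 hw
    exact ((hd _ h3 h4).comp w (differentiableAt_inv hw0)).inv (hφ0 _ h3 h4)
  have hlimg : Tendsto (fun w => (φ w⁻¹)⁻¹) (𝓝[≠] 0) (𝓝 0) := by
    have h4 := Complex.tendsto_limUnder_of_differentiable_on_punctured_nhds_of_bounded_under hgd
      ⟨ε⁻¹ + ‖(φ 0⁻¹)⁻¹‖, eventually_map.mpr (by
        filter_upwards [nhdsWithin_le_nhds hsmall, self_mem_nhdsWithin] with w hw hw0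
        obtain ⟨h3, -, h4⟩ := hwinv w hw0 hw
        exact (norm_sub_le _ _).trans (add_le_add (hbdd _ h3 h4) le_rfl))⟩
    have h5 : Tendsto (fun x : ℂ => x⁻¹) l2 (𝓝[≠] 0) := by
      refine tendsto_nhdsWithin_iff.mpr ⟨tendsto_inv₀_cobounded.mono_left hl2, ?_⟩
      have : ∀ᶠ x : ℂ in Bornology.cobounded ℂ, x ≠ 0 := by
        rw [Metric.cobounded_eq_cocompact]
        exact isCompact_singleton.compl_mem_cocompact
      exact (this.filter_mono hl2).mono fun x hx => inv_ne_zero hx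
    have h6 := h4.comp h5
    have h7 : Tendsto (fun x => (φ x)⁻¹) l2 (𝓝 0) := tendsto_inv₀_cobounded.comp h2
    have h8 := tendsto_nhds_unique h6 (by simpa [Function.comp_def] using h7)
    rwa [h8] at h4
  have hgana : AnalyticAt ℂ g 0 := by
    refine Complex.analyticAt_of_differentiable_on_punctured_nhds_of_continuousAt ?_
      (continuousAt_update_same.mpr hlimg)
    filter_upwards [hgd, self_mem_nhdsWithin] with w hw hw0
    exact hw.congr_of_eventuallyEq ((isOpen_ne.eventually_mem hw0).mono
      fun y hy => Function.update_of_ne hy _ _)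
  have hg0 : g 0 = 0 := Function.update_self _ _ _
  have hginj : Set.InjOn g (Metric.ball 0 1) := by
    intro w hw v hv hwv
    rw [mem_ball_zero_iff] at hw hv
    by_cases hw0 : w = 0
    · by_cases hv0 : v = 0
      · rw [hw0, hv0]
      · obtain ⟨-, h3, h4⟩ := hwinv v hv0 hv
        rw [hw0, hg0, hgeq v hv0] at hwv
        exact absurd (inv_eq_zero.mp hwv.symm) (hφ0 _ h3 h4)
    · obtain ⟨-, h3, h4⟩ := hwinv w hw0 hw
      by_cases hv0 : v = 0
      · rw [hv0, hg0, hgeq w hw0] at hwv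
        exact absurd (inv_eq_zero.mp hwv) (hφ0 _ h3 h4)
      · obtain ⟨-, h5, h6⟩ := hwinv v hv0 hv
        rw [hgeq w hw0, hgeq v hv0, inv_inj] at hwv
        exact inv_injective (hinj (by simp [h3, h4]) (by simp [h5, h6]) hwv)
  -- Injectivity makes ∞ a simple pole, so Φ(z)/z has a finite limit there.
  have hgd0 := deriv_ne_zero_of_injOn hgana (Metric.ball_mem_nhds 0 one_pos) hginj
  -- the quotient `Φ z / z` is bounded
  have hslope : Tendsto (fun w => w * φ w⁻¹) (𝓝[≠] 0) (𝓝 (deriv g 0)⁻¹) := by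
    have h3 := hasDerivAt_iff_tendsto_slope.mp hgana.differentiableAt.hasDerivAt
    refine (h3.inv₀ hgd0).congr' ?_
    filter_upwards [self_mem_nhdsWithin] with w hw
    rw [slope_def_field, hg0, hgeq w hw]; simp [div_eq_mul_inv]
  obtain ⟨δ, hδ, hδb⟩ := Metric.mem_nhdsWithin_iff.mp
    (hslope.norm.eventually (gt_mem_nhds (lt_add_one _)))
  have hqd : Differentiable ℂ (dslope Φ 0) := by
    have := (Complex.differentiableOn_dslope (f := Φ) (c := 0) (s := Set.univ) univ_mem).mpr
      hent.differentiableOn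
    exact differentiableOn_univ.mp this
  have hbound : Bornology.IsBounded (Set.range (dslope Φ 0)) := by
    set R := max (δ⁻¹ + 1) 2 with hR
    have hc := (isCompact_closedBall (0 : ℂ) R).exists_bound_of_continuousOn
      hqd.continuous.continuousOn
    obtain ⟨C, hC⟩ := hc
    refine isBounded_iff_forall_norm_le.mpr ⟨max C (‖(deriv g 0)⁻¹‖ + 1), ?_⟩
    rintro _ ⟨x, rfl⟩
    by_cases hx : ‖x‖ ≤ R
    · exact (hC x (by simpa using hx)).trans (le_max_left _ _)
    · push Not at hx
      have hxδ : δ⁻¹ < ‖x‖ := by linarith [le_max_left (δ⁻¹ + 1) 2]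
      have hx2 : 2 < ‖x‖ := (le_max_right _ _).trans_lt hx
      have hx0 : x ≠ 0 := by rintro rfl; norm_num at hx2
      have hx1 : x ≠ 1 := by rintro rfl; norm_num at hx2
      have h4 := @hδb x⁻¹ ⟨by
        rw [mem_ball_zero_iff, norm_inv]; exact inv_lt_of_inv_lt₀ hδ hxδ, by simpa using hx0⟩
      simp only [Set.mem_ofPred_eq, inv_inv] at h4
      refine le_trans ?_ (le_max_right _ _)
      rw [dslope_of_ne _ hx0, slope_def_field, hΦ0, hΦeq x hx0 hx1]
      refine le_trans (le_of_eq ?_) h4.le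
      congr 1
      rw [sub_zero, sub_zero, div_eq_inv_mul]
  -- By Liouville's theorem Φ(z)/z is constant, and it equals 1 at z = 1.
  have hconst := hqd.apply_eq_apply_of_bounded hbound
  have h3 := hconst z 1
  rw [dslope_of_ne _ hz0, dslope_of_ne _ one_ne_zero, slope_def_field, slope_def_field, hΦ0, hΦ1,
    hΦeq z hz0 hz1] at h3
  simp only [sub_zero, div_one] at h3
  rwa [div_eq_one_iff_eq hz0] at h3

/-! ### Uniqueness of the covering map -/

theorem eq_coe_zCoord {p : OnePoint ℂ} (hp : p ≠ OnePoint.infty) : p = (zCoord p : ℂ) := by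
  induction p using OnePoint.rec with
  | infty => exact absurd rfl hp
  | coe z => rfl

theorem hpt_zCoord {p : OnePoint ℂ} (hp : p ≠ OnePoint.infty) : hpt (zCoord p) 1 = p := by
  rw [hpt_of_ne one_ne_zero, div_one, ← eq_coe_zCoord hp]

theorem hpt_wCoord {p : OnePoint ℂ} (hp : p ≠ ((0 : ℂ) : OnePoint ℂ)) : hpt 1 (wCoord p) = p := by
  induction p using OnePoint.rec with
  | infty => simp
  | coe z =>
    have hz : z ≠ 0 := by rintro rfl; exact hp rfl
    rw [wCoord_coe, hpt_of_ne (inv_ne_zero hz), one_div, inv_inv]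

theorem tendsto_comp_ofComplex {f : ℍ → OnePoint ℂ} (hf : Continuous f) (τ : ℍ) :
    Tendsto (fun z => f (ofComplex z)) (𝓝 (τ : ℂ)) (𝓝 (f τ)) := by
  have h1 : Tendsto ofComplex (𝓝 (τ : ℂ)) (𝓝 τ) := by
    have := (UpperHalfPlane.contMDiffAt_ofComplex (n := 0) τ.im_pos).continuousAt.tendsto
    rwa [UpperHalfPlane.ofComplex_apply] at this
  exact (hf.tendsto τ).comp h1

/-- In the coordinate in which f is regular, z or w, the composition is a quotient of affine
functions. -/
theorem differentiableAt_zMap_mobius {f : ℍ → OnePoint ℂ} (hf : IsHolomorphic f) {a b c d : ℂ}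
    {τ : ℍ} (hτ : mobius a b c d (f τ) ≠ OnePoint.infty) :
    DifferentiableAt ℂ (zMap fun τ => mobius a b c d (f τ)) τ := by
  have ht := tendsto_comp_ofComplex hf.1 τ
  by_cases hinf : f τ = OnePoint.infty
  · have hd := (hf.2 τ).2 hinf
    have hev : ∀ᶠ z in 𝓝 (τ : ℂ), f (ofComplex z) ≠ ((0 : ℂ) : OnePoint ℂ) :=
      ht.eventually (isOpen_ne.mem_nhds (by rw [hinf]; exact (OnePoint.coe_ne_infty _).symm))
    have heq : (zMap fun τ => mobius a b c d (f τ)) =ᶠ[𝓝 (τ : ℂ)]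
        fun z => (a * 1 + b * wMap f z) / (c * 1 + d * wMap f z) := by
      filter_upwards [hev] with z hz
      rw [zMap]
      conv_lhs => rw [← hpt_wCoord hz]
      rw [mobius_hpt _ _ _ _ (Or.inl one_ne_zero), zCoord_hpt]; rfl
    refine DifferentiableAt.congr_of_eventuallyEq ?_ heq
    refine ((hd.const_mul b).const_add _).div ((hd.const_mul d).const_add _) ?_
    intro h0
    apply hτ
    have h0' : f τ ≠ ((0 : ℂ) : OnePoint ℂ) := by rw [hinf]; exact (OnePoint.coe_ne_infty _).symm
    rw [← hpt_wCoord h0', mobius_hpt _ _ _ _ (Or.inl one_ne_zero), hpt_eq_infty_iff]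
    simpa [wMap, UpperHalfPlane.ofComplex_apply] using h0
  · have hd := (hf.2 τ).1 hinf
    have hev : ∀ᶠ z in 𝓝 (τ : ℂ), f (ofComplex z) ≠ OnePoint.infty :=
      ht.eventually (isOpen_ne.mem_nhds hinf)
    have heq : (zMap fun τ => mobius a b c d (f τ)) =ᶠ[𝓝 (τ : ℂ)]
        fun z => (a * zMap f z + b * 1) / (c * zMap f z + d * 1) := by
      filter_upwards [hev] with z hz
      rw [zMap]
      conv_lhs => rw [← hpt_zCoord hz]
      rw [mobius_hpt _ _ _ _ (Or.inr one_ne_zero), zCoord_hpt]; rfl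
    refine DifferentiableAt.congr_of_eventuallyEq ?_ heq
    refine ((hd.const_mul a).add_const _).div ((hd.const_mul c).add_const _) ?_
    intro h0
    apply hτ
    rw [← hpt_zCoord hinf, mobius_hpt _ _ _ _ (Or.inr one_ne_zero), hpt_eq_infty_iff]
    simpa [zMap, UpperHalfPlane.ofComplex_apply] using h0

theorem coverMap_zero_one_infty (τ : ℍ) :
    coverMap ((0 : ℂ) : OnePoint ℂ) ((1 : ℂ) : OnePoint ℂ) OnePoint.infty τ = (lam τ : ℂ) := by
  rw [coverMap, modularLambda_eq_lam]
  simp [diff, hpt]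

/-- After the inverse Möbius transformation f takes values in ℂ ∖ {0, 1} and has the fibres of λ, so
it is φ ∘ λ with φ injective. Local inverses of λ make φ holomorphic, and the cusp values give its
limits at 0, 1, ∞. -/
theorem coverMap_unique {a₁ a₂ a₃ : OnePoint ℂ} (h₁₂ : a₁ ≠ a₂) (h₁₃ : a₁ ≠ a₃)
    (h₂₃ : a₂ ≠ a₃) {f : ℍ → OnePoint ℂ} (hf : IsHolomorphic f)
    (hrange : Set.range f = {a₁, a₂, a₃}ᶜ) (hfib : FibresAreGammaTwoOrbits f)
    (hcusp : HasCuspValues f a₁ a₂ a₃) : f = coverMap a₁ a₂ a₃ := by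
  obtain ⟨hM0, hM1, hMi⟩ := mobius_coverMap_values h₁₂ h₁₃ h₂₃
  have hdet := det_coverMap_ne_zero h₁₂ h₁₃ h₂₃
  set a := -(hx a₃ * diff a₂ a₁)
  set b := hx a₁ * diff a₂ a₃
  set c := -(hy a₃ * diff a₂ a₁)
  set d := hy a₁ * diff a₂ a₃
  set M := mobiusHomeo hdet with hMdef
  have hsymm : ∀ p, M.symm p = mobius d (-b) (-c) a p := fun p => rfl
  have hMs0 : M.symm a₁ = ((0 : ℂ) : OnePoint ℂ) := by rw [Homeomorph.symm_apply_eq]; exact hM0.symm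
  have hMs1 : M.symm a₂ = ((1 : ℂ) : OnePoint ℂ) := by rw [Homeomorph.symm_apply_eq]; exact hM1.symm
  have hMsi : M.symm a₃ = OnePoint.infty := by rw [Homeomorph.symm_apply_eq]; exact hMi.symm
  set κ : ℍ → ℂ := fun τ => zCoord (M.symm (f τ)) with hκ
  have hmem : ∀ τ, f τ ≠ a₁ ∧ f τ ≠ a₂ ∧ f τ ≠ a₃ := fun τ => by
    have : f τ ∈ ({a₁, a₂, a₃}ᶜ : Set (OnePoint ℂ)) := hrange ▸ Set.mem_range_self τ
    simpa using this
  have hki : ∀ τ, M.symm (f τ) ≠ OnePoint.infty := fun τ => by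
    rw [← hMsi, M.symm.injective.ne_iff]; exact (hmem τ).2.2
  have hκM : ∀ τ, ((κ τ : ℂ) : OnePoint ℂ) = M.symm (f τ) := fun τ => (eq_coe_zCoord (hki τ)).symm
  have hκ0 : ∀ τ, κ τ ≠ 0 := fun τ h => (hmem τ).1 (by
    apply M.symm.injective; rw [hMs0, ← hκM, h])
  have hκ1 : ∀ τ, κ τ ≠ 1 := fun τ h => (hmem τ).2.1 (by
    apply M.symm.injective; rw [hMs1, ← hκM, h])
  have hκiff : ∀ τ τ', κ τ = κ τ' ↔ lam τ = lam τ' := fun τ τ' => by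
    rw [lam_eq_lam_iff, ← hfib, ← M.symm.injective.eq_iff, ← hκM, ← hκM, OnePoint.coe_eq_coe]
  -- the induced map
  have hsec : ∀ z : ℂ, ∃ τ : ℍ, z ≠ 0 → z ≠ 1 → lam τ = z := fun z => by
    by_cases h : z ≠ 0 ∧ z ≠ 1
    · obtain ⟨τ, hτ⟩ := exists_lam_eq h.1 h.2
      exact ⟨τ, fun _ _ => hτ⟩
    · exact ⟨UpperHalfPlane.I, fun h0 h1 => absurd ⟨h0, h1⟩ h⟩
  choose s hs using hsec
  set φ : ℂ → ℂ := fun z => κ (s z) with hφ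
  have hφlam : ∀ τ : ℍ, φ (lam τ) = κ τ := fun τ => by
    rw [hφ]
    exact (hκiff _ _).mpr (hs _ (lam_coe_ne_zero τ) (lam_coe_ne_one τ))
  have hκd : ∀ τ : ℍ, DifferentiableAt ℂ (fun z => κ (ofComplex z)) τ := fun τ =>
    differentiableAt_zMap_mobius hf (hki τ)
  have hφd : ∀ z, z ≠ 0 → z ≠ 1 → DifferentiableAt ℂ φ z := by
    intro z h0 h1
    obtain ⟨τ, rfl⟩ := exists_lam_eq h0 h1
    obtain ⟨Q, hQ, hQτ, hright, -⟩ :=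
      exists_local_inverse (analyticAt_lam τ.im_pos) (deriv_lam_ne_zero τ.im_pos)
    have hcomp : DifferentiableAt ℂ (fun w => κ (ofComplex (Q w))) (lam τ) :=
      DifferentiableAt.comp (g := fun z => κ (ofComplex z)) (lam τ) (by rw [hQτ]; exact hκd τ)
        hQ.differentiableAt
    refine hcomp.congr_of_eventuallyEq ?_
    have hpos : ∀ᶠ w in 𝓝 (lam τ), 0 < (Q w).im :=
      hQ.continuousAt.eventually (by rw [hQτ]; exact eventually_im_pos_nhds τ.im_pos)
    filter_upwards [hright, hpos] with w hw hwp
    rw [← hφlam, UpperHalfPlane.ofComplex_apply_of_im_pos hwp, UpperHalfPlane.coe_mk, hw]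
  have hinj : Set.InjOn φ {0, 1}ᶜ := by
    intro z hz w hw h
    simp only [Set.mem_compl_iff, Set.mem_insert_iff, Set.mem_singleton_iff, not_or] at hz hw
    have := (hκiff _ _).mp h
    rwa [hs z hz.1 hz.2, hs w hw.1 hw.2] at this
  have htend : ∀ {l : Filter ℍ} {p : OnePoint ℂ}, Tendsto f l (𝓝 p) →
      Tendsto (fun τ => ((κ τ : ℂ) : OnePoint ℂ)) l (𝓝 (M.symm p)) := fun h => by
    simp only [hκM]
    exact (M.symm.continuous.tendsto _).comp h
  have hfin : ∀ {l : Filter ℝ} {g : ℝ → ℂ} {z : ℂ},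
      Tendsto (fun y => ((g y : ℂ) : OnePoint ℂ)) l (𝓝 (z : OnePoint ℂ)) → Tendsto g l (𝓝 z) :=
    fun h => (OnePoint.isOpenEmbedding_coe.isInducing.tendsto_nhds_iff).mpr h
  have hinf : ∀ {l : Filter ℝ} {g : ℝ → ℂ},
      Tendsto (fun y => ((g y : ℂ) : OnePoint ℂ)) l (𝓝 OnePoint.infty) →
        Tendsto g l (Bornology.cobounded ℂ) := fun h => by
    rw [Metric.cobounded_eq_cocompact, ← coclosedCompact_eq_cocompact,
      ← OnePoint.comap_coe_nhds_infty, tendsto_comap_iff]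
    exact h
  -- Points with small λ can be moved high up by Γ(2), so the limit at the cusp ∞ gives a full limit
  -- of φ at 0. At 1 and ∞ limits are known only along images of vertical lines.
  have hφ0 : Tendsto φ (𝓝[≠] 0) (𝓝 0) := by
    have h1 : Tendsto κ atImInfty (𝓝 0) := by
      have := htend hcusp.1
      rw [hMs0] at this
      exact (OnePoint.isOpenEmbedding_coe.isInducing.tendsto_nhds_iff).mpr this
    intro V hV
    obtain ⟨Y, hY⟩ := (UpperHalfPlane.atImInfty_mem _).mp (h1 hV)
    obtain ⟨δ, hδ, hhigh⟩ := exists_smul_high Y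
    have hlt : ∀ᶠ z : ℂ in 𝓝 0, ‖z‖ < δ := by
      filter_upwards [Metric.ball_mem_nhds (0 : ℂ) hδ] with w hw using mem_ball_zero_iff.mp hw
    have hne1 : ∀ᶠ x : ℂ in 𝓝 0, x ≠ 1 := isOpen_ne.mem_nhds (by norm_num)
    rw [mem_map]
    filter_upwards [nhdsWithin_le_nhds hlt, nhdsWithin_le_nhds hne1, self_mem_nhdsWithin]
      with z hz hz1 hz0
    obtain ⟨γ, hγ, hγY⟩ := hhigh (s z) (by rwa [hs z hz0 hz1])
    have := hY _ hγY
    rwa [Set.mem_preimage, (hκiff _ (s z)).mpr (lam_smul_of_mem hγ _)] at this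
  have h01i := hasCuspValues_coverMap (a₁ := ((0 : ℂ) : OnePoint ℂ)) (a₂ := ((1 : ℂ) : OnePoint ℂ))
    (a₃ := OnePoint.infty) (by simp) (OnePoint.coe_ne_infty _) (OnePoint.coe_ne_infty _)
  have hid : ∀ z, z ≠ 0 → z ≠ 1 → φ z = z := by
    intro z hz0 hz1
    have hl1 := hfin (by simpa only [coverMap_zero_one_infty] using h01i.2.1)
    have hl2 := hinf (by simpa only [coverMap_zero_one_infty] using h01i.2.2)
    have hk1 := htend (l := map _ (𝓝[>] 0)) (tendsto_map'_iff.mpr hcusp.2.1)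
    rw [tendsto_map'_iff, hMs1] at hk1
    have hk1 := hfin hk1
    have hk2 := htend (l := map _ (𝓝[>] 0)) (tendsto_map'_iff.mpr hcusp.2.2)
    rw [tendsto_map'_iff, hMsi] at hk2
    have hk2 := hinf hk2
    simp only [← hφlam] at hk1 hk2
    refine eq_id_of_injective hφd hinj (fun z h0 h1 => hκ0 _) hφ0 ?_ (tendsto_map'_iff.mpr hk1) hl2
      (tendsto_map'_iff.mpr hk2) hz0 hz1
    exact tendsto_nhdsWithin_iff.mpr ⟨hl1, Eventually.of_forall fun y => lam_coe_ne_one _⟩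
  funext τ
  have h1 := hid (lam τ) (lam_coe_ne_zero τ) (lam_coe_ne_one τ)
  rw [hφlam] at h1
  rw [coverMap_eq_mobius, ← h1, hκM]
  exact (M.apply_symm_apply _).symm

/-! ### Conformal pullback of densities of curvature `-1` -/

/-- A smooth positive density of curvature `-1` at `z`. -/
structure IsHyperbolicAt (σ : ℂ → ℝ) (z : ℂ) : Prop where
  pos : 0 < σ z
  smooth : ContDiffAt ℝ ∞ σ z
  laplacian_log : Laplacian.laplacian (fun z => Real.log (σ z)) z = σ z ^ 2

theorem isHyperbolicAt_iff {σ : ℂ → ℝ} {z : ℂ} (hpos : 0 < σ z) : IsHyperbolicAt σ z ↔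
    ContDiffAt ℝ ∞ σ z ∧ -Laplacian.laplacian (fun z => Real.log (σ z)) z / σ z ^ 2 = -1 := by
  have h : σ z ^ 2 ≠ 0 := by positivity
  rw [neg_div, neg_inj, div_eq_one_iff_eq h]
  exact ⟨fun h => ⟨h.2, h.3⟩, fun h => ⟨hpos, h.1, h.2⟩⟩

theorem ContDiffAt.two_of_smooth {u : ℂ → ℝ} {z : ℂ} (hu : ContDiffAt ℝ ∞ u z) : ContDiffAt ℝ 2 u z :=
  hu.of_le (by norm_cast)

theorem IsHyperbolicAt.contDiffAt_log {σ : ℂ → ℝ} {z : ℂ} (h : IsHyperbolicAt σ z) :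
    ContDiffAt ℝ 2 (fun z => Real.log (σ z)) z :=
  (ContDiffAt.two_of_smooth h.smooth).log h.pos.ne'

/-- log ‖g'‖ is harmonic, so the Laplacian of log μ is ‖g'‖² times that of log σ at g, which is μ².
-/
theorem IsHyperbolicAt.pullback {σ μ : ℂ → ℝ} {g : ℂ → ℂ} {z : ℂ} (hg : AnalyticAt ℂ g z)
    (hd : deriv g z ≠ 0) (hσ : IsHyperbolicAt σ (g z))
    (hμ : μ =ᶠ[𝓝 z] fun x => σ (g x) * ‖deriv g x‖) : IsHyperbolicAt μ z := by
  have hμz := hμ.self_of_nhds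
  have hpos : 0 < ‖deriv g z‖ := norm_pos_iff.mpr hd
  have hgR : ContDiffAt ℝ ∞ g z := (hg.contDiffAt (n := ∞)).restrict_scalars ℝ
  have hdR : ContDiffAt ℝ ∞ (deriv g) z := (hg.deriv.contDiffAt (n := ∞)).restrict_scalars ℝ
  have hsm : ContDiffAt ℝ ∞ (fun x => σ (g x) * ‖deriv g x‖) z :=
    (hσ.smooth.comp z hgR).mul (hdR.norm ℝ hd)
  refine ⟨?_, hsm.congr_of_eventuallyEq hμ, ?_⟩
  · rw [hμz]; exact mul_pos hσ.pos hpos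
  · have hharm := hg.deriv.harmonicAt_log_norm hd
    have hσpos : ∀ᶠ x in 𝓝 z, 0 < σ (g x) :=
      (hσ.smooth.continuousAt.comp hg.continuousAt).eventually_const_lt hσ.pos
    have hdne : ∀ᶠ x in 𝓝 z, deriv g x ≠ 0 := hg.deriv.continuousAt.eventually_ne hd
    have heq : (fun x => Real.log (μ x)) =ᶠ[𝓝 z]
        (fun x => Real.log (σ (g x))) + fun x => Real.log ‖deriv g x‖ := by
      filter_upwards [hμ, hσpos, hdne] with x h1 h2 h3
      rw [h1, Real.log_mul h2.ne' (norm_ne_zero_iff.mpr h3)]; rfl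
    have hc1 : ContDiffAt ℝ 2 (fun x => Real.log (σ (g x))) z :=
      ContDiffAt.two_of_smooth ((hσ.smooth.comp z hgR).log hσ.pos.ne')
    rw [(InnerProductSpace.laplacian_congr_nhds heq).self_of_nhds, hc1.laplacian_add hharm.1,
      hharm.2.self_of_nhds, laplacian_comp_analyticAt (u := fun w => Real.log (σ w)) hg hσ.contDiffAt_log,
      hσ.laplacian_log, hμz]
    simp; ring

/-- The density σ is the pullback of μ by a local inverse of g. -/
theorem IsHyperbolicAt.of_pullback {σ μ : ℂ → ℝ} {g : ℂ → ℂ} {z : ℂ} (hg : AnalyticAt ℂ g z)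
    (hd : deriv g z ≠ 0) (hμ : IsHyperbolicAt μ z)
    (h : μ =ᶠ[𝓝 z] fun x => σ (g x) * ‖deriv g x‖) : IsHyperbolicAt σ (g z) := by
  obtain ⟨Q, hQ, hQz, hright, -⟩ := exists_local_inverse hg hd
  have hQt : Tendsto Q (𝓝 (g z)) (𝓝 z) := by simpa only [ContinuousAt, hQz] using hQ.continuousAt
  have hga : ∀ᶠ w in 𝓝 (g z), DifferentiableAt ℂ g (Q w) :=
    hQt.eventually (hg.eventually_analyticAt.mono fun x hx => hx.differentiableAt)
  have hQa : ∀ᶠ w in 𝓝 (g z), DifferentiableAt ℂ Q w :=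
    hQ.eventually_analyticAt.mono fun x hx => hx.differentiableAt
  have hmul : ∀ᶠ w in 𝓝 (g z), deriv g (Q w) * deriv Q w = 1 := by
    filter_upwards [hga, hQa, hright.eventually_nhds] with w h1 h2 h3
    have h4 := (h1.hasDerivAt.comp w h2.hasDerivAt).congr_of_eventuallyEq
      (f₁ := id) (by filter_upwards [h3] with x hx using hx.symm)
    exact h4.unique (hasDerivAt_id w)
  refine IsHyperbolicAt.pullback (σ := μ) (g := Q) hQ ?_ (by rwa [hQz]) ?_
  · exact right_ne_zero_of_mul_eq_one hmul.self_of_nhds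
  · filter_upwards [hmul, hright, hQt.eventually h] with w h1 h2 h3
    rw [h3, h2, mul_assoc, ← norm_mul, h1, norm_one, mul_one]

theorem isHyperbolicAt_inv_im {z : ℂ} (hz : 0 < z.im) : IsHyperbolicAt (fun z => 1 / z.im) z := by
  have hsm : ContDiffAt ℝ ∞ (fun z : ℂ => 1 / z.im) z :=
    contDiffAt_const.div Complex.imCLM.contDiff.contDiffAt hz.ne'
  have hpos : 0 < 1 / z.im := by positivity
  refine ⟨hpos, hsm, ?_⟩
  rw [laplacian_eq_of_hasDerivAt (a := fun _ => 0) (a' := 0) (b := fun t => -(z.im + t)⁻¹)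
    (b' := 1 / z.im ^ 2) (ContDiffAt.two_of_smooth (hsm.log hpos.ne'))]
  · rw [zero_add, div_pow, one_pow]
  · refine Eventually.of_forall fun t => ?_
    simp only [Complex.add_im, Complex.ofReal_im, add_zero]
    exact hasDerivAt_const _ _
  · exact hasDerivAt_const _ _
  · have h : ∀ᶠ t : ℝ in 𝓝 0, 0 < z.im + t := by
      have : Continuous fun t : ℝ => z.im + t := by fun_prop
      exact this.continuousAt.eventually_const_lt (by simpa using hz)
    filter_upwards [h] with t ht
    have h1 := (((hasDerivAt_id t).const_add z.im).log ht.ne').neg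
    have h2 : (fun t : ℝ => Real.log (1 / (z + t * Complex.I).im)) = fun t => -Real.log (z.im + t) := by
      funext t; simp
    rw [h2]
    refine h1.congr_deriv ?_
    rw [one_div]; rfl
  · have h1 := ((((hasDerivAt_id (0 : ℝ)).const_add z.im)).inv (by simpa using hz.ne')).neg
    refine h1.congr_deriv ?_
    simp [neg_div]

/-! ### The pullback of a density of the sphere -/

open Classical in
/-- The density on the upper half plane of the pullback of the metric `ρ` by `f`. -/
def pull (ρ : OnePoint ℂ → ℝ) (f : ℍ → OnePoint ℂ) (z : ℂ) : ℝ :=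
  if f (ofComplex z) = OnePoint.infty then ρ (f (ofComplex z)) * ‖deriv (wMap f) z‖
  else ρ (f (ofComplex z)) * ‖deriv (zMap f) z‖

theorem wMap_eq_inv (f : ℍ → OnePoint ℂ) : wMap f = fun z => (zMap f z)⁻¹ := by
  funext z
  rw [wMap, zMap]
  induction f (ofComplex z) using OnePoint.rec <;> simp

theorem zMap_eq_inv (f : ℍ → OnePoint ℂ) : zMap f = fun z => (wMap f z)⁻¹ := by
  rw [wMap_eq_inv]; simp

theorem eventually_ne {f : ℍ → OnePoint ℂ} (hf : Continuous f) {τ : ℍ} {p : OnePoint ℂ}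
    (h : f τ ≠ p) : ∀ᶠ z in 𝓝 (τ : ℂ), f (ofComplex z) ≠ p :=
  (tendsto_comp_ofComplex hf τ).eventually (isOpen_ne.mem_nhds h)

theorem zMap_ne_zero {f : ℍ → OnePoint ℂ} {z : ℂ} (h : f (ofComplex z) ≠ OnePoint.infty)
    (h0 : f (ofComplex z) ≠ ((0 : ℂ) : OnePoint ℂ)) : zMap f z ≠ 0 := by
  intro hz
  rw [zMap] at hz
  apply h0
  rw [eq_coe_zCoord h, hz]

theorem analyticAt_of_eventually_coe {g : ℂ → ℂ} {τ : ℍ}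
    (h : ∀ᶠ z in 𝓝 (τ : ℂ), ∀ τ' : ℍ, (τ' : ℂ) = z → DifferentiableAt ℂ g τ') : AnalyticAt ℂ g τ := by
  rw [Complex.analyticAt_iff_eventually_differentiableAt]
  filter_upwards [h, eventually_im_pos_nhds τ.im_pos] with z hz hp
  exact hz ⟨z, hp⟩ rfl

namespace IsImmersion

variable {f : ℍ → OnePoint ℂ} (hf : IsImmersion f)
include hf

theorem analyticAt_zMap {τ : ℍ} (h : f τ ≠ OnePoint.infty) : AnalyticAt ℂ (zMap f) τ := by
  refine analyticAt_of_eventually_coe ?_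
  filter_upwards [eventually_ne hf.holomorphic.1 h] with z hz τ' hτ'
  subst hτ'
  rw [UpperHalfPlane.ofComplex_apply] at hz
  exact (hf.holomorphic.2 τ').1 hz

theorem hasDerivAt_wMap {τ : ℍ} (h : f τ ≠ OnePoint.infty) (h0 : f τ ≠ ((0 : ℂ) : OnePoint ℂ)) :
    HasDerivAt (wMap f) (-deriv (zMap f) τ / zMap f τ ^ 2) τ := by
  rw [wMap_eq_inv]
  refine (hf.analyticAt_zMap h).differentiableAt.hasDerivAt.inv (zMap_ne_zero ?_ ?_) <;>
  rwa [UpperHalfPlane.ofComplex_apply]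

theorem analyticAt_wMap {τ : ℍ} (h : f τ ≠ ((0 : ℂ) : OnePoint ℂ)) : AnalyticAt ℂ (wMap f) τ := by
  refine analyticAt_of_eventually_coe ?_
  filter_upwards [eventually_ne hf.holomorphic.1 h] with z hz τ' hτ'
  subst hτ'
  rw [UpperHalfPlane.ofComplex_apply] at hz
  by_cases hi : f τ' = OnePoint.infty
  · exact (hf.holomorphic.2 τ').2 hi
  · exact (hf.hasDerivAt_wMap hi hz).differentiableAt

theorem pull_of_ne_infty (ρ : OnePoint ℂ → ℝ) {τ : ℍ} (h : f τ ≠ OnePoint.infty) :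
    pull ρ f =ᶠ[𝓝 (τ : ℂ)] fun z => ρ (zMap f z : ℂ) * ‖deriv (zMap f) z‖ := by
  filter_upwards [eventually_ne hf.holomorphic.1 h] with z hz
  rw [pull, if_neg hz, zMap, ← eq_coe_zCoord hz]

/-- At nearby finite points the factor ‖w‖⁻² in `wDensity` cancels the factor from w' = -z'/z², so
both coordinates describe the same density. -/
theorem pull_of_eq_infty (ρ : OnePoint ℂ → ℝ) {τ : ℍ} (h : f τ = OnePoint.infty) :
    pull ρ f =ᶠ[𝓝 (τ : ℂ)] fun z => wDensity ρ (wMap f z) * ‖deriv (wMap f) z‖ := by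
  have h0 : f τ ≠ ((0 : ℂ) : OnePoint ℂ) := by rw [h]; exact (OnePoint.coe_ne_infty _).symm
  filter_upwards [eventually_ne hf.holomorphic.1 h0, eventually_im_pos_nhds τ.im_pos] with z hz hp
  by_cases hi : f (ofComplex z) = OnePoint.infty
  · rw [pull, if_pos hi, wDensity, if_pos (by rw [wMap, hi]; rfl), hi]
  · have hzn := zMap_ne_zero hi hz
    have hoz : ((ofComplex z : ℍ) : ℂ) = z := by
      rw [UpperHalfPlane.ofComplex_apply_of_im_pos hp]
    have hd := (hf.hasDerivAt_wMap hi hz).deriv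
    rw [hoz] at hd
    rw [pull, if_neg hi, wDensity, if_neg (by rw [wMap_eq_inv]; exact inv_ne_zero hzn), hd,
      ← congrFun (zMap_eq_inv f) z, wMap_eq_inv, norm_div, norm_neg, norm_pow, norm_inv]
    have : ((zMap f z : ℂ) : OnePoint ℂ) = f (ofComplex z) := (eq_coe_zCoord hi).symm
    rw [this]
    have : ‖zMap f z‖ ≠ 0 := norm_ne_zero_iff.mpr hzn
    field_simp

theorem isHyperbolicAt_pull {X : Set (OnePoint ℂ)} {ρ : OnePoint ℂ → ℝ} (hρ : IsCompleteKE X ρ)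
    (hfX : ∀ τ, f τ ∈ X) (τ : ℍ) : IsHyperbolicAt (pull ρ f) τ := by
  have hX := hfX τ
  by_cases hi : f τ = OnePoint.infty
  · rw [hi] at hX
    have hw : wMap f τ = 0 := by rw [wMap, UpperHalfPlane.ofComplex_apply, hi]; rfl
    have hpos : 0 < wDensity ρ 0 := by rw [wDensity, if_pos rfl]; exact hρ.pos _ hX
    refine IsHyperbolicAt.pullback (g := wMap f) (hf.analyticAt_wMap (by
      rw [hi]; exact (OnePoint.coe_ne_infty _).symm)) (hf.deriv_wMap_ne τ hi) ?_
      (hf.pull_of_eq_infty ρ hi)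
    rw [hw, isHyperbolicAt_iff hpos]
    exact ⟨hρ.smooth_infty hX, hρ.curvature_infty hX⟩
  · have hz : ((zMap f τ : ℂ) : OnePoint ℂ) = f τ := by
      rw [zMap, UpperHalfPlane.ofComplex_apply, ← eq_coe_zCoord hi]
    rw [← hz] at hX
    refine IsHyperbolicAt.pullback (σ := fun z : ℂ => ρ z) (g := zMap f) (hf.analyticAt_zMap hi)
      (hf.deriv_zMap_ne τ hi) ?_ (hf.pull_of_ne_infty ρ hi)
    rw [isHyperbolicAt_iff (hρ.pos _ hX)]
    exact ⟨hρ.smooth _ hX, hρ.curvature _ hX⟩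

theorem pull_pos {ρ : OnePoint ℂ → ℝ} (τ : ℍ) (h : 0 < ρ (f τ)) : 0 < pull ρ f τ := by
  rw [pull, UpperHalfPlane.ofComplex_apply]
  split_ifs with hi
  · exact mul_pos h (norm_pos_iff.mpr (hf.deriv_wMap_ne τ hi))
  · exact mul_pos h (norm_pos_iff.mpr (hf.deriv_zMap_ne τ hi))

end IsImmersion

/-- The second factor does not involve ρ, so metrics can be compared through their pullbacks. -/
theorem pull_eq_mul (ρ : OnePoint ℂ → ℝ) (f : ℍ → OnePoint ℂ) (τ : ℍ) :
    pull ρ f τ = ρ (f τ) * pull (fun _ => 1) f τ := by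
  rw [pull, pull, UpperHalfPlane.ofComplex_apply]
  split_ifs <;> simp

/-- The modular group acts by hyperbolic isometries. -/
theorem exists_hasDerivAt_smul (γ : Matrix.SpecialLinearGroup (Fin 2) ℤ) (τ : ℍ) : ∃ (G : ℂ → ℂ) (G' : ℂ),
    HasDerivAt G G' τ ∧ G τ = ↑(γ • τ) ∧ (γ • τ).im = ‖G'‖ * τ.im ∧
      ∀ᶠ z in 𝓝 (τ : ℂ), G z = ↑(γ • ofComplex z) := by
  set a : ℝ := algebraMap ℤ ℝ (γ 0 0)
  set b : ℝ := algebraMap ℤ ℝ (γ 0 1)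
  set c : ℝ := algebraMap ℤ ℝ (γ 1 0)
  set d : ℝ := algebraMap ℤ ℝ (γ 1 1)
  have hdet : (a : ℂ) * d - b * c = 1 := by
    have := γ.det_coe
    rw [Matrix.det_fin_two] at this
    simp only [a, b, c, d, eq_intCast]
    exact_mod_cast this
  have hden : (c : ℂ) * τ + d ≠ 0 := by
    have := UpperHalfPlane.denom_ne_zero (Matrix.SpecialLinearGroup.mapGL ℝ γ) τ
    simpa [UpperHalfPlane.denom, c, d] using this
  have him := ModularGroup.im_smul_eq_div_normSq γ τ
  refine ⟨fun z => (a * z + b) / (c * z + d), 1 / (c * τ + d) ^ 2, ?_, ?_, ?_, ?_⟩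
  · have h := ((((hasDerivAt_id (τ : ℂ)).const_mul (a : ℂ)).add_const (b : ℂ)).div
      (((hasDerivAt_id (τ : ℂ)).const_mul (c : ℂ)).add_const (d : ℂ)) hden)
    refine h.congr_deriv ?_
    simp only [id]
    congr 1
    linear_combination hdet
  · exact (UpperHalfPlane.coe_specialLinearGroup_apply γ τ).symm
  · rw [him, norm_div, norm_one, norm_pow, ← Complex.normSq_eq_norm_sq, div_eq_mul_one_div, mul_comm]
    congr 3
  · filter_upwards [eventually_im_pos_nhds τ.im_pos] with z hz
    rw [UpperHalfPlane.coe_specialLinearGroup_apply, UpperHalfPlane.ofComplex_apply_of_im_pos hz]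

/-- The factor ‖G'‖ that the chain rule produces is also the ratio of the imaginary parts. -/
theorem pull_smul {f : ℍ → OnePoint ℂ} (hf : IsImmersion f) (ρ : OnePoint ℂ → ℝ)
    (γ : Matrix.SpecialLinearGroup (Fin 2) ℤ) (τ : ℍ) :
    τ.im * pull ρ (fun τ => f (γ • τ)) τ = (γ • τ).im * pull ρ f ↑(γ • τ) := by
  obtain ⟨G, G', hG, hGτ, him, hev⟩ := exists_hasDerivAt_smul γ τ
  have key : ∀ {C : OnePoint ℂ → ℂ}, DifferentiableAt ℂ (fun z => C (f (ofComplex z))) ↑(γ • τ) →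
      ‖deriv (fun z => C (f (γ • ofComplex z))) τ‖ =
        ‖deriv (fun z => C (f (ofComplex z))) ↑(γ • τ)‖ * ‖G'‖ := by
    intro C hC
    rw [← hGτ] at hC ⊢
    rw [← norm_mul, ← (hC.hasDerivAt.comp _ hG).deriv]
    congr 1
    refine Filter.EventuallyEq.deriv_eq ?_
    filter_upwards [hev] with z hz
    simp only [Function.comp, hz, UpperHalfPlane.ofComplex_apply]
  rw [pull, pull, UpperHalfPlane.ofComplex_apply, UpperHalfPlane.ofComplex_apply, him]
  split_ifs with hi
  · have := key ((hf.holomorphic.2 (γ • τ)).2 hi)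
    rw [show wMap (fun τ => f (γ • τ)) = fun z => wCoord (f (γ • ofComplex z)) from rfl, this]
    change _ = _ * (_ * ‖deriv (fun z => wCoord (f (ofComplex z))) ↑(γ • τ)‖)
    ring
  · have := key ((hf.holomorphic.2 (γ • τ)).1 hi)
    rw [show zMap (fun τ => f (γ • τ)) = fun z => zCoord (f (γ • ofComplex z)) from rfl, this]
    change _ = _ * (_ * ‖deriv (fun z => zCoord (f (ofComplex z))) ↑(γ • τ)‖)
    ring

/-! ### The hyperbolic metric -/

open Classical in
/-- The density on the sphere whose pullback by `f` is the hyperbolic metric. -/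
def hypDensity (f : ℍ → OnePoint ℂ) (p : OnePoint ℂ) : ℝ :=
  if h : ∃ τ, f τ = p then 1 / (h.choose.im * pull (fun _ => 1) f h.choose) else 1

/-- The preimage chosen in `hypDensity` does not matter: two preimages differ by an element of Γ(2),
under which the product of the imaginary part with the pulled back density is invariant. -/
theorem pull_hypDensity {f : ℍ → OnePoint ℂ} (hf : IsImmersion f) (hfib : FibresAreGammaTwoOrbits f)
    (τ : ℍ) : pull (hypDensity f) f τ = 1 / τ.im := by
  have h : ∃ τ', f τ' = f τ := ⟨τ, rfl⟩
  have h1 := h.choose_spec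
  rw [pull_eq_mul, hypDensity, dif_pos h]
  set τ' := h.choose
  obtain ⟨γ, hγ, hτ'⟩ := (hfib τ τ').mp h1.symm
  have h2 := pull_smul hf (fun _ => 1) γ τ
  have h3 : (fun τ => f (γ • τ)) = f := funext fun τ => ((hfib _ _).mpr ⟨γ, hγ, rfl⟩).symm
  rw [h3, hτ'] at h2
  rw [← h2]
  have h4 := hf.pull_pos (ρ := fun _ => 1) τ one_pos
  have h5 := τ.im_pos
  field_simp

theorem pull_hypDensity_eventuallyEq {f : ℍ → OnePoint ℂ} (hf : IsImmersion f)
    (hfib : FibresAreGammaTwoOrbits f) (τ : ℍ) :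
    pull (hypDensity f) f =ᶠ[𝓝 (τ : ℂ)] fun z => 1 / z.im := by
  filter_upwards [eventually_im_pos_nhds τ.im_pos] with z hz
  exact pull_hypDensity hf hfib ⟨z, hz⟩

theorem isHyperbolicAt_pull_hypDensity {f : ℍ → OnePoint ℂ} (hf : IsImmersion f)
    (hfib : FibresAreGammaTwoOrbits f) (τ : ℍ) : IsHyperbolicAt (pull (hypDensity f) f) τ :=
  IsHyperbolicAt.pullback (g := id) analyticAt_id (by simp) (isHyperbolicAt_inv_im τ.im_pos) (by
    filter_upwards [pull_hypDensity_eventuallyEq hf hfib τ] with z hz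
    rw [hz]; simp)

theorem isHyperbolicAt_hypDensity {f : ℍ → OnePoint ℂ} (hf : IsImmersion f)
    (hfib : FibresAreGammaTwoOrbits f) {z : ℂ} (hz : (z : OnePoint ℂ) ∈ Set.range f) :
    IsHyperbolicAt (fun z : ℂ => hypDensity f z) z := by
  obtain ⟨τ, hτ⟩ := hz
  have hi : f τ ≠ OnePoint.infty := by rw [hτ]; exact OnePoint.coe_ne_infty z
  have h := IsHyperbolicAt.of_pullback (σ := fun z : ℂ => hypDensity f z)
    (hf.analyticAt_zMap hi) (hf.deriv_zMap_ne τ hi)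
    (isHyperbolicAt_pull_hypDensity hf hfib τ) (hf.pull_of_ne_infty _ hi)
  rwa [zMap, UpperHalfPlane.ofComplex_apply, hτ] at h

theorem isHyperbolicAt_hypDensity_infty {f : ℍ → OnePoint ℂ} (hf : IsImmersion f)
    (hfib : FibresAreGammaTwoOrbits f) (hz : OnePoint.infty ∈ Set.range f) :
    IsHyperbolicAt (wDensity (hypDensity f)) 0 := by
  obtain ⟨τ, hi⟩ := hz
  have h0 : f τ ≠ ((0 : ℂ) : OnePoint ℂ) := by rw [hi]; exact (OnePoint.coe_ne_infty _).symm
  have h := IsHyperbolicAt.of_pullback (σ := wDensity (hypDensity f))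
    (hf.analyticAt_wMap h0) (hf.deriv_wMap_ne τ hi)
    (isHyperbolicAt_pull_hypDensity hf hfib τ) (hf.pull_of_eq_infty _ hi)
  rwa [wMap, UpperHalfPlane.ofComplex_apply, hi] at h

/-! ### Lifting curves -/

theorem speed_eq_pull {f : ℍ → OnePoint ℂ} (hf : IsImmersion f) (ρ : OnePoint ℂ → ℝ)
    {γ : ℝ → OnePoint ℂ} {c : ℝ → ℂ} {c' : ℂ} {t : ℝ} (hc : HasDerivAt c c' t) (hpos : 0 < (c t).im)
    (hγ : ∀ᶠ s in 𝓝 t, γ s = f (ofComplex (c s))) : speed ρ γ t = pull ρ f (c t) * ‖c'‖ := by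
  have hγt := hγ.self_of_nhds
  have hct : c t = ((⟨c t, hpos⟩ : ℍ) : ℂ) := rfl
  have key : ∀ {C : OnePoint ℂ → ℂ}, DifferentiableAt ℂ (fun z => C (f (ofComplex z))) (c t) →
      ‖deriv (fun s => C (γ s)) t‖ = ‖deriv (fun z => C (f (ofComplex z))) (c t)‖ * ‖c'‖ := by
    intro C hC
    have h := (hC.hasDerivAt.comp t hc)
    rw [← norm_mul, ← h.deriv]
    congr 1
    refine Filter.EventuallyEq.deriv_eq ?_
    filter_upwards [hγ] with s hs
    rw [hs]; rfl
  have hof : ofComplex (c t) = ⟨c t, hpos⟩ := UpperHalfPlane.ofComplex_apply_of_im_pos hpos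
  rw [speed, pull, hγt]
  split_ifs with hi
  · rw [hof] at hi
    rw [key ((hf.holomorphic.2 ⟨c t, hpos⟩).2 hi), mul_assoc]; rfl
  · rw [hof] at hi
    rw [key ((hf.holomorphic.2 ⟨c t, hpos⟩).1 hi), mul_assoc]; rfl

/-- Path lifting provides a continuous lift. In a coordinate it is a local inverse of f applied to
γ, hence continuously differentiable on the interval; beyond the endpoints it is extended by
constants. -/
theorem exists_lift {X : Set (OnePoint ℂ)} {f : ℍ → OnePoint ℂ} (hf : IsImmersion f)
    (hcov : IsHolomorphicCovering X f) {p q : OnePoint ℂ} {γ : ℝ → OnePoint ℂ}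
    (hγ : IsCurve X p q γ) {τ : ℍ} (hτ : f τ = p) :
    ∃ c : ℝ → ℂ, ContDiffOn ℝ 1 c (Set.Icc 0 1) ∧ c 0 = τ ∧
      (∀ t ∈ Set.Icc (0 : ℝ) 1, 0 < (c t).im) ∧
      ∀ t ∈ Set.Icc (0 : ℝ) 1, γ t = f (ofComplex (c t)) := by
  let γX : C(unitInterval, X) := ⟨fun t => ⟨γ t, hγ.mem t t.2⟩, by
    refine Continuous.subtype_mk (continuous_iff_continuousAt.mpr fun t => ?_) _
    exact (hγ.isC1 t t.2).1.comp continuous_subtype_val.continuousAt⟩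
  have h0 : γX 0 = Set.codRestrict f X (fun τ => hcov.range_eq ▸ Set.mem_range_self τ) τ := by
    apply Subtype.ext
    change γ 0 = f τ
    rw [hγ.source, hτ]
  set Γ := hcov.covering.liftPath γX τ h0
  have hΓ : ∀ t : unitInterval, f (Γ t) = γ t := fun t =>
    congrArg Subtype.val (congrFun (hcov.covering.liftPath_lifts γX τ h0) t)
  have hΓ0 : Γ 0 = τ := hcov.covering.liftPath_zero γX τ h0
  set c : ℝ → ℂ := fun t => ((Γ (Set.projIcc 0 1 zero_le_one t) : ℍ) : ℂ) with hc
  have hcc : Continuous c :=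
    UpperHalfPlane.continuous_coe.comp (Γ.continuous.comp continuous_projIcc)
  have hcγ : ∀ t ∈ Set.Icc (0 : ℝ) 1, γ t = f (ofComplex (c t)) := fun t ht => by
    rw [hc]
    simp only [UpperHalfPlane.ofComplex_apply, hΓ, Set.projIcc_of_mem _ ht]
  have hlift : ∀ {C : OnePoint ℂ → ℂ} {t : ℝ}, t ∈ Set.Icc (0 : ℝ) 1 →
      AnalyticAt ℂ (fun z => C (f (ofComplex z))) (c t) →
      deriv (fun z => C (f (ofComplex z))) (c t) ≠ 0 → ContDiffAt ℝ 1 (fun s => C (γ s)) t →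
      ContDiffWithinAt ℝ 1 c (Set.Icc 0 1) t := by
    intro C t ht ha hd hC
    obtain ⟨Q, hQ, -, -, hleft⟩ := exists_local_inverse ha hd
    have h1 : ContDiffAt ℝ 1 (fun s => Q (C (γ s))) t := by
      refine ContDiffAt.comp t ?_ hC
      have := (hQ.contDiffAt (n := 1)).restrict_scalars ℝ
      rwa [← hcγ t ht] at this
    refine h1.contDiffWithinAt.congr_of_eventuallyEq ?_ ?_
    · have h2 := (hcc.tendsto t).eventually hleft
      filter_upwards [nhdsWithin_le_nhds h2, self_mem_nhdsWithin] with s hs hs'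
      rw [hcγ s hs', hs]
    · rw [hcγ t ht, hleft.self_of_nhds]
  refine ⟨c, fun t ht => ?_, ?_, fun t _ => UpperHalfPlane.im_pos _, hcγ⟩
  · have hct := hcγ t ht
    by_cases hi : γ t = OnePoint.infty
    · have hi' : f (Γ (Set.projIcc 0 1 zero_le_one t)) = OnePoint.infty := by
        rw [← hi, hct, hc]; simp only [UpperHalfPlane.ofComplex_apply]
      refine hlift (C := wCoord) ht (hf.analyticAt_wMap ?_) (hf.deriv_wMap_ne _ hi')
        ((hγ.isC1 t ht).2.2 hi)
      rw [hi']; exact (OnePoint.coe_ne_infty _).symm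
    · have hi' : f (Γ (Set.projIcc 0 1 zero_le_one t)) ≠ OnePoint.infty := by
        rw [hct, hc] at hi; simpa only [UpperHalfPlane.ofComplex_apply] using hi
      exact hlift (C := zCoord) ht (hf.analyticAt_zMap hi') (hf.deriv_zMap_ne _ hi')
        ((hγ.isC1 t ht).2.1 hi)
  · rw [hc]
    simp only [Set.projIcc_left]
    exact congrArg _ hΓ0

open MeasureTheory in
/-- A curve of hyperbolic length at most `L` in the upper half plane does not go far. -/
theorem hyperbolic_length_bounds {c : ℝ → ℂ} (hc : ContDiffOn ℝ 1 c (Set.Icc 0 1))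
    (hpos : ∀ t ∈ Set.Icc (0 : ℝ) 1, 0 < (c t).im) {L : ℝ} (hL : 0 ≤ L)
    (hlen : ∫⁻ t in Set.Icc (0 : ℝ) 1, ENNReal.ofReal (‖deriv c t‖ / (c t).im) ≤ ENNReal.ofReal L) :
    |Real.log (c 1).im - Real.log (c 0).im| ≤ L ∧
      ‖c 1 - c 0‖ ≤ L * (Real.exp L * (c 0).im) := by
  have hlog : ∀ t ∈ Set.Icc (0 : ℝ) 1, |Real.log (c t).im - Real.log (c 0).im| ≤ L := by
    intro t ht
    have hsub : Set.Icc 0 t ⊆ Set.Icc (0 : ℝ) 1 := Set.Icc_subset_Icc_right ht.2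
    have hcd : ContDiffOn ℝ 1 (fun t => Real.log (c t).im) (Set.Icc 0 t) :=
      ContDiffOn.log ((Complex.imCLM.contDiff.comp_contDiffOn hc).mono hsub)
        fun s hs => (hpos s (hsub hs)).ne'
    have h1 := enorm_sub_le_lintegral_deriv_of_contDiffOn_Icc hcd ht.1
    have h2 : ∫⁻ x in Set.Icc 0 t, ‖deriv (fun t => Real.log (c t).im) x‖ₑ ≤
        ∫⁻ x in Set.Icc 0 t, ENNReal.ofReal (‖deriv c x‖ / (c x).im) := by
      -- In the interior the derivative is two-sided; the endpoints have measure zero.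
      rw [← restrict_Ioo_eq_restrict_Icc]
      refine setLIntegral_mono' measurableSet_Ioo fun x hx => ?_
      have hx' : x ∈ Set.Ioo (0 : ℝ) 1 := ⟨hx.1, hx.2.trans_le ht.2⟩
      have hd : HasDerivAt c (deriv c x) x :=
        ((hc.differentiableOn one_ne_zero).differentiableAt
          (Icc_mem_nhds hx'.1 hx'.2)).hasDerivAt
      have hp := hpos x (Set.Ioo_subset_Icc_self hx')
      have hd2 : HasDerivAt (fun t => Real.log (c t).im) ((deriv c x).im / (c x).im) x :=
        HasDerivAt.log (Complex.imCLM.hasFDerivAt.comp_hasDerivAt x hd) hp.ne'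
      rw [hd2.deriv, ← ofReal_norm]
      refine ENNReal.ofReal_le_ofReal ?_
      rw [norm_div, Real.norm_of_nonneg hp.le]
      exact div_le_div_of_nonneg_right (Complex.abs_im_le_norm _) hp.le
    have h3 := h1.trans (h2.trans ((lintegral_mono_set hsub).trans hlen))
    rw [← ofReal_norm, ENNReal.ofReal_le_ofReal_iff hL] at h3
    exact h3
  have hp0 := hpos 0 (by simp)
  refine ⟨hlog 1 (by simp), ?_⟩
  -- The height bound converts hyperbolic length into Euclidean length.
  have him : ∀ t ∈ Set.Icc (0 : ℝ) 1, (c t).im ≤ Real.exp L * (c 0).im := by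
    intro t ht
    have h1 := (abs_le.mp (hlog t ht)).2
    rw [← Real.log_div (hpos t ht).ne' hp0.ne', Real.log_le_iff_le_exp (div_pos (hpos t ht) hp0),
      div_le_iff₀ hp0] at h1
    exact h1
  have h1 := enorm_sub_le_lintegral_deriv_of_contDiffOn_Icc hc zero_le_one
  have hK : 0 ≤ Real.exp L * (c 0).im := by positivity
  have h2 : ∫⁻ x in Set.Icc (0 : ℝ) 1, ‖deriv c x‖ₑ ≤
      ∫⁻ x in Set.Icc (0 : ℝ) 1, ENNReal.ofReal (‖deriv c x‖ / (c x).im) *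
        ENNReal.ofReal (Real.exp L * (c 0).im) := by
    refine setLIntegral_mono' measurableSet_Icc fun x hx => ?_
    have hp := hpos x hx
    rw [← ENNReal.ofReal_mul (by positivity), ← ofReal_norm]
    refine ENNReal.ofReal_le_ofReal ?_
    rw [div_mul_eq_mul_div, le_div_iff₀ hp]
    exact mul_le_mul_of_nonneg_left (him x hx) (norm_nonneg _)
  rw [lintegral_mul_const' _ _ ENNReal.ofReal_ne_top] at h2
  have h3 := h1.trans (h2.trans (mul_le_mul_left hlen _))
  rw [← ENNReal.ofReal_mul hL, ← ofReal_norm, ENNReal.ofReal_le_ofReal_iff (by positivity)] at h3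
  exact h3

/-! ### Completeness of the hyperbolic metric -/

theorem exists_lift_near {X : Set (OnePoint ℂ)} {f : ℍ → OnePoint ℂ} (hf : IsImmersion f)
    (hfib : FibresAreGammaTwoOrbits f) (hcov : IsHolomorphicCovering X f) {τ : ℍ} {q : OnePoint ℂ}
    {L : ℝ} (hL : 0 ≤ L) (hdist : pathDist X (hypDensity f) (f τ) q < ENNReal.ofReal L) :
    ∃ τ' : ℍ, f τ' = q ∧ |Real.log τ'.im - Real.log τ.im| ≤ L ∧
      ‖(τ' : ℂ) - τ‖ ≤ L * (Real.exp L * τ.im) := by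
  rw [pathDist] at hdist
  obtain ⟨γ, hγ⟩ := iInf_lt_iff.mp hdist
  obtain ⟨hγc, hlen⟩ := iInf_lt_iff.mp hγ
  obtain ⟨c, hc, hc0, hcpos, hcγ⟩ := exists_lift hf hcov hγc rfl
  have hlen' : ∫⁻ t in Set.Icc (0 : ℝ) 1, ENNReal.ofReal (‖deriv c t‖ / (c t).im) ≤
      ENNReal.ofReal L := by
    refine le_trans (le_of_eq ?_) hlen.le
    rw [length, ← MeasureTheory.restrict_Ioo_eq_restrict_Icc]
    refine MeasureTheory.setLIntegral_congr_fun measurableSet_Ioo fun t ht => ?_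
    have ht' := Set.Ioo_subset_Icc_self ht
    have hd : HasDerivAt c (deriv c t) t :=
      ((hc.differentiableOn one_ne_zero).differentiableAt (Icc_mem_nhds ht.1 ht.2)).hasDerivAt
    rw [speed_eq_pull hf (hypDensity f) hd (hcpos t ht') (by
      filter_upwards [Icc_mem_nhds ht.1 ht.2] with s hs using hcγ s hs)]
    congr 1
    have := pull_hypDensity hf hfib ⟨c t, hcpos t ht'⟩
    change pull (hypDensity f) f (c t) = 1 / (c t).im at this
    rw [this]; ring
  obtain ⟨h1, h2⟩ := hyperbolic_length_bounds hc hcpos hL hlen'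
  rw [hc0] at h1 h2
  refine ⟨⟨c 1, hcpos 1 (by simp)⟩, ?_, h1, h2⟩
  rw [← UpperHalfPlane.ofComplex_apply_of_im_pos, ← hcγ 1 (by simp), hγc.target]

/-- The tail of the sequence lifts to points at bounded hyperbolic distance from one point σ, which
lie in a compact subset K of ℍ. A subsequence of the lifts converges, and every later term has a
lift near a far member of this subsequence, so the whole sequence converges. -/
theorem isCompleteMetric_hypDensity {X : Set (OnePoint ℂ)} {f : ℍ → OnePoint ℂ} (hf : IsImmersion f)
    (hfib : FibresAreGammaTwoOrbits f) (hcov : IsHolomorphicCovering X f) :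
    IsCompleteMetric X (hypDensity f) := by
  intro u hu hcauchy
  obtain ⟨N, hN⟩ := hcauchy (ENNReal.ofReal 1) (by simp)
  have huN := hu N
  rw [← hcov.range_eq] at huN
  obtain ⟨σ, hσ⟩ := huN
  have hlift : ∀ n, ∃ τ : ℍ, f τ = u (N + n) ∧ |Real.log τ.im - Real.log σ.im| ≤ 1 ∧
      ‖(τ : ℂ) - σ‖ ≤ 1 * (Real.exp 1 * σ.im) := fun n =>
    exists_lift_near hf hfib hcov zero_le_one (by rw [hσ]; exact hN N le_rfl (N + n) (by omega))
  choose τ hτu hτlog hτd using hlift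
  set K : Set ℂ := Metric.closedBall σ (1 * (Real.exp 1 * σ.im)) ∩
    {z | Real.exp (-1) * σ.im ≤ z.im} with hK
  have hKc : IsCompact K := (isCompact_closedBall _ _).inter_right
    (isClosed_le continuous_const Complex.continuous_im)
  have hτK : ∀ n, (τ n : ℂ) ∈ K := fun n => by
    refine ⟨by rw [mem_closedBall_iff_norm]; exact hτd n, ?_⟩
    have h1 := (abs_le.mp (hτlog n)).1
    have h2 : Real.log (Real.exp (-1) * σ.im) ≤ Real.log (τ n).im := by
      rw [Real.log_mul (Real.exp_ne_zero _) σ.im_pos.ne', Real.log_exp]; linarith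
    exact (Real.log_le_log_iff (mul_pos (Real.exp_pos _) σ.im_pos) (τ n).im_pos).mp h2
  obtain ⟨z, hz, ψ, hψ, hlim⟩ := hKc.tendsto_subseq hτK
  have hzpos : 0 < z.im := lt_of_lt_of_le (mul_pos (Real.exp_pos _) σ.im_pos) hz.2
  set ζ : ℍ := ⟨z, hzpos⟩ with hζ
  refine ⟨f ζ, hcov.range_eq ▸ Set.mem_range_self ζ, ?_⟩
  intro V hV
  have hV' := (tendsto_comp_ofComplex hf.holomorphic.1 ζ) hV
  obtain ⟨r, hr, hball⟩ := Metric.mem_nhds_iff.mp hV'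
  set B := z.im + 1 with hB
  have hBpos : 0 < B := by linarith
  -- Below height B, a curve of length δ then moves a point by at most r/2 in the Euclidean
  -- distance.
  set δ := min 1 (r / (2 * (Real.exp 1 * B))) with hδ
  have hE := Real.exp_pos 1
  have hδpos : 0 < δ := by positivity
  obtain ⟨N', hN'⟩ := hcauchy (ENNReal.ofReal δ) (by simpa using hδpos)
  have hev : ∀ᶠ k in atTop, ‖(τ (ψ k) : ℂ) - z‖ < min 1 (r / 2) ∧ N' ≤ N + ψ k := by
    refine Filter.Eventually.and ?_ ?_
    · have := Metric.tendsto_nhds.mp hlim (min 1 (r / 2)) (by positivity)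
      simpa only [dist_eq_norm, Function.comp_apply] using this
    · exact (hψ.tendsto_atTop.eventually_ge_atTop N').mono fun k hk => hk.trans (Nat.le_add_left _ _)
  obtain ⟨k, hk, hkN⟩ := hev.exists
  refine Filter.mem_map.mpr ?_
  filter_upwards [eventually_ge_atTop N'] with m hm
  obtain ⟨τ', hτ', -, hd⟩ := exists_lift_near (τ := τ (ψ k)) (q := u m) hf hfib hcov hδpos.le (by
    rw [hτu]; exact hN' _ hkN m hm)
  have him : (τ (ψ k)).im ≤ B := by
    have h1 := (Complex.abs_im_le_norm ((τ (ψ k) : ℂ) - z)).trans (hk.le.trans (min_le_left _ _))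
    rw [Complex.sub_im, UpperHalfPlane.coe_im] at h1
    linarith [(abs_le.mp h1).2]
  have hexp : Real.exp δ ≤ Real.exp 1 := Real.exp_le_exp.mpr (min_le_left _ _)
  have h2 : δ * (Real.exp δ * (τ (ψ k)).im) ≤ r / 2 := by
    calc δ * (Real.exp δ * (τ (ψ k)).im) ≤ (r / (2 * (Real.exp 1 * B))) * (Real.exp 1 * B) := by
          have := (τ (ψ k)).im_pos
          have := min_le_right 1 (r / (2 * (Real.exp 1 * B)))
          gcongr
      _ = r / 2 := by field_simp
  have h3 : (τ' : ℂ) ∈ Metric.ball (ζ : ℂ) r := by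
    rw [mem_ball_iff_norm]
    calc ‖(τ' : ℂ) - z‖ ≤ ‖(τ' : ℂ) - τ (ψ k)‖ + ‖(τ (ψ k) : ℂ) - z‖ := norm_sub_le_norm_sub_add_norm_sub _ _ _
      _ < r / 2 + r / 2 := add_lt_add_of_le_of_lt (hd.trans h2) (hk.trans_le (min_le_right _ _))
      _ = r := by ring
  have h4 := hball h3
  rwa [Set.mem_preimage, UpperHalfPlane.ofComplex_apply, hτ'] at h4

theorem isCompleteKE_hypDensity {X : Set (OnePoint ℂ)} {f : ℍ → OnePoint ℂ} (hf : IsImmersion f)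
    (hfib : FibresAreGammaTwoOrbits f) (hcov : IsHolomorphicCovering X f) :
    IsCompleteKE X (hypDensity f) := by
  have hpos : ∀ p ∈ X, 0 < hypDensity f p := by
    intro p hp
    rw [← hcov.range_eq] at hp
    replace hp : ∃ τ, f τ = p := hp
    rw [hypDensity, dif_pos hp]
    have h1 := hf.pull_pos (ρ := fun _ => 1) hp.choose one_pos
    have h2 := hp.choose.im_pos
    positivity
  have hw : OnePoint.infty ∈ X → 0 < wDensity (hypDensity f) 0 := fun h => by
    rw [wDensity, if_pos rfl]; exact hpos _ h
  refine ⟨hpos, fun z hz => ?_, fun h => ?_, fun z hz => ?_, fun h => ?_,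
    isCompleteMetric_hypDensity hf hfib hcov⟩
  · exact ((isHyperbolicAt_iff (hpos _ hz)).mp
      (isHyperbolicAt_hypDensity hf hfib (hcov.range_eq ▸ hz))).1
  · exact ((isHyperbolicAt_iff (hw h)).mp
      (isHyperbolicAt_hypDensity_infty hf hfib (hcov.range_eq ▸ h))).1
  · exact ((isHyperbolicAt_iff (hpos _ hz)).mp
      (isHyperbolicAt_hypDensity hf hfib (hcov.range_eq ▸ hz))).2
  · exact ((isHyperbolicAt_iff (hw h)).mp
      (isHyperbolicAt_hypDensity_infty hf hfib (hcov.range_eq ▸ h))).2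

/-! ### A modular barrier function -/

/-- The fourth power of the product of the theta constants. -/
def thetaProd (τ : ℂ) : ℂ := theta2 τ ^ 4 * jacobiTheta τ ^ 4 * theta4 τ ^ 4

theorem thetaProd_ne_zero {τ : ℂ} (hτ : 0 < τ.im) : thetaProd τ ≠ 0 :=
  mul_ne_zero (mul_ne_zero (pow_ne_zero _ (theta2_ne_zero hτ)) (pow_ne_zero _ (jacobiTheta_ne_zero hτ)))
    (pow_ne_zero _ (theta4_ne_zero hτ))

theorem analyticAt_thetaProd {τ : ℂ} (hτ : 0 < τ.im) : AnalyticAt ℂ thetaProd τ := by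
  have h : DifferentiableOn ℂ thetaProd {z | 0 < z.im} := fun z hz =>
    ((((differentiableAt_theta2 hz).pow 4).mul ((differentiableAt_jacobiTheta hz).pow 4)).mul
      ((differentiableAt_theta4 hz).pow 4)).differentiableWithinAt
  exact h.analyticAt (isOpen_im_pos.mem_nhds hτ)

/-- An exhaustion function of the modular orbifold. -/
def barrier (z : ℂ) : ℝ := 6 * Real.log (1 / z.im) - 2 * Real.log ‖thetaProd z‖

open scoped MatrixGroups in
-- The product has weight 6 up to sign, so (Im z)⁶ ‖`thetaProd` z‖² is invariant; the barrier is
-- minus its logarithm.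
theorem barrier_smul (γ : SL(2, ℤ)) (τ : ℍ) : barrier ↑(γ • τ) = barrier τ := by
  refine modular_invariant (f := fun τ : ℍ => barrier τ) (fun τ => ?_) (fun τ => ?_) γ τ
  · have h0 : (τ : ℂ) ≠ 0 := UpperHalfPlane.ne_zero τ
    have h1 : thetaProd (-1 / τ) = -(τ : ℂ) ^ 6 * thetaProd τ := by
      rw [thetaProd, thetaProd, theta2_S τ.im_pos, jacobiTheta_S τ.im_pos, theta4_S τ.im_pos]; ring
    have h2 : (-1 / (τ : ℂ)).im = τ.im / ‖(τ : ℂ)‖ ^ 2 := by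
      rw [neg_div, Complex.neg_im, one_div, Complex.inv_im, Complex.normSq_eq_norm_sq, neg_div, neg_neg]
      rfl
    have h3 : 0 < ‖(τ : ℂ)‖ := norm_pos_iff.mpr h0
    have h4 : 0 < ‖thetaProd τ‖ := norm_pos_iff.mpr (thetaProd_ne_zero τ.im_pos)
    have h5 := τ.im_pos
    rw [coe_S_smul, barrier, barrier, h1, h2, norm_mul, norm_neg, norm_pow, one_div_div, UpperHalfPlane.coe_im,
      Real.log_div (by positivity) h5.ne', Real.log_mul (by positivity) h4.ne', Real.log_pow,
      Real.log_pow, one_div, Real.log_inv]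
    push_cast; ring
  · have h1 : thetaProd (τ + 1) = -thetaProd τ := by
      rw [thetaProd, thetaProd, theta2_T, ← theta4, theta4_T]; ring
    rw [coe_T_smul, barrier, barrier, h1, norm_neg]
    simp

theorem contDiffAt_barrier {z : ℂ} (hz : 0 < z.im) : ContDiffAt ℝ 2 barrier z ∧
    Laplacian.laplacian barrier z = 6 * (1 / z.im) ^ 2 := by
  have h1 := isHyperbolicAt_inv_im hz
  have h2 := (analyticAt_thetaProd hz).harmonicAt_log_norm (thetaProd_ne_zero hz)
  have h3 : barrier = (6 : ℝ) • (fun z : ℂ => Real.log (1 / z.im)) +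
      (-2 : ℝ) • fun z => Real.log ‖thetaProd z‖ := by
    funext z; simp only [barrier, Pi.add_apply, Pi.smul_apply, smul_eq_mul]; ring
  have hc1 : ContDiffAt ℝ 2 ((6 : ℝ) • fun z : ℂ => Real.log (1 / z.im)) z :=
    h1.contDiffAt_log.const_smul (6 : ℝ)
  have hc2 : ContDiffAt ℝ 2 ((-2 : ℝ) • fun z => Real.log ‖thetaProd z‖) z := h2.1.const_smul (-2 : ℝ)
  refine ⟨h3 ▸ hc1.add hc2, ?_⟩
  rw [h3, hc1.laplacian_add hc2, InnerProductSpace.laplacian_smul _ h1.contDiffAt_log,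
    InnerProductSpace.laplacian_smul _ h2.1, h1.laplacian_log, h2.2.self_of_nhds]
  simp

theorem tendsto_thetaProd_div : Tendsto (fun τ => thetaProd τ / qpar τ) (comap Complex.im atTop) (𝓝 16) := by
  obtain ⟨U, hU, hU0, -, hlam⟩ := exists_lam_expansion
  have h1 : Tendsto (fun τ => U (qpar τ)) (comap Complex.im atTop) (𝓝 1) := by
    have := hU.continuousAt.tendsto.comp tendsto_qpar
    rwa [hU0] at this
  have h2 : Tendsto (fun τ => 16 * U (qpar τ) * (theta4 τ ^ 12 / (1 - lam τ) ^ 2))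
      (comap Complex.im atTop) (𝓝 (16 * 1 * (1 ^ 12 / (1 - 0) ^ 2))) :=
    (h1.const_mul 16).mul ((tendsto_theta4.pow 12).div ((tendsto_lam.const_sub 1).pow 2) (by norm_num))
  norm_num at h2
  refine h2.congr' ?_
  filter_upwards [eventually_im_pos] with τ hτ
  have h3 : jacobiTheta τ ≠ 0 := jacobiTheta_ne_zero hτ
  have h4 := theta4_ne_zero hτ
  have h5 := qpar_ne_zero τ
  have h6 : theta2 τ ^ 4 = lam τ * jacobiTheta τ ^ 4 := by rw [lam]; field_simp
  rw [one_sub_lam hτ, thetaProd, h6, hlam τ hτ]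
  field_simp

/-- `thetaProd` is asymptotic to 16 q, so -2 log ‖`thetaProd`‖ contributes 2π Im z up to a constant,
which outweighs 6 log (Im z). -/
theorem exists_le_barrier : ∃ Y, ∀ z : ℂ, Y ≤ z.im → z.im ≤ barrier z := by
  obtain ⟨Y, hY⟩ := eventually_comap_im_iff.mp
    (tendsto_thetaProd_div.norm.eventually (gt_mem_nhds (show ‖(16 : ℂ)‖ < 17 by norm_num)))
  refine ⟨max (max Y 1) (6 * Real.log 6 + 2 * Real.log 17), fun z hz => ?_⟩
  have h1 := hY z ((le_max_left _ _).trans ((le_max_left _ _).trans hz))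
  have h2 : 1 ≤ z.im := (le_max_right _ _).trans ((le_max_left _ _).trans hz)
  have h3 : 6 * Real.log 6 + 2 * Real.log 17 ≤ z.im := (le_max_right _ _).trans hz
  have hy : 0 < z.im := by linarith
  have h4 : 0 < ‖thetaProd z‖ := norm_pos_iff.mpr (thetaProd_ne_zero hy)
  have hq : 0 < ‖qpar z‖ := norm_pos_iff.mpr (qpar_ne_zero z)
  rw [norm_div, div_lt_iff₀ hq, norm_qpar] at h1
  have h5 := Real.log_le_log h4 h1.le
  rw [Real.log_mul (by norm_num) (Real.exp_ne_zero _), Real.log_exp] at h5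
  have h6 := Real.log_le_sub_one_of_pos (show 0 < z.im / 6 by positivity)
  rw [Real.log_div hy.ne' (by norm_num)] at h6
  rw [barrier, one_div, Real.log_inv]
  have := Real.pi_gt_three
  nlinarith

open ModularGroup in
theorem exists_barrier_bound : ∃ M, 0 ≤ M ∧ ∀ τ : ℍ, -M ≤ barrier τ := by
  obtain ⟨Y, hY⟩ := exists_le_barrier
  have hc : ContinuousOn (fun τ : ℍ => barrier τ) (truncatedFundamentalDomain Y) :=
    (continuous_iff_continuousAt.mpr fun τ : ℍ => (contDiffAt_barrier τ.im_pos).1.continuousAt.comp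
      UpperHalfPlane.continuous_coe.continuousAt).continuousOn
  obtain ⟨M, hM⟩ := (isCompact_truncatedFundamentalDomain Y).exists_bound_of_continuousOn hc
  refine ⟨max M 0, le_max_right _ _, fun τ => ?_⟩
  obtain ⟨g, hg⟩ := exists_smul_mem_fd τ
  rw [← barrier_smul g τ]
  rcases le_or_gt (g • τ).im Y with h | h
  · have := (abs_le.mp (hM _ ⟨hg, h⟩)).1
    linarith [le_max_left M 0]
  · have := hY ↑(g • τ) h.le
    have := (g • τ).im_pos
    have := le_max_right M 0
    rw [UpperHalfPlane.coe_im] at *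
    linarith

/-! ### Comparison of a metric with the hyperbolic metric -/

/-- The logarithm of the quotient of the hyperbolic density by the pullback of `ρ`. -/
def defect (ρ : OnePoint ℂ → ℝ) (f : ℍ → OnePoint ℂ) (z : ℂ) : ℝ :=
  Real.log (1 / z.im) - Real.log (pull ρ f z)

section

variable {X : Set (OnePoint ℂ)} {ρ : OnePoint ℂ → ℝ} {f : ℍ → OnePoint ℂ} (hf : IsImmersion f)
  (hρ : IsCompleteKE X ρ) (hfX : ∀ τ, f τ ∈ X)
include hf hρ hfX

theorem isHyperbolicAt_pull_of_im_pos {z : ℂ} (hz : 0 < z.im) : IsHyperbolicAt (pull ρ f) z :=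
  hf.isHyperbolicAt_pull hρ hfX ⟨z, hz⟩

theorem pull_mul_im_le_one {z : ℂ} (hz : 0 < z.im) : pull ρ f z * z.im ≤ 1 :=
  mul_im_le_one_of_curvature (fun _ h => (isHyperbolicAt_pull_of_im_pos hf hρ hfX h).pos)
    (fun _ h => ContDiffAt.two_of_smooth (isHyperbolicAt_pull_of_im_pos hf hρ hfX h).smooth)
    (fun _ h => (isHyperbolicAt_pull_of_im_pos hf hρ hfX h).laplacian_log) hz

theorem log_pull_le {z : ℂ} (hz : 0 < z.im) : Real.log (pull ρ f z) ≤ Real.log (1 / z.im) :=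
  Real.log_le_log (isHyperbolicAt_pull_of_im_pos hf hρ hfX hz).pos
    ((le_div_iff₀ hz).mpr (pull_mul_im_le_one hf hρ hfX hz))

theorem defect_nonneg {z : ℂ} (hz : 0 < z.im) : 0 ≤ defect ρ f z :=
  sub_nonneg.mpr (log_pull_le hf hρ hfX hz)

theorem contDiffAt_defect {z : ℂ} (hz : 0 < z.im) : ContDiffAt ℝ 2 (defect ρ f) z ∧
    Laplacian.laplacian (defect ρ f) z = (1 / z.im) ^ 2 - pull ρ f z ^ 2 := by
  have h1 := isHyperbolicAt_inv_im hz
  have h2 := isHyperbolicAt_pull_of_im_pos hf hρ hfX hz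
  have h3 : defect ρ f = (fun z : ℂ => Real.log (1 / z.im)) - fun z => Real.log (pull ρ f z) := rfl
  refine ⟨h3 ▸ h1.contDiffAt_log.sub h2.contDiffAt_log, ?_⟩
  rw [h3, h1.contDiffAt_log.laplacian_sub h2.contDiffAt_log, h1.laplacian_log, h2.laplacian_log]

theorem defect_eq {z : ℂ} (hz : 0 < z.im) : defect ρ f z = -Real.log (z.im * pull ρ f z) := by
  rw [defect, one_div, Real.log_inv, Real.log_mul hz.ne'
    (isHyperbolicAt_pull_of_im_pos hf hρ hfX hz).pos.ne']
  ring

end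

/-! ### The defect at the cusps -/

theorem defect_smul {X : Set (OnePoint ℂ)} {ρ : OnePoint ℂ → ℝ} {f : ℍ → OnePoint ℂ}
    (γ : Matrix.SpecialLinearGroup (Fin 2) ℤ) (hf : IsImmersion f)
    (hf' : IsImmersion fun τ => f (γ • τ)) (hρ : IsCompleteKE X ρ) (hfX : ∀ τ, f τ ∈ X) (τ : ℍ) :
    defect ρ f ↑(γ • τ) = defect ρ (fun τ => f (γ • τ)) τ := by
  rw [defect_eq hf hρ hfX (γ • τ).im_pos, defect_eq hf' hρ (fun τ => hfX _) τ.im_pos]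
  have := pull_smul hf ρ γ τ
  rw [UpperHalfPlane.coe_im, UpperHalfPlane.coe_im, this]

theorem pull_add_two {f : ℍ → OnePoint ℂ} (hf : ∀ z : ℂ, f (ofComplex (z + 2)) = f (ofComplex z))
    (ρ : OnePoint ℂ → ℝ) (z : ℂ) : pull ρ f (z + 2) = pull ρ f z := by
  have h1 : (fun z => zMap f (z + 2)) = zMap f := funext fun z => by rw [zMap, hf]; rfl
  have h2 : (fun z => wMap f (z + 2)) = wMap f := funext fun z => by rw [wMap, hf]; rfl
  have h3 : deriv (zMap f) (z + 2) = deriv (zMap f) z := by rw [← deriv_comp_add_const, h1]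
  have h4 : deriv (wMap f) (z + 2) = deriv (wMap f) z := by rw [← deriv_comp_add_const, h2]
  rw [pull, pull, hf, h3, h4]

theorem coverMap_T_T (a₁ a₂ a₃ : OnePoint ℂ) (τ : ℍ) :
    coverMap a₁ a₂ a₃ (ModularGroup.T • ModularGroup.T • τ) = coverMap a₁ a₂ a₃ τ := by
  rw [coverMap_T, coverMap_T]

theorem coverMap_ofComplex_add_two (a₁ a₂ a₃ : OnePoint ℂ) (z : ℂ) :
    coverMap a₁ a₂ a₃ (ofComplex (z + 2)) = coverMap a₁ a₂ a₃ (ofComplex z) := by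
  rcases le_or_gt z.im 0 with h | h
  · rw [UpperHalfPlane.ofComplex_apply_eq_of_im_nonpos (w := z + 2) (w' := z) (by simpa using h) h]
  · rw [← coverMap_T_T _ _ _ (ofComplex z)]
    congr 1
    apply UpperHalfPlane.ext
    rw [coe_T_smul, coe_T_smul, UpperHalfPlane.ofComplex_apply_of_im_pos h,
      UpperHalfPlane.ofComplex_apply_of_im_pos (z := z + 2) (by simpa using h)]
    rw [UpperHalfPlane.coe_mk, UpperHalfPlane.coe_mk]; ring

/-- Composition with the modular group permutes the punctures. -/
theorem exists_coverMap_smul (γ : Matrix.SpecialLinearGroup (Fin 2) ℤ) (a₁ a₂ a₃ : OnePoint ℂ) :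
    ∃ b₁ b₂ b₃ : OnePoint ℂ, [b₁, b₂, b₃].Perm [a₁, a₂, a₃] ∧
      ∀ τ, coverMap a₁ a₂ a₃ (γ • τ) = coverMap b₁ b₂ b₃ τ := by
  induction γ using modular_induction with
  | one => exact ⟨a₁, a₂, a₃, List.Perm.refl _, fun τ => by rw [one_smul]⟩
  | hS γ h =>
    obtain ⟨b₁, b₂, b₃, hb, h⟩ := h
    exact ⟨b₂, b₁, b₃, (List.Perm.swap _ _ _).trans hb, fun τ => by rw [mul_smul, h, coverMap_S]⟩
  | hT γ h =>
    obtain ⟨b₁, b₂, b₃, hb, h⟩ := h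
    exact ⟨b₁, b₃, b₂, ((List.Perm.swap _ _ _).cons _).trans hb,
      fun τ => by rw [mul_smul, h, coverMap_T]⟩
  | hT' γ h =>
    obtain ⟨b₁, b₂, b₃, hb, h⟩ := h
    refine ⟨b₁, b₃, b₂, ((List.Perm.swap _ _ _).cons _).trans hb, fun τ => ?_⟩
    rw [mul_smul, h, ← coverMap_T, smul_inv_smul]

open MeasureTheory in
/-- A complete metric of curvature `-1` cannot decay exponentially at the cusp `∞`. -/
theorem not_exponential_decay {a₁ a₂ a₃ : OnePoint ℂ} (h₁₂ : a₁ ≠ a₂) (h₁₃ : a₁ ≠ a₃)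
    (h₂₃ : a₂ ≠ a₃) {ρ : OnePoint ℂ → ℝ} (hρ : IsCompleteKE ({a₁, a₂, a₃}ᶜ) ρ) {ε : ℝ} (hε : 0 < ε)
    (h : ∀ z : ℂ, 1 ≤ z.im →
      pull ρ (coverMap a₁ a₂ a₃) z ≤ Real.exp (-ε * (z.im - 1))) : False := by
  set f := coverMap a₁ a₂ a₃ with hf
  have himm : IsImmersion f := isImmersion_coverMap h₁₂ h₁₃ h₂₃
  have hmem : ∀ τ, f τ ∈ ({a₁, a₂, a₃}ᶜ : Set (OnePoint ℂ)) := fun τ =>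
    range_coverMap h₁₂ h₁₃ h₂₃ ▸ Set.mem_range_self τ
  -- The vertical ray is parametrized by v = exp(-ε (Im z - 1)). The density is at most v and the
  -- derivative has norm 1/(εv), so the speed is at most 1/ε. Hence v = 1/(n + 1) gives a Cauchy
  -- sequence, but it converges to the puncture a₁.
  set Z : ℝ → ℂ := fun v => ((1 - Real.log v / ε : ℝ) : ℂ) * Complex.I with hZ
  have hZim : ∀ v, (Z v).im = 1 - Real.log v / ε := fun v => by simp [hZ]
  have hZge : ∀ v, 0 < v → v ≤ 1 → 1 ≤ (Z v).im := fun v h0 h1 => by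
    rw [hZim]
    have := div_nonneg (neg_nonneg.mpr (Real.log_nonpos h0.le h1)) hε.le
    rw [neg_div] at this; linarith
  have hZd : ∀ v, 0 < v → HasDerivAt Z (((-(v⁻¹ / ε) : ℝ) : ℂ) * Complex.I) v := fun v hv => by
    have h1 : HasDerivAt (fun v => 1 - Real.log v / ε) (-(v⁻¹ / ε)) v :=
      ((Real.hasDerivAt_log hv.ne').div_const ε).const_sub 1
    exact h1.ofReal_comp.mul_const Complex.I
  have hZc : ∀ v, 0 < v → ContDiffAt ℝ 1 Z v := fun v hv => by
    have h1 : ContDiffAt ℝ 1 (fun v => 1 - Real.log v / ε) v :=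
      contDiffAt_const.sub ((Real.contDiffAt_log.mpr hv.ne').div_const ε)
    exact (Complex.ofRealCLM.contDiff.contDiffAt.comp v h1).mul contDiffAt_const
  set v : ℕ → ℝ := fun n => 1 / ((n : ℝ) + 1) with hv
  have hv0 : ∀ n, 0 < v n := fun n => by positivity
  have hv1 : ∀ n, v n ≤ 1 := fun n => by
    rw [hv]; simp only
    rw [div_le_one (by positivity)]
    have : (0 : ℝ) ≤ n := Nat.cast_nonneg n
    linarith
  have hvlim : Tendsto v atTop (𝓝 0) := tendsto_one_div_add_atTop_nhds_zero_nat
  have hdist : ∀ m n, pathDist ({a₁, a₂, a₃}ᶜ) ρ (f (ofComplex (Z (v m)))) (f (ofComplex (Z (v n)))) ≤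
      ENNReal.ofReal (|v n - v m| / ε) := by
    intro m n
    set V : ℝ → ℝ := fun s => v m + s * (v n - v m) with hV
    have hVpos : ∀ s ∈ Set.Icc (0 : ℝ) 1, 0 < V s ∧ V s ≤ 1 := fun s hs => by
      have e : V s = (1 - s) * v m + s * v n := by simp only [hV]; ring
      have h1 := hv0 m; have h2 := hv0 n; have h3 := hv1 m; have h4 := hv1 n
      rw [e]
      constructor
      · rcases eq_or_lt_of_le hs.1 with h0 | h0
        · rw [← h0]; simpa using h1
        · have := mul_pos h0 h2
          have := mul_nonneg (sub_nonneg.mpr hs.2) h1.le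
          linarith
      · have := mul_le_mul_of_nonneg_left h3 (sub_nonneg.mpr hs.2)
        have := mul_le_mul_of_nonneg_left h4 hs.1
        linarith
    have hVd : ∀ s, HasDerivAt V (v n - v m) s := fun s => by
      have := ((hasDerivAt_id s).mul_const (v n - v m)).const_add (v m)
      exact this.congr_deriv (one_mul _)
    have hVc : ∀ s, ContDiffAt ℝ 1 V s := fun s => by
      simp only [hV]; fun_prop
    set c : ℝ → ℂ := fun s => Z (V s) with hc
    have hcpos : ∀ s ∈ Set.Icc (0 : ℝ) 1, 0 < (c s).im := fun s hs =>
      lt_of_lt_of_le one_pos (hZge _ (hVpos s hs).1 (hVpos s hs).2)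
    have hcc : ∀ s ∈ Set.Icc (0 : ℝ) 1, ContDiffAt ℝ 1 c s := fun s hs =>
      (hZc _ (hVpos s hs).1).comp s (hVc s)
    have hcurve : IsCurve ({a₁, a₂, a₃}ᶜ) (f (ofComplex (Z (v m)))) (f (ofComplex (Z (v n))))
        (fun s => f (ofComplex (c s))) := by
      refine ⟨?_, ?_, fun s _ => hmem _, fun s hs => ?_⟩
      · simp [hc, hV]
      · simp [hc, hV]
      · set σ : ℍ := ⟨c s, hcpos s hs⟩ with hσ
        have hoσ : ofComplex (c s) = σ := UpperHalfPlane.ofComplex_apply_of_im_pos _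
        refine ⟨?_, fun hi => ?_, fun hi => ?_⟩
        · have h1 := tendsto_comp_ofComplex himm.holomorphic.1 σ
          have h2 : Tendsto c (𝓝 s) (𝓝 (σ : ℂ)) := (hcc s hs).continuousAt
          have := h1.comp h2
          rw [ContinuousAt, hoσ]; exact this
        · simp only [hoσ] at hi
          have := ((himm.analyticAt_zMap hi).contDiffAt (n := 1)).restrict_scalars ℝ
          exact this.comp s (hcc s hs)
        · simp only [hoσ] at hi
          have := ((himm.analyticAt_wMap (τ := σ) (by
            rw [hi]
            exact (OnePoint.coe_ne_infty _).symm)).contDiffAt (n := 1)).restrict_scalars ℝ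
          exact this.comp s (hcc s hs)
    rw [pathDist]
    refine (iInf₂_le (f := fun γ _ => length ρ γ) _ hcurve).trans ?_
    have hspeed : ∀ s ∈ Set.Icc (0 : ℝ) 1, speed ρ (fun s => f (ofComplex (c s))) s ≤
        |v n - v m| / ε := fun s hs => by
      obtain ⟨hp, hp1⟩ := hVpos s hs
      have hd : HasDerivAt c _ s := (hZd (V s) hp).scomp s (hVd s)
      rw [speed_eq_pull himm ρ hd (hcpos s hs) (Eventually.of_forall fun _ => rfl)]
      have h1 := h (c s) (hZge _ hp hp1)
      have h2 : Real.exp (-ε * ((c s).im - 1)) = V s := by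
        rw [hc]; simp only [hZim]
        rw [show -ε * (1 - Real.log (V s) / ε - 1) = Real.log (V s) by field_simp; ring,
          Real.exp_log hp]
      rw [h2] at h1
      have h3 : ‖(v n - v m) • (((-((V s)⁻¹ / ε) : ℝ) : ℂ) * Complex.I)‖ =
          |v n - v m| * ((V s)⁻¹ / ε) := by
        rw [norm_smul, norm_mul, Complex.norm_I, mul_one, Complex.norm_real, norm_neg,
          Real.norm_eq_abs, Real.norm_of_nonneg (by positivity)]
      rw [h3]
      calc pull ρ f (c s) * (|v n - v m| * ((V s)⁻¹ / ε))
          ≤ V s * (|v n - v m| * ((V s)⁻¹ / ε)) := by gcongr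
        _ = |v n - v m| / ε := by field_simp
    rw [length]
    calc ∫⁻ t in Set.Icc (0 : ℝ) 1, ENNReal.ofReal (speed ρ (fun s => f (ofComplex (c s))) t)
        ≤ ∫⁻ t in Set.Icc (0 : ℝ) 1, ENNReal.ofReal (|v n - v m| / ε) :=
          setLIntegral_mono' measurableSet_Icc fun s hs => ENNReal.ofReal_le_ofReal (hspeed s hs)
      _ = ENNReal.ofReal (|v n - v m| / ε) := by simp
  obtain ⟨p, hp, hlim⟩ := hρ.complete (fun n => f (ofComplex (Z (v n)))) (fun n => hmem _) (by
    intro δ hδ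
    have h1 : Tendsto (fun p : ℕ × ℕ => ENNReal.ofReal (|v p.2 - v p.1| / ε)) (atTop ×ˢ atTop)
        (𝓝 0) := by
      have h2 : Tendsto (fun p : ℕ × ℕ => |v p.2 - v p.1| / ε) (atTop ×ˢ atTop) (𝓝 0) := by
        have := ((hvlim.comp tendsto_snd).sub (hvlim.comp tendsto_fst) :
          Tendsto (fun p : ℕ × ℕ => v p.2 - v p.1) (atTop ×ˢ atTop) _).abs.div_const ε
        simpa using this
      simpa using ENNReal.tendsto_ofReal h2
    have h3 := h1.eventually (gt_mem_nhds hδ)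
    rw [prod_atTop_atTop_eq, eventually_atTop] at h3
    obtain ⟨⟨N, N'⟩, hN⟩ := h3
    refine ⟨max N N', fun m hm n hn => (hdist m n).trans_lt (hN (m, n) ?_)⟩
    exact ⟨(le_max_left _ _).trans hm, (le_max_right _ _).trans hn⟩)
  have hlim2 : Tendsto (fun n => f (ofComplex (Z (v n)))) atTop (𝓝 a₁) := by
    refine (tendsto_coverMap h₁₂ h₁₃ h₂₃).comp ?_
    rw [atImInfty, tendsto_comap_iff]
    have h1 : Tendsto (fun n => 1 - Real.log (v n) / ε) atTop atTop := by
      have h2 : Tendsto (fun n => Real.log (v n)) atTop atBot := by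
        refine Real.tendsto_log_nhdsGT_zero.comp ?_
        exact tendsto_nhdsWithin_iff.mpr ⟨hvlim, Eventually.of_forall hv0⟩
      have h3 : Tendsto (fun n => Real.log (v n) / ε) atTop atBot := h2.atBot_div_const hε
      have h4 := tendsto_atTop_add_const_left atTop 1 (tendsto_neg_atBot_atTop.comp h3)
      exact h4.congr fun n => (sub_eq_add_neg _ _).symm
    refine h1.congr fun n => ?_
    have := hZge _ (hv0 n) (hv1 n)
    rw [Function.comp, ← UpperHalfPlane.coe_im,
      UpperHalfPlane.ofComplex_apply_of_im_pos (by linarith), ← hZim]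
  have := tendsto_nhds_unique hlim hlim2
  exact hp (by simp [this])

/-! ### Uniqueness of the complete metric -/

theorem defect_periodic {f : ℍ → OnePoint ℂ}
    (hf : ∀ z : ℂ, f (ofComplex (z + 2)) = f (ofComplex z)) (ρ : OnePoint ℂ → ℝ) (z : ℂ) (n : ℤ) :
    defect ρ f (z + n * 2) = defect ρ f z := by
  have : Function.Periodic (defect ρ f) 2 := fun z => by
    rw [defect, defect, pull_add_two hf, Complex.add_im, Complex.im_ofNat, add_zero]
  exact this.int_mul n z

section

variable {a₁ a₂ a₃ : OnePoint ℂ} (h₁₂ : a₁ ≠ a₂) (h₁₃ : a₁ ≠ a₃) (h₂₃ : a₂ ≠ a₃)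
  {ρ : OnePoint ℂ → ℝ} (hρ : IsCompleteKE ({a₁, a₂, a₃}ᶜ) ρ)
include h₁₂ h₁₃ h₂₃

theorem coverMap_mem (τ : ℍ) : coverMap a₁ a₂ a₃ τ ∈ ({a₁, a₂, a₃}ᶜ : Set (OnePoint ℂ)) :=
  range_coverMap h₁₂ h₁₃ h₂₃ ▸ Set.mem_range_self τ

include hρ

/-- The logarithm of the pullback is subharmonic, periodic and nonpositive at height 1. If it were
below -ε t on horizontal lines of arbitrarily large height t, the maximum principle on strips would
give exponential decay, against completeness. -/
theorem exists_neg_mul_le_log_pull {ε : ℝ} (hε : 0 < ε) : ∃ T, ∀ t ≥ T, ∃ z : ℂ, z.im = t ∧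
    -ε * t ≤ Real.log (pull ρ (coverMap a₁ a₂ a₃) z) := by
  by_contra! H
  have himm := isImmersion_coverMap h₁₂ h₁₃ h₂₃
  have hmem := coverMap_mem h₁₂ h₁₃ h₂₃
  refine not_exponential_decay h₁₂ h₁₃ h₂₃ hρ hε fun z hz => ?_
  obtain ⟨t, ht, hlt⟩ := H (max z.im 2)
  have hzt := (le_max_left _ _).trans ht
  have ht2 := (le_max_right _ _).trans ht
  have hhyp : ∀ z : ℂ, 1 ≤ z.im → IsHyperbolicAt (pull ρ (coverMap a₁ a₂ a₃)) z := fun z hz =>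
    isHyperbolicAt_pull_of_im_pos himm hρ hmem (by linarith)
  rw [← Real.log_le_iff_le_exp (hhyp z hz).pos]
  have key := le_of_laplacian_nonneg_strip (u := fun z => Real.log (pull ρ (coverMap a₁ a₂ a₃) z))
    (a := 1) (b := t) (by linarith)
    (fun z => by simp only [pull_add_two (coverMap_ofComplex_add_two a₁ a₂ a₃)])
    (fun z hz => (hhyp z hz).contDiffAt_log)
    (fun z hz => by rw [(hhyp z hz).laplacian_log]; positivity)
    (m := 0) (n := -ε * t)
    (fun z hz => (log_pull_le himm hρ hmem (by linarith)).trans (by rw [hz]; simp))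
    (fun z hz => (hlt z hz).le) hz hzt
  refine key.trans ?_
  rw [zero_add, sub_zero]
  have h1 : -ε * t / (t - 1) ≤ -ε := by
    rw [div_le_iff₀ (by linarith)]; linarith
  exact mul_le_mul_of_nonneg_right h1 (by linarith)

open MeasureTheory in
-- A Harnack argument. On each high horizontal line some w has log pull ≥ -(ε/4) Im w, and a period
-- translation brings z within distance 1 of w. The defect is nonnegative and subharmonic, so its
-- value is at most 1/π times its integral over the disc of radius 2 around w. There it is at most
-- -log pull, whose integral the mean value inequality at w bounds. The ratio 4 of the areas uses up
-- the factor 1/4.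
theorem exists_defect_le {ε : ℝ} (hε : 0 < ε) : ∃ Y, ∀ z : ℂ, Y ≤ z.im →
    defect ρ (coverMap a₁ a₂ a₃) z ≤ ε * z.im := by
  have himm := isImmersion_coverMap h₁₂ h₁₃ h₂₃
  have hmem := coverMap_mem h₁₂ h₁₃ h₂₃
  obtain ⟨T, hT⟩ := exists_neg_mul_le_log_pull h₁₂ h₁₃ h₂₃ hρ (by positivity : 0 < ε / 4)
  refine ⟨max T 3, fun z hz => ?_⟩
  obtain ⟨w, hw, hlow⟩ := hT z.im ((le_max_left _ _).trans hz)
  have hz3 := (le_max_right _ _).trans hz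
  set n : ℤ := round ((w.re - z.re) / 2) with hn
  rw [← defect_periodic (coverMap_ofComplex_add_two a₁ a₂ a₃) ρ z n]
  set z' := z + n * 2 with hz'
  have hdist : dist z' w ≤ 1 := by
    have h1 : z' - w = ((2 * (n - (w.re - z.re) / 2) : ℝ) : ℂ) := by
      apply Complex.ext
      · simp [hz']; ring
      · simp [hz', hw]
    have h2 := abs_sub_round ((w.re - z.re) / 2)
    rw [dist_eq_norm, h1, Complex.norm_real, Real.norm_eq_abs, abs_mul, abs_two, abs_sub_comm]
    rw [← hn] at h2
    linarith
  have him : ∀ x ∈ Metric.closedBall w 2, 1 ≤ x.im := fun x hx => by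
    have h1 := (Complex.abs_im_le_norm (x - w)).trans (mem_closedBall_iff_norm.mp hx)
    rw [Complex.sub_im] at h1
    have := (abs_le.mp h1).1
    linarith
  have hpos : ∀ x ∈ Metric.closedBall w 2, 0 < x.im := fun x hx => one_pos.trans_le (him x hx)
  have hsub : Metric.closedBall z' 1 ⊆ Metric.closedBall w 2 :=
    Metric.closedBall_subset_closedBall' (by linarith)
  have hsub' : Metric.ball z' 1 ⊆ Metric.ball w 2 := Metric.ball_subset_ball' (by linarith)
  set f := coverMap a₁ a₂ a₃
  have h1 := mul_volume_le_setIntegral (u := defect ρ f) (c := z') zero_le_one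
    (fun x hx => (contDiffAt_defect himm hρ hmem (hpos x (hsub hx))).1)
    (fun x hx => by
      have hx0 := hpos x (hsub hx)
      rw [(contDiffAt_defect himm hρ hmem hx0).2, sub_nonneg]
      exact pow_le_pow_left₀ (isHyperbolicAt_pull_of_im_pos himm hρ hmem hx0).pos.le
        ((le_div_iff₀ hx0).mpr (pull_mul_im_le_one himm hρ hmem hx0)) 2)
  have hint : ∀ {u : ℂ → ℝ}, (∀ x : ℂ, 0 < x.im → ContDiffAt ℝ 2 u x) →
      IntegrableOn u (Metric.ball w 2) := fun {u} hu =>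
    (ContinuousOn.integrableOn_compact (isCompact_closedBall w 2) fun x hx =>
      (hu x (hpos x hx)).continuousAt.continuousWithinAt).mono_set Metric.ball_subset_closedBall
  have hlog : ∀ x : ℂ, 0 < x.im → ContDiffAt ℝ 2 (fun x => Real.log (pull ρ f x)) x := fun x hx =>
    (isHyperbolicAt_pull_of_im_pos himm hρ hmem hx).contDiffAt_log
  have hd := hint fun x hx => (contDiffAt_defect himm hρ hmem hx).1
  have h2 : ∫ x in Metric.ball z' 1, defect ρ f x ≤ ∫ x in Metric.ball w 2, defect ρ f x := by
    refine setIntegral_mono_set hd ?_ (Eventually.of_forall hsub')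
    exact (ae_restrict_iff' measurableSet_ball).mpr (Eventually.of_forall fun x hx =>
      defect_nonneg himm hρ hmem (hpos x (Metric.ball_subset_closedBall hx)))
  have h3 : ∫ x in Metric.ball w 2, defect ρ f x ≤
      ∫ x in Metric.ball w 2, -Real.log (pull ρ f x) := by
    refine setIntegral_mono_on hd (hint hlog).neg measurableSet_ball fun x hx => ?_
    have := him x (Metric.ball_subset_closedBall hx)
    have h4 : Real.log (1 / x.im) ≤ 0 := by
      rw [one_div, Real.log_inv]
      exact neg_nonpos.mpr (Real.log_nonneg this)
    rw [defect]; linarith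
  rw [integral_neg] at h3
  have h4 := mul_volume_le_setIntegral (u := fun x => Real.log (pull ρ f x)) (c := w) zero_le_two
    (fun x hx => hlog x (hpos x hx)) (fun x hx => by
      rw [(isHyperbolicAt_pull_of_im_pos himm hρ hmem (hpos x hx)).laplacian_log]; positivity)
  have him' : z'.im = z.im := by simp [hz']
  have hpi := Real.pi_pos
  have h5 : -(ε / 4) * z.im * (Real.pi * 2 ^ 2) ≤ Real.log (pull ρ f w) * (Real.pi * 2 ^ 2) :=
    mul_le_mul_of_nonneg_right hlow (by positivity)
  have h6 : defect ρ f z' * Real.pi ≤ ε * z.im * Real.pi := by linarith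
  exact le_of_mul_le_mul_right h6 hpi

end

/-- Composition with γ only permutes the punctures, so each cusp is the cusp ∞ for one of finitely
many maps, and one height serves for all of them. -/
theorem exists_defect_smul_le {a₁ a₂ a₃ : OnePoint ℂ} (h₁₂ : a₁ ≠ a₂) (h₁₃ : a₁ ≠ a₃)
    (h₂₃ : a₂ ≠ a₃) {ρ : OnePoint ℂ → ℝ} (hρ : IsCompleteKE ({a₁, a₂, a₃}ᶜ) ρ) {ε : ℝ}
    (hε : 0 < ε) : ∃ Y, ∀ (γ : Matrix.SpecialLinearGroup (Fin 2) ℤ) (τ : ℍ), Y ≤ τ.im →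
      defect ρ (coverMap a₁ a₂ a₃) ↑(γ • τ) ≤ ε * τ.im := by
  classical
  have hset : ∀ {b₁ b₂ b₃ : OnePoint ℂ}, [b₁, b₂, b₃].Perm [a₁, a₂, a₃] →
      b₁ ≠ b₂ ∧ b₁ ≠ b₃ ∧ b₂ ≠ b₃ ∧ ({b₁, b₂, b₃} : Set (OnePoint ℂ)) = {a₁, a₂, a₃} := by
    intro b₁ b₂ b₃ hb
    have h1 : [b₁, b₂, b₃].Nodup := hb.nodup_iff.mpr (by simp [h₁₂, h₁₃, h₂₃])
    simp only [List.nodup_cons, List.mem_cons, List.not_mem_nil, or_false, not_or] at h1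
    refine ⟨h1.1.1, h1.1.2, h1.2.1, Set.ext fun x => ?_⟩
    simpa using hb.mem_iff (a := x)
  have hfin : ∀ l ∈ [a₁, a₂, a₃].permutations.toFinset, ∀ᶠ Y : ℝ in atTop, ∀ b₁ b₂ b₃,
      l = [b₁, b₂, b₃] → ∀ z : ℂ, Y ≤ z.im → defect ρ (coverMap b₁ b₂ b₃) z ≤ ε * z.im := by
    intro l hl
    rw [List.mem_toFinset, List.mem_permutations] at hl
    by_cases h : ∃ b₁ b₂ b₃, l = [b₁, b₂, b₃]
    · obtain ⟨b₁, b₂, b₃, rfl⟩ := h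
      obtain ⟨hb₁, hb₂, hb₃, hb⟩ := hset hl
      obtain ⟨Y, hY⟩ := exists_defect_le hb₁ hb₂ hb₃ (hb.symm ▸ hρ) hε
      filter_upwards [eventually_ge_atTop Y] with Y' hY' c₁ c₂ c₃ hc z hz
      simp only [List.cons.injEq, and_true] at hc
      obtain ⟨rfl, rfl, rfl⟩ := hc
      exact hY z (hY'.trans hz)
    · exact Eventually.of_forall fun Y b₁ b₂ b₃ hb => (h ⟨b₁, b₂, b₃, hb⟩).elim
  obtain ⟨Y, hY⟩ := ((eventually_all_finset _).mpr hfin).exists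
  refine ⟨Y, fun γ τ hτ => ?_⟩
  obtain ⟨b₁, b₂, b₃, hb, hγ⟩ := exists_coverMap_smul γ a₁ a₂ a₃
  obtain ⟨hb₁, hb₂, hb₃, -⟩ := hset hb
  have hfun : (fun τ => coverMap a₁ a₂ a₃ (γ • τ)) = coverMap b₁ b₂ b₃ := funext hγ
  rw [defect_smul γ (isImmersion_coverMap h₁₂ h₁₃ h₂₃)
    (hfun ▸ isImmersion_coverMap hb₁ hb₂ hb₃) hρ (coverMap_mem h₁₂ h₁₃ h₂₃), hfun]
  exact hY _ (by simpa using hb) b₁ b₂ b₃ rfl τ hτ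

open ModularGroup in
open scoped MatrixGroups in
theorem exists_isCompact_or_high (Y : ℝ) : ∃ C : Set ℍ, IsCompact C ∧ ∀ τ : ℍ,
    (∃ γ ∈ CongruenceSubgroup.Gamma 2, γ • τ ∈ C) ∨ ∃ γ : SL(2, ℤ), Y ≤ (γ • τ).im := by
  refine ⟨⋃ q : SL(2, ℤ) ⧸ CongruenceSubgroup.Gamma 2,
    (fun τ => q.out⁻¹ • τ) '' truncatedFundamentalDomain Y, ?_, fun τ => ?_⟩
  · exact isCompact_iUnion fun q =>
      (isCompact_truncatedFundamentalDomain Y).image (continuous_const_smul _)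
  · obtain ⟨g, hg⟩ := exists_smul_mem_fd τ
    rcases le_total (g • τ).im Y with him | him
    · refine Or.inl ⟨(g : SL(2, ℤ) ⧸ CongruenceSubgroup.Gamma 2).out⁻¹ * g, ?_, ?_⟩
      · exact QuotientGroup.eq.mp (QuotientGroup.out_eq' _)
      · refine Set.mem_iUnion.mpr
          ⟨(g : SL(2, ℤ) ⧸ CongruenceSubgroup.Gamma 2), g • τ, ⟨hg, him⟩, ?_⟩
        exact (mul_smul _ _ _).symm
    · exact Or.inr ⟨g, him⟩

section

variable {a₁ a₂ a₃ : OnePoint ℂ} (h₁₂ : a₁ ≠ a₂) (h₁₃ : a₁ ≠ a₃) (h₂₃ : a₂ ≠ a₃)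
  {ρ : OnePoint ℂ → ℝ} (hρ : IsCompleteKE ({a₁, a₂, a₃}ᶜ) ρ)
include h₁₂ h₁₃ h₂₃ hρ

theorem defect_smul_of_mem {γ : Matrix.SpecialLinearGroup (Fin 2) ℤ}
    (hγ : γ ∈ CongruenceSubgroup.Gamma 2) (τ : ℍ) :
    defect ρ (coverMap a₁ a₂ a₃) ↑(γ • τ) = defect ρ (coverMap a₁ a₂ a₃) τ := by
  have himm := isImmersion_coverMap h₁₂ h₁₃ h₂₃
  have hfun : (fun τ => coverMap a₁ a₂ a₃ (γ • τ)) = coverMap a₁ a₂ a₃ :=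
    funext fun τ => ((fibres_coverMap h₁₂ h₁₃ h₂₃ τ (γ • τ)).mpr ⟨γ, hγ, rfl⟩).symm
  rw [defect_smul γ himm (hfun.symm ▸ himm) hρ (coverMap_mem h₁₂ h₁₃ h₂₃), hfun]

/-- V is nonpositive high up in every cusp. So if it is positive somewhere, it attains its maximum,
by compactness modulo Γ(2), and the maximum is bounded by the curvature equation. -/
theorem defect_le_barrier {M : ℝ} (hM0 : 0 ≤ M) (hM : ∀ τ : ℍ, -M ≤ barrier τ) {ε : ℝ}
    (hε : 0 < ε) (hε6 : 6 * ε < 1) (τ : ℍ) : defect ρ (coverMap a₁ a₂ a₃) τ ≤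
      ε * (barrier τ + M) - Real.log (1 - 6 * ε) / 2 := by
  have himm := isImmersion_coverMap h₁₂ h₁₃ h₂₃
  have hmem := coverMap_mem h₁₂ h₁₃ h₂₃
  have hlog : Real.log (1 - 6 * ε) ≤ 0 := Real.log_nonpos (by linarith) (by linarith)
  set f := coverMap a₁ a₂ a₃
  obtain ⟨Y₁, hY₁⟩ := exists_le_barrier
  obtain ⟨Y₂, hY₂⟩ := exists_defect_smul_le h₁₂ h₁₃ h₂₃ hρ hε
  obtain ⟨C, hC, hCY⟩ := exists_isCompact_or_high (max Y₁ Y₂)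
  set V : ℂ → ℝ := fun z => defect ρ f z - ε * barrier z with hV
  have hVc : ∀ τ : ℍ, ContDiffAt ℝ 2 V τ := fun τ =>
    (contDiffAt_defect himm hρ hmem τ.im_pos).1.sub
      (contDiffAt_const.mul (contDiffAt_barrier τ.im_pos).1)
  have hVΔ : ∀ τ : ℍ, Laplacian.laplacian V τ =
      (1 / τ.im) ^ 2 - pull ρ f τ ^ 2 - ε * (6 * (1 / τ.im) ^ 2) := fun τ => by
    have h1 := contDiffAt_defect himm hρ hmem τ.im_pos
    have h2 := contDiffAt_barrier τ.im_pos
    have h3 : V = defect ρ f - ε • barrier := rfl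
    have h4 : ContDiffAt ℝ 2 (ε • barrier) τ := h2.1.const_smul ε
    rw [h3, h1.1.laplacian_sub h4, InnerProductSpace.laplacian_smul _ h2.1, h1.2, h2.2, smul_eq_mul]
    rfl
  have hVinv : ∀ γ ∈ CongruenceSubgroup.Gamma 2, ∀ τ : ℍ, V ↑(γ • τ) = V τ := fun γ hγ τ => by
    simp only [hV]
    rw [barrier_smul, defect_smul_of_mem h₁₂ h₁₃ h₂₃ hρ hγ]
  have hVhigh : ∀ τ : ℍ, (∃ γ : Matrix.SpecialLinearGroup (Fin 2) ℤ, max Y₁ Y₂ ≤ (γ • τ).im) →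
      V τ ≤ 0 := by
    rintro τ ⟨γ, hγ⟩
    have h1 := hY₁ ↑(γ • τ) ((le_max_left _ _).trans hγ)
    have h2 := hY₂ γ⁻¹ (γ • τ) ((le_max_right _ _).trans hγ)
    rw [inv_smul_smul] at h2
    rw [barrier_smul] at h1
    have := mul_le_mul_of_nonneg_left h1 hε.le
    simp only [hV]
    rw [UpperHalfPlane.coe_im] at this
    linarith
  -- At a maximum ΔV ≤ 0 says that (Im σ · pull)² ≥ 1 - 6ε, where 6 is the coefficient in the
  -- Laplacian of the barrier; taking logarithms bounds the defect.
  have hVbound : ∀ σ : ℍ, (∀ τ : ℍ, V τ ≤ V σ) → V σ ≤ ε * M - Real.log (1 - 6 * ε) / 2 := by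
    intro σ hσ
    have hmax : IsLocalMax V σ := by
      filter_upwards [eventually_im_pos_nhds σ.im_pos] with z hz using hσ ⟨z, hz⟩
    have h1 := laplacian_nonpos_of_isLocalMax (hVc σ) hmax
    rw [hVΔ] at h1
    have hp := (isHyperbolicAt_pull_of_im_pos himm hρ hmem σ.im_pos).pos
    have hy : 0 < σ.im := σ.im_pos
    have h2 : 1 - 6 * ε ≤ (σ.im * pull ρ f σ) ^ 2 := by
      have h3 : (1 / σ.im) ^ 2 - pull ρ f σ ^ 2 - ε * (6 * (1 / σ.im) ^ 2) =
          (1 - 6 * ε - (σ.im * pull ρ f σ) ^ 2) / σ.im ^ 2 := by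
        field_simp; ring
      rw [h3, div_nonpos_iff] at h1
      rcases h1 with h1 | h1
      · have : 0 < σ.im ^ 2 := by positivity
        linarith [h1.2]
      · linarith [h1.1]
    have h3 := Real.log_le_log (by linarith) h2
    rw [Real.log_pow] at h3
    have h4 := defect_eq himm hρ hmem σ.im_pos
    rw [UpperHalfPlane.coe_im] at h4
    have h5 := mul_le_mul_of_nonneg_left (hM σ) hε.le
    simp only [hV]
    push_cast at h3
    linarith
  have hVle : V τ ≤ ε * M - Real.log (1 - 6 * ε) / 2 := by
    have hpos : 0 ≤ ε * M := by positivity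
    by_contra! hcon
    have hτ0 : 0 < V τ := by linarith
    have hlow : ∀ σ : ℍ, V τ ≤ V σ → ∃ γ ∈ CongruenceSubgroup.Gamma 2, γ • σ ∈ C := fun σ hσ =>
      (hCY σ).resolve_right fun h => by linarith [hVhigh σ h]
    obtain ⟨γ₀, -, hγ₀C⟩ := hlow τ le_rfl
    obtain ⟨σ, hσC, hσ⟩ := hC.exists_isMaxOn ⟨_, hγ₀C⟩ (f := fun τ : ℍ => V τ)
      (continuous_iff_continuousAt.mpr fun τ : ℍ =>
        (hVc τ).continuousAt.comp UpperHalfPlane.continuous_coe.continuousAt).continuousOn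
    have hglob : ∀ σ' : ℍ, V τ ≤ V σ' → V σ' ≤ V σ := fun σ' h => by
      obtain ⟨γ, hγ, hγC⟩ := hlow σ' h
      rw [← hVinv γ hγ]
      exact hσ hγC
    have hb := hVbound σ fun σ' => by
      rcases le_total (V τ) (V σ') with h | h
      · exact hglob σ' h
      · exact h.trans (hglob τ le_rfl)
    linarith [hglob τ le_rfl]
  simp only [hV] at hVle
  linarith

theorem defect_eq_zero (τ : ℍ) : defect ρ (coverMap a₁ a₂ a₃) τ = 0 := by
  refine le_antisymm ?_ (defect_nonneg (isImmersion_coverMap h₁₂ h₁₃ h₂₃) hρ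
    (coverMap_mem h₁₂ h₁₃ h₂₃) τ.im_pos)
  obtain ⟨M, hM0, hM⟩ := exists_barrier_bound
  have hlim : Tendsto (fun ε : ℝ => ε * (barrier τ + M) - Real.log (1 - 6 * ε) / 2) (𝓝[>] 0)
      (𝓝 0) := by
    have hc : ContinuousAt (fun ε : ℝ => ε * (barrier τ + M) - Real.log (1 - 6 * ε) / 2) 0 := by
      fun_prop (disch := norm_num)
    have := hc.tendsto
    simp only [zero_mul, mul_zero, sub_zero, Real.log_one, zero_div] at this
    exact this.mono_left nhdsWithin_le_nhds
  refine ge_of_tendsto hlim ?_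
  filter_upwards [Ioo_mem_nhdsGT (by norm_num : (0 : ℝ) < 1 / 6)] with ε hε
  exact defect_le_barrier h₁₂ h₁₃ h₂₃ hρ hM0 hM hε.1 (by linarith [hε.2]) τ

theorem pull_eq_inv_im (τ : ℍ) : pull ρ (coverMap a₁ a₂ a₃) τ = 1 / τ.im := by
  have h1 := defect_eq_zero h₁₂ h₁₃ h₂₃ hρ τ
  have hp := (isHyperbolicAt_pull_of_im_pos (isImmersion_coverMap h₁₂ h₁₃ h₂₃) hρ
    (coverMap_mem h₁₂ h₁₃ h₂₃) τ.im_pos).pos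
  exact (Real.log_injOn_pos (Set.mem_Ioi.mpr (one_div_pos.mpr τ.im_pos)) (Set.mem_Ioi.mpr hp)
    (sub_eq_zero.mp h1)).symm

end

theorem eq_of_isCompleteKE {a₁ a₂ a₃ : OnePoint ℂ} (h₁₂ : a₁ ≠ a₂) (h₁₃ : a₁ ≠ a₃)
    (h₂₃ : a₂ ≠ a₃) {ρ ρ' : OnePoint ℂ → ℝ} (hρ : IsCompleteKE ({a₁, a₂, a₃}ᶜ) ρ)
    (hρ' : IsCompleteKE ({a₁, a₂, a₃}ᶜ) ρ') {p : OnePoint ℂ}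
    (hp : p ∈ ({a₁, a₂, a₃}ᶜ : Set (OnePoint ℂ))) : ρ' p = ρ p := by
  rw [← range_coverMap h₁₂ h₁₃ h₂₃] at hp
  obtain ⟨τ, rfl⟩ := hp
  have h1 := pull_eq_inv_im h₁₂ h₁₃ h₂₃ hρ τ
  rw [← pull_eq_inv_im h₁₂ h₁₃ h₂₃ hρ' τ, pull_eq_mul, pull_eq_mul ρ'] at h1
  exact (mul_right_cancel₀ ((isImmersion_coverMap h₁₂ h₁₃ h₂₃).pull_pos (ρ := fun _ => 1) τ
    one_pos).ne' h1).symm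

/-! ### Expansions at a puncture -/

theorem isBigO_sub_affine {g : ℂ → ℂ} (hg : AnalyticAt ℂ g 0) :
    (fun q => g q - (g 0 + deriv g 0 * q)) =O[𝓝 0] fun q => q ^ 2 := by
  set r : ℂ → ℂ := fun q => g q - (g 0 + deriv g 0 * q) with hr
  have hra : AnalyticAt ℂ r 0 := hg.sub (by fun_prop)
  have h2 : ((2 : ℕ) : ℕ∞) ≤ analyticOrderAt r 0 := by
    rw [natCast_le_analyticOrderAt_iff_iteratedDeriv_eq_zero hra]
    intro i hi
    interval_cases i
    · simp [hr]
    · rw [iteratedDeriv_one]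
      have h3 := hg.differentiableAt.hasDerivAt.sub
        (((hasDerivAt_id (0 : ℂ)).const_mul (deriv g 0)).const_add (g 0))
      rw [mul_one, sub_self] at h3
      exact h3.deriv
  obtain ⟨h, hh, hev⟩ := (natCast_le_analyticOrderAt hra).mp h2
  have h4 : (fun q : ℂ => q ^ 2 * h q) =O[𝓝 0] fun q => q ^ 2 * 1 :=
    (isBigO_refl _ _).mul (hh.continuousAt.tendsto.isBigO_one ℂ)
  simp only [mul_one] at h4
  refine h4.congr' (hev.mono fun q hq => ?_) EventuallyEq.rfl
  rw [hq, sub_zero, smul_eq_mul]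

theorem tendsto_log_norm : Tendsto (fun F : ℂ => Real.log ‖F‖) (𝓝[≠] 0) atBot :=
  Real.tendsto_log_nhdsGT_zero.comp tendsto_norm_nhdsNE_zero

/-- The expansion of the quotient of a metric with a cusp by the model metric. -/
theorem isBigO_cusp_quotient {H K : ℂ → ℂ} {c : ℂ} (hH : AnalyticAt ℂ H 0) (hH0 : H 0 = 1)
    (hH1 : deriv H 0 = -c) (hK : AnalyticAt ℂ K 0) (hK0 : K 0 = 1) (hK1 : deriv K 0 = c) :
    (fun F : ℂ => H F * ((Real.log ‖F‖ / (Real.log ‖F‖ - Real.log ‖K F‖) : ℝ) : ℂ) -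
      (1 - (c * F - (((c * F).re / Real.log ‖F‖ : ℝ) : ℂ)))) =O[𝓝[≠] 0] fun F => F ^ 2 := by
  have hR : (fun F => H F - (1 - c * F)) =O[𝓝[≠] 0] fun F => F ^ 2 := by
    have := (isBigO_sub_affine hH).mono (nhdsWithin_le_nhds (s := {0}ᶜ))
    refine this.congr_left fun F => ?_
    rw [hH0, hH1]; ring
  have hlogK : AnalyticAt ℂ (fun F => Complex.log (K F)) 0 :=
    hK.clog (by rw [hK0]; exact Complex.one_mem_slitPlane)
  have hlogK1 : deriv (fun F => Complex.log (K F)) 0 = c := by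
    have := hK.differentiableAt.hasDerivAt.clog (by rw [hK0]; exact Complex.one_mem_slitPlane)
    rw [this.deriv, hK0, hK1, div_one]
  set w : ℂ → ℝ := fun F => Real.log ‖K F‖ with hw
  set s : ℂ → ℝ := fun F => (c * F).re with hs
  set L : ℂ → ℝ := fun F => Real.log ‖F‖ with hL
  have hcF : (fun F : ℂ => c * F) =O[𝓝[≠] 0] fun F => F := (isBigO_refl _ _).const_mul_left c
  have hws : (fun F => w F - s F) =O[𝓝[≠] 0] fun F => F ^ 2 := by
    have h1 := (isBigO_sub_affine hlogK).mono (nhdsWithin_le_nhds (s := {0}ᶜ))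
    refine (IsBigO.of_bound 1 (Eventually.of_forall fun F => ?_)).trans h1
    rw [one_mul, hlogK1, hK0, Complex.log_one, zero_add]
    have := Complex.abs_re_le_norm (Complex.log (K F) - c * F)
    rwa [Complex.sub_re, Complex.log_re] at this
  have hsO : s =O[𝓝[≠] 0] fun F => F :=
    (IsBigO.of_bound 1 (Eventually.of_forall fun F => by
      rw [one_mul]; exact Complex.abs_re_le_norm _)).trans hcF
  have hid : Tendsto (fun F : ℂ => F) (𝓝[≠] 0) (𝓝 0) := tendsto_id.mono_left nhdsWithin_le_nhds
  have hsq : (fun F : ℂ => F ^ 2) =O[𝓝[≠] 0] fun F => F := by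
    have := (isBigO_refl (fun F : ℂ => F) (𝓝[≠] 0)).mul (hid.isBigO_one ℂ)
    exact this.congr (fun F => (sq F).symm) fun F => mul_one F
  have hwO : w =O[𝓝[≠] 0] fun F => F :=
    ((hws.trans hsq).add hsO).congr_left fun F => sub_add_cancel _ _
  have hw0 : Tendsto w (𝓝[≠] 0) (𝓝 0) := hwO.trans_tendsto hid
  have hLt : Tendsto L (𝓝[≠] 0) atBot := tendsto_log_norm
  have hLw : Tendsto (fun F => L F - w F) (𝓝[≠] 0) atBot := by
    have := hLt.atBot_add hw0.neg
    exact this.congr fun F => (sub_eq_add_neg _ _).symm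
  have hLi : (fun F => (L F)⁻¹) =O[𝓝[≠] 0] fun _ => (1 : ℂ) :=
    ((tendsto_inv_atBot_zero.comp hLt).isBigO_one ℂ)
  have hLwi : (fun F => (L F - w F)⁻¹) =O[𝓝[≠] 0] fun _ => (1 : ℂ) :=
    ((tendsto_inv_atBot_zero.comp hLw).isBigO_one ℂ)
  have hS : (fun F => w F * (L F - w F)⁻¹) =O[𝓝[≠] 0] fun F => F :=
    (hwO.mul hLwi).congr_right fun F => mul_one F
  -- This is the error of replacing w/(L - w) by s/L, where L/(L - w) = 1 + w/(L - w). The bounded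
  -- factors 1/L and 1/(L - w) cost nothing.
  have hT : (fun F => (w F - s F) * (L F - w F)⁻¹ + w F * (L F - w F)⁻¹ * (s F * (L F)⁻¹))
      =O[𝓝[≠] 0] fun F => F ^ 2 := by
    refine ((hws.mul hLwi).congr_right fun F => mul_one _).add ?_
    exact (hS.mul (hsO.mul hLi)).congr_right fun F => by ring
  have hSC : (fun F => ((w F * (L F - w F)⁻¹ : ℝ) : ℂ)) =O[𝓝[≠] 0] fun F => F :=
    Complex.isBigO_ofReal_left.mpr hS
  have hTC := Complex.isBigO_ofReal_left.mpr hT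
  have h1 : (fun F => c * F * ((w F * (L F - w F)⁻¹ : ℝ) : ℂ)) =O[𝓝[≠] 0] fun F => F ^ 2 :=
    (hcF.mul hSC).congr_right fun F => (sq F).symm
  have h2 : (fun F => (H F - (1 - c * F)) * (1 + ((w F * (L F - w F)⁻¹ : ℝ) : ℂ)))
      =O[𝓝[≠] 0] fun F => F ^ 2 :=
    (hR.mul ((isBigO_refl (fun _ => (1 : ℂ)) _).add (hSC.trans (hid.isBigO_one ℂ)))).congr_right
      fun F => mul_one _
  -- With S = w/(L - w) and T = S - s/L the difference is T - c F S + (H - (1 - c F))(1 + S).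
  refine ((hTC.sub h1).add h2).congr' ?_ EventuallyEq.rfl
  filter_upwards [hLt.eventually (eventually_lt_atBot 0), hLw.eventually (eventually_lt_atBot 0)]
    with F hF1 hF2
  have hF1' : (L F : ℂ) ≠ 0 := Complex.ofReal_ne_zero.mpr hF1.ne
  have hF2' : (L F : ℂ) - w F ≠ 0 := by exact_mod_cast hF2.ne
  change _ = H F * ((L F / (L F - w F) : ℝ) : ℂ) - (1 - (c * F - ((s F / L F : ℝ) : ℂ)))
  push_cast
  field_simp
  ring

/-- With r the ratio, f - a = A (λ/16) / (1 - r λ). Inserting λ = 16 q U(q) gives W = U / (1 - 16 r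
q U), whose derivative at 0 is -8 + 16 r. -/
theorem exists_coverMap_expansion {a : ℂ} {a₂ a₃ : OnePoint ℂ} (h₂₃ : a₂ ≠ a₃) :
    ∃ W : ℂ → ℂ, AnalyticAt ℂ W 0 ∧ W 0 = 1 ∧ deriv W 0 = 8 * (2 * ratio a a₂ a₃ - 1) ∧
      ∃ Y > 0, ∀ z : ℂ, Y ≤ z.im → coverMap a a₂ a₃ (ofComplex z) =
        ((a + coeffA a a₂ a₃ * (qpar z * W (qpar z)) : ℂ) : OnePoint ℂ) := by
  obtain ⟨U, hU, hU0, hU1, hlam⟩ := exists_lam_expansion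
  have hD := diff_eq_zero_iff.not.mpr h₂₃
  set r := ratio a a₂ a₃ with hr
  have hden : HasDerivAt (fun q => 1 - r * (16 * q * U q)) (-(r * 16)) 0 := by
    have h1 := (((hasDerivAt_id (0 : ℂ)).const_mul 16).mul hU.differentiableAt.hasDerivAt)
    have h2 := (h1.const_mul r).const_sub 1
    exact h2.congr_deriv (by simp [hU0])
  have hdena : AnalyticAt ℂ (fun q => 1 - r * (16 * q * U q)) 0 := by fun_prop
  refine ⟨fun q => U q / (1 - r * (16 * q * U q)), hU.div hdena (by simp), by simp [hU0], ?_, ?_⟩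
  · have := hU.differentiableAt.hasDerivAt.div hden (by simp)
    rw [hU0, hU1] at this
    refine this.deriv.trans ?_
    simp; ring
  · have h1 : ∀ᶠ q in 𝓝 (0 : ℂ), 1 - r * (16 * q * U q) ≠ 0 :=
      hdena.continuousAt.eventually_ne (by simp)
    obtain ⟨Y, hY⟩ := eventually_comap_im_iff.mp (tendsto_qpar.eventually h1)
    refine ⟨max Y 1, by positivity, fun z hz => ?_⟩
    have hz0 : 0 < z.im := by linarith [(le_max_right Y 1).trans hz]
    have hne := hY z ((le_max_left _ _).trans hz)
    rw [← hlam z hz0] at hne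
    have hyD : hy a * diff a₂ a₃ - hy a₃ * diff a₂ a * lam z = diff a₂ a₃ * (1 - r * lam z) := by
      rw [hr, ratio, hy_coe]; field_simp
    rw [coverMap, modularLambda_eq_lam, UpperHalfPlane.ofComplex_apply_of_im_pos hz0]
    change hpt (hx a * diff a₂ a₃ - hx a₃ * diff a₂ a * lam z)
      (hy a * diff a₂ a₃ - hy a₃ * diff a₂ a * lam z) = _
    rw [hyD, hpt_of_ne (mul_ne_zero hD hne)]
    congr 1
    have h2 : qpar z * (U (qpar z) / (1 - r * lam z)) = lam z / 16 / (1 - r * lam z) := by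
      rw [hlam z hz0]; ring
    simp only
    rw [← hlam z hz0, h2, div_eq_iff (mul_ne_zero hD hne), coeffA]
    have h3 : r * diff a₂ a₃ = diff a₂ a * hy a₃ := by rw [hr, ratio]; field_simp
    have h4 : diff (a : OnePoint ℂ) a₃ = a * hy a₃ - hx a₃ := by simp [diff]
    rw [h4, hx_coe]
    have hne' : 1 - lam z * r ≠ 0 := by rwa [mul_comm]
    field_simp
    linear_combination (a * lam z) * h3

theorem coeffA_ne_zero {a₁ a₂ a₃ : OnePoint ℂ} (h₁₂ : a₁ ≠ a₂) (h₁₃ : a₁ ≠ a₃) (h₂₃ : a₂ ≠ a₃) :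
    coeffA a₁ a₂ a₃ ≠ 0 := by
  have h1 := diff_eq_zero_iff.not.mpr h₁₂.symm
  have h2 := diff_eq_zero_iff.not.mpr h₁₃
  have h3 := diff_eq_zero_iff.not.mpr h₂₃
  exact mul_ne_zero (by norm_num) (div_ne_zero (mul_ne_zero h2 h1) h3)

theorem eventually_atImInfty_of_forall {p : ℍ → Prop} {Y : ℝ} (h : ∀ τ : ℍ, Y ≤ τ.im → p τ) :
    ∀ᶠ τ in atImInfty, p τ := by
  filter_upwards [tendsto_comap.eventually (eventually_ge_atTop Y)] with τ hτ using h τ hτ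

/-- B is A times W'(0), and the factor q turns the quadratic error of W into a cubic one. -/
theorem coverMap_isBigO {a : ℂ} {a₂ a₃ : OnePoint ℂ} (h₂₃ : a₂ ≠ a₃) :
    (∀ᶠ τ in atImInfty, coverMap a a₂ a₃ τ ≠ OnePoint.infty) ∧
      (fun τ : ℍ => zCoord (coverMap a a₂ a₃ τ) -
        (a + coeffA a a₂ a₃ * q2 τ + coeffB a a₂ a₃ * q2 τ ^ 2)) =O[atImInfty]
          fun τ : ℍ => q2 τ ^ 3 := by
  obtain ⟨W, hW, hW0, hW1, Y, -, hY⟩ := exists_coverMap_expansion (a := a) h₂₃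
  have hY' : ∀ τ : ℍ, Y ≤ τ.im → coverMap a a₂ a₃ τ =
      ((a + coeffA a a₂ a₃ * (q2 τ * W (q2 τ)) : ℂ) : OnePoint ℂ) := fun τ hτ => by
    have := hY τ hτ
    rwa [UpperHalfPlane.ofComplex_apply] at this
  refine ⟨eventually_atImInfty_of_forall (Y := Y) fun τ hτ => ?_, ?_⟩
  · rw [hY' τ hτ]; exact OnePoint.coe_ne_infty _
  · have hq : Tendsto q2 atImInfty (𝓝 0) := tendsto_qpar.comp tendsto_coe_atImInfty
    have h1 := (isBigO_sub_affine hW).comp_tendsto hq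
    have h2 := ((isBigO_refl q2 atImInfty).mul h1).const_mul_left (coeffA a a₂ a₃)
    refine h2.congr' ?_ (Eventually.of_forall fun τ => ?_)
    · refine eventually_atImInfty_of_forall (Y := Y) fun τ hτ => ?_
      simp only [Function.comp_apply]
      rw [hY' τ hτ, zCoord_coe]
      rw [hW0, hW1, coeffA, coeffB]
      ring
    · simp only [Function.comp_apply]; ring

/-- For small q the point z = log q / (πi) is high, of imaginary part -log‖q‖ / π. There the
pullback of the metric is 1 / Im z, and the derivative of the covering is A (W + q W') πi q; the
factor π cancels. -/
theorem eventually_density_mul_eq_one {a : ℂ} {a₂ a₃ : OnePoint ℂ} (h₁₂ : (a : OnePoint ℂ) ≠ a₂)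
    (h₁₃ : (a : OnePoint ℂ) ≠ a₃) (h₂₃ : a₂ ≠ a₃) {ρ : OnePoint ℂ → ℝ}
    (hρ : IsCompleteKE ({(a : OnePoint ℂ), a₂, a₃}ᶜ) ρ) {W : ℂ → ℂ} (hW : AnalyticAt ℂ W 0)
    {A : ℂ} {Y : ℝ} (hY0 : 0 < Y) (hY : ∀ z : ℂ, Y ≤ z.im → coverMap a a₂ a₃ (ofComplex z) =
      ((a + A * (qpar z * W (qpar z)) : ℂ) : OnePoint ℂ)) :
    ∀ᶠ q in 𝓝[≠] (0 : ℂ), ρ ((a + A * (q * W q) : ℂ) : OnePoint ℂ) *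
      (‖A‖ * ‖W q + q * deriv W q‖ * (‖q‖ * |Real.log ‖q‖|)) = 1 := by
  have hsmall := tendsto_log_norm.eventually (eventually_lt_atBot (-(Real.pi * Y)))
  filter_upwards [hsmall, self_mem_nhdsWithin,
    hW.eventually_analyticAt.filter_mono nhdsWithin_le_nhds] with q hq1 hq0 hWq
  have hpi := Real.pi_pos
  have hpiI : (Real.pi * Complex.I : ℂ) ≠ 0 := by simp [hpi.ne']
  set z : ℂ := Complex.log q / (Real.pi * Complex.I) with hz
  have hqz : qpar z = q := by
    rw [qpar, hz, mul_div_cancel₀ _ hpiI, Complex.exp_log hq0]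
  have him : Real.log ‖q‖ = -(Real.pi * z.im) := by
    rw [← hqz, norm_qpar, Real.log_exp, neg_mul]
  have hYz : Y < z.im := by
    rw [him] at hq1
    exact lt_of_mul_lt_mul_left (neg_lt_neg_iff.mp hq1) hpi.le
  have hz0 : 0 < z.im := hY0.trans hYz
  have h1 : pull ρ (coverMap a a₂ a₃) z = 1 / z.im := pull_eq_inv_im h₁₂ h₁₃ h₂₃ hρ ⟨z, hz0⟩
  have hz1 := hY z hYz.le
  have hev : zMap (coverMap a a₂ a₃) =ᶠ[𝓝 z] fun z => a + A * (qpar z * W (qpar z)) := by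
    filter_upwards [(Complex.continuous_im.tendsto z).eventually (lt_mem_nhds hYz)] with x hx
    rw [zMap, hY x hx.le, zCoord_coe]
  have hd : HasDerivAt (fun z => a + A * (qpar z * W (qpar z)))
      (A * ((W q + q * deriv W q) * (q * (Real.pi * Complex.I)))) z := by
    have h2 := hasDerivAt_qpar z
    have h3 : HasDerivAt W (deriv W q) (qpar z) := by
      rw [hqz]; exact hWq.differentiableAt.hasDerivAt
    have h4 := ((h2.mul (h3.comp z h2)).const_mul A).const_add (a : ℂ)
    refine h4.congr_deriv ?_
    simp only [Function.comp_apply, hqz]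
    ring
  rw [pull, if_neg (by rw [hz1]; exact OnePoint.coe_ne_infty _), hz1, hev.deriv_eq, hd.deriv,
    hqz, eq_div_iff hz0.ne'] at h1
  rw [← h1, him, abs_neg, abs_of_pos (mul_pos hpi hz0)]
  simp only [norm_mul, Complex.norm_I, Complex.norm_real, Real.norm_of_nonneg hpi.le]
  ring

/-- With F = q W(q), inverted by Q, one has log‖q‖ = log‖F‖ - log‖W‖. So the density is the model 1
/ (‖A‖ ‖F‖ |log‖F‖|) times ‖W / (W + q W')‖ and the quotient of the logarithms.
`isBigO_cusp_quotient` applies with H = W / (W + q W'), K = W and the constant 8c, because W'(0) =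
8c while W + q W' has derivative 16c. -/
theorem exists_density_expansion {a : ℂ} {a₂ a₃ : OnePoint ℂ} (h₁₂ : (a : OnePoint ℂ) ≠ a₂)
    (h₁₃ : (a : OnePoint ℂ) ≠ a₃) (h₂₃ : a₂ ≠ a₃) {ρ : OnePoint ℂ → ℝ}
    (hρ : IsCompleteKE ({(a : OnePoint ℂ), a₂, a₃}ᶜ) ρ) :
    ∃ E : ℂ → ℂ, E =O[𝓝[≠] 0] (fun F => F ^ 2) ∧ ∀ᶠ F : ℂ in 𝓝[≠] 0,
      ρ ((a + coeffA a a₂ a₃ * F : ℂ) : OnePoint ℂ) =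
        1 / ‖coeffA a a₂ a₃‖ * (1 / (‖F‖ * |Real.log ‖F‖|)) *
          ‖1 - 8 * ((2 * ratio a a₂ a₃ - 1) * F -
            ((((2 * ratio a a₂ a₃ - 1) * F).re / Real.log ‖F‖ : ℝ) : ℂ)) + E F‖ := by
  obtain ⟨W, hW, hW0, hW1, Y, hY0, hY⟩ := exists_coverMap_expansion (a := a) h₂₃
  have hdens := eventually_density_mul_eq_one h₁₂ h₁₃ h₂₃ hρ hW hY0 hY
  set A := coeffA a a₂ a₃
  set c := 2 * ratio a a₂ a₃ - 1
  set Ψ : ℂ → ℂ := fun q => q * W q with hΨ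
  set D : ℂ → ℂ := fun q => W q + q * deriv W q with hD
  have hΨa : AnalyticAt ℂ Ψ 0 := by fun_prop
  have hΨ0 : Ψ 0 = 0 := zero_mul _
  have hΨd : HasDerivAt Ψ 1 0 :=
    ((hasDerivAt_id (0 : ℂ)).mul hW.differentiableAt.hasDerivAt).congr_deriv (by simp [hW0])
  obtain ⟨Q, hQ, hQ0, hΨQ, -⟩ := exists_local_inverse hΨa (by rw [hΨd.deriv]; exact one_ne_zero)
  rw [hΨ0] at hQ hQ0 hΨQ
  have hQd : HasDerivAt Q 1 0 := by
    have h1 := hQ.differentiableAt.hasDerivAt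
    have hΨd' : HasDerivAt Ψ 1 (Q 0) := by rwa [hQ0]
    have h2 : HasDerivAt (fun F => Ψ (Q F)) (1 * deriv Q 0) 0 := hΨd'.comp (0 : ℂ) h1
    have h3 := (h2.congr_of_eventuallyEq (hΨQ.mono fun F hF => hF.symm)).unique (hasDerivAt_id 0)
    rw [one_mul] at h3
    rwa [h3] at h1
  have hWQ : AnalyticAt ℂ W (Q 0) := by rwa [hQ0]
  have hDa : AnalyticAt ℂ D 0 := hW.add (analyticAt_id.mul hW.deriv)
  have hDQ : AnalyticAt ℂ D (Q 0) := by rwa [hQ0]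
  have hD0 : D 0 = 1 := by simp [hD, hW0]
  have hDd : HasDerivAt D (2 * (8 * c)) 0 := by
    have h1 := hW.differentiableAt.hasDerivAt.add
      ((hasDerivAt_id (0 : ℂ)).mul hW.deriv.differentiableAt.hasDerivAt)
    exact h1.congr_deriv (by simp [hW1]; ring)
  set K : ℂ → ℂ := fun F => W (Q F) with hK
  set H : ℂ → ℂ := fun F => W (Q F) / D (Q F) with hH
  have hKa : AnalyticAt ℂ K 0 := hWQ.comp hQ
  have hK0 : K 0 = 1 := by rw [hK]; simp only [hQ0, hW0]
  have hKd : HasDerivAt K (8 * c) 0 := by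
    have h1 : HasDerivAt W (8 * c) (Q 0) := by
      rw [hQ0, ← hW1]; exact hW.differentiableAt.hasDerivAt
    exact (h1.comp (0 : ℂ) hQd).congr_deriv (mul_one _)
  have hDQd : HasDerivAt (fun F => D (Q F)) (2 * (8 * c)) 0 := by
    have h1 : HasDerivAt D (2 * (8 * c)) (Q 0) := by rw [hQ0]; exact hDd
    exact (h1.comp (0 : ℂ) hQd).congr_deriv (mul_one _)
  have hHa : AnalyticAt ℂ H 0 := hKa.div (hDQ.comp hQ) (by simp [hQ0, hD0])
  have hH0 : H 0 = 1 := by simp [hH, hQ0, hW0, hD0]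
  have hHd : deriv H 0 = -(8 * c) := by
    have h1 : HasDerivAt H _ 0 := hKd.div hDQd (by simp [hQ0, hD0])
    rw [h1.deriv, hK0, hQ0, hD0]
    ring
  have hE := isBigO_cusp_quotient hHa hH0 hHd hKa hK0 hKd.deriv
  refine ⟨_, hE, ?_⟩
  have hQne : Tendsto Q (𝓝[≠] 0) (𝓝[≠] 0) := by
    refine tendsto_nhdsWithin_iff.mpr ⟨?_, ?_⟩
    · have := hQ.continuousAt.tendsto
      rw [hQ0] at this
      exact this.mono_left nhdsWithin_le_nhds
    · filter_upwards [self_mem_nhdsWithin, hΨQ.filter_mono nhdsWithin_le_nhds] with F hF hF' h0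
      refine hF ?_
      rw [Set.mem_singleton_iff] at h0
      rw [← hF', h0, hΨ0]; rfl
  filter_upwards [hQne.eventually hdens, self_mem_nhdsWithin, hΨQ.filter_mono nhdsWithin_le_nhds,
    tendsto_log_norm.eventually (eventually_lt_atBot 0)] with F hF hF0 hΨF hL
  change Q F * W (Q F) = F at hΨF
  rw [hΨF] at hF
  have hF0' : Q F * W (Q F) ≠ 0 := by rw [hΨF]; exact hF0
  have hq0 : ‖Q F‖ ≠ 0 := norm_ne_zero_iff.mpr (left_ne_zero_of_mul hF0')
  have hW0' : ‖W (Q F)‖ ≠ 0 := norm_ne_zero_iff.mpr (right_ne_zero_of_mul hF0')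
  have hlog : Real.log ‖F‖ - Real.log ‖K F‖ = Real.log ‖Q F‖ := by
    conv_lhs => rw [← hΨF]
    rw [norm_mul, Real.log_mul hq0 hW0', hΨF]
    ring
  have hsum : 1 - 8 * (c * F - (((c * F).re / Real.log ‖F‖ : ℝ) : ℂ)) +
      (H F * ((Real.log ‖F‖ / (Real.log ‖F‖ - Real.log ‖K F‖) : ℝ) : ℂ) -
        (1 - (8 * c * F - (((8 * c * F).re / Real.log ‖F‖ : ℝ) : ℂ)))) =
      H F * ((Real.log ‖F‖ / Real.log ‖Q F‖ : ℝ) : ℂ) := by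
    have h8 : (8 * c * F).re = 8 * (c * F).re := by
      rw [mul_assoc]; simp [Complex.mul_re]
    rw [hlog, h8, mul_div_assoc]
    push_cast
    ring
  rw [hsum, hH]
  simp only [norm_mul, norm_div, Complex.norm_real, Real.norm_eq_abs]
  have hn : ‖F‖ = ‖Q F‖ * ‖W (Q F)‖ := by rw [← norm_mul, hΨF]
  have hL' : |Real.log ‖F‖| ≠ 0 := abs_ne_zero.mpr hL.ne
  generalize |Real.log ‖F‖| = L at hL' ⊢
  change ρ _ * (‖A‖ * ‖D (Q F)‖ * (‖Q F‖ * |Real.log ‖Q F‖|)) = 1 at hF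
  rw [hn, eq_div_of_mul_eq (right_ne_zero_of_mul (hF ▸ one_ne_zero)) hF]
  field_simp

theorem density_expansion {a : ℂ} {a₂ a₃ : OnePoint ℂ} (h₁₂ : (a : OnePoint ℂ) ≠ a₂)
    (h₁₃ : (a : OnePoint ℂ) ≠ a₃) (h₂₃ : a₂ ≠ a₃) {ρ : OnePoint ℂ → ℝ}
    (hρ : IsCompleteKE ({(a : OnePoint ℂ), a₂, a₃}ᶜ) ρ) {F : ℂ → ℂ}
    (hF : ∀ z, F z = (z - a) / coeffA a a₂ a₃) :
    ∃ E : ℂ → ℂ, E =O[𝓝[≠] a] (fun z => F z ^ 2) ∧ ∀ᶠ z : ℂ in 𝓝[≠] a,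
      ρ (z : OnePoint ℂ) = 1 / ‖coeffA a a₂ a₃‖ * (1 / (‖F z‖ * |Real.log ‖F z‖|)) *
        ‖1 - 8 * ((2 * ratio a a₂ a₃ - 1) * F z -
          ((((2 * ratio a a₂ a₃ - 1) * F z).re / Real.log ‖F z‖ : ℝ) : ℂ)) + E z‖ := by
  have hA := coeffA_ne_zero h₁₂ h₁₃ h₂₃
  obtain ⟨E, hE, h⟩ := exists_density_expansion h₁₂ h₁₃ h₂₃ hρ
  have hFt : Tendsto F (𝓝[≠] a) (𝓝[≠] 0) := by
    obtain rfl : F = fun z => (z - a) / coeffA a a₂ a₃ := funext hF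
    refine tendsto_nhdsWithin_iff.mpr ⟨?_, ?_⟩
    · have : ContinuousAt (fun z => (z - a) / coeffA a a₂ a₃) a := by fun_prop
      have := this.tendsto
      rw [sub_self, zero_div] at this
      exact this.mono_left nhdsWithin_le_nhds
    · filter_upwards [self_mem_nhdsWithin] with z hz
      exact div_ne_zero (sub_ne_zero.mpr hz) hA
  refine ⟨fun z => E (F z), hE.comp_tendsto hFt, (hFt.eventually h).mono fun z hz => ?_⟩
  have hz' : a + coeffA a a₂ a₃ * F z = z := by rw [hF]; field_simp; ring
  rwa [hz'] at hz

end PuncturedSphere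

end

open PuncturedSphere

theorem corollary8p3 (a₁ a₂ a₃ : OnePoint ℂ) (h₁₂ : a₁ ≠ a₂) (h₁₃ : a₁ ≠ a₃) (h₂₃ : a₂ ≠ a₃) :
    -- the Möbius transform of `λ` is the covering map with these cusp values
    (IsHolomorphicCovering ({a₁, a₂, a₃}ᶜ) (coverMap a₁ a₂ a₃) ∧
      FibresAreGammaTwoOrbits (coverMap a₁ a₂ a₃) ∧
      HasCuspValues (coverMap a₁ a₂ a₃) a₁ a₂ a₃ ∧
      ∀ f : ℍ → OnePoint ℂ, IsHolomorphicCovering ({a₁, a₂, a₃}ᶜ) f →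
        FibresAreGammaTwoOrbits f → HasCuspValues f a₁ a₂ a₃ → f = coverMap a₁ a₂ a₃) ∧
    -- the complete Kähler–Einstein metric exists and is unique
    (∃ ρ : OnePoint ℂ → ℝ, IsCompleteKE ({a₁, a₂, a₃}ᶜ) ρ ∧
      ∀ ρ' : OnePoint ℂ → ℝ, IsCompleteKE ({a₁, a₂, a₃}ᶜ) ρ' →
        ∀ p ∈ ({a₁, a₂, a₃}ᶜ : Set (OnePoint ℂ)), ρ' p = ρ p) ∧
    -- the expansions at a finite puncture `a₁ = a`
    ∀ a : ℂ, a₁ = (a : OnePoint ℂ) →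
      coeffA a₁ a₂ a₃ ≠ 0 ∧
      ((∀ᶠ τ in atImInfty, coverMap a₁ a₂ a₃ τ ≠ OnePoint.infty) ∧
        (fun τ : ℍ => zCoord (coverMap a₁ a₂ a₃ τ) -
            (a + coeffA a₁ a₂ a₃ * q2 τ + coeffB a₁ a₂ a₃ * q2 τ ^ 2))
          =O[atImInfty] fun τ : ℍ => q2 τ ^ 3) ∧
      ∀ ρ : OnePoint ℂ → ℝ, IsCompleteKE ({a₁, a₂, a₃}ᶜ) ρ →
      ∀ F : ℂ → ℂ, (∀ z, F z = (z - a) / coeffA a₁ a₂ a₃) →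
        ∃ E : ℂ → ℂ, E =O[𝓝[≠] a] (fun z => F z ^ 2) ∧
          ∀ᶠ z : ℂ in 𝓝[≠] a,
            ρ (z : OnePoint ℂ) =
              1 / ‖coeffA a₁ a₂ a₃‖ * (1 / (‖F z‖ * |Real.log ‖F z‖|)) *
                ‖1 - 8 * ((2 * ratio a₁ a₂ a₃ - 1) * F z -
                    ((((2 * ratio a₁ a₂ a₃ - 1) * F z).re / Real.log ‖F z‖ : ℝ) : ℂ)) + E z‖ := by
  refine ⟨⟨isHolomorphicCovering_coverMap h₁₂ h₁₃ h₂₃, fibres_coverMap h₁₂ h₁₃ h₂₃,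
    hasCuspValues_coverMap h₁₂ h₁₃ h₂₃, fun f hf hfib hcusp =>
      coverMap_unique h₁₂ h₁₃ h₂₃ hf.holomorphic hf.range_eq hfib hcusp⟩,
    ⟨hypDensity (coverMap a₁ a₂ a₃), ?_, fun ρ' hρ' p hp => ?_⟩, ?_⟩
  · exact isCompleteKE_hypDensity (isImmersion_coverMap h₁₂ h₁₃ h₂₃) (fibres_coverMap h₁₂ h₁₃ h₂₃)
      (isHolomorphicCovering_coverMap h₁₂ h₁₃ h₂₃)
  · exact eq_of_isCompleteKE h₁₂ h₁₃ h₂₃ (isCompleteKE_hypDensity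
      (isImmersion_coverMap h₁₂ h₁₃ h₂₃) (fibres_coverMap h₁₂ h₁₃ h₂₃)
      (isHolomorphicCovering_coverMap h₁₂ h₁₃ h₂₃)) hρ' hp
  · rintro a rfl
    exact ⟨coeffA_ne_zero h₁₂ h₁₃ h₂₃, coverMap_isBigO h₂₃, fun ρ hρ F hF =>
      density_expansion h₁₂ h₁₃ h₂₃ hρ hF⟩
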